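/- Throughout, $k\ge 2$ is an integer, $N$ denotes a prime, $\mathbb Z_N=\mathbb Z/N\mathbb Z$, $\mathbb E$ denotes averages over finite sets, and $o(1)$ is a quantity tending to $0$ as $N\to\infty$ along the primes. \emph{Pseudorandom measures.} A family of functions $\nu=\nu_N:\mathbb Z_N\to[0,\infty)$ is a \emph{measure} if $\mathbb E(\nu)=1+o(1)$. A measure $\nu$ is \emph{$k$-pseudorandom} if the following two conditions hold. (1) The $(k2^{k-1},\,3k-4,\,k)$-\emph{linear forms condition}: for all $1\le m\le k2^{k-1}$ and $1\le t\le 3k-4$, all rational numbers $L_{ij}$ ($1\le i\le m$, $1\le j\le t$) with numerator and denominator at most $k$ in absolute value, such that the tuples $(L_{ij})_{1\le j\le t}\in\mathbb Q^t$ are non-zero and no one of them is a rational multiple of another, and all $b_1,\dots,b_m\in\mathbb Z_N$, the forms $\psi_i(x)=\sum_{j=1}^t L_{ij}x_j+b_i$ (with the $L_{ij}$ interpreted as elements of $\mathbb Z_N$) satisfy $$\mathbb E\bigl(\nu(\psi_1(x))\cdots\nu(\psi_m(x))\mid x\in\mathbb Z_N^t\bigr)=1+o(1),$$ with $o(1)$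 uniform in $m$, $t$, the $L_{ij}$ and the $b_i$. (2) The $2^{k-1}$-\emph{correlation condition}: for every $1<m\le 2^{k-1}$ there are weight functions $\tau=\tau_{m,N}:\mathbb Z_N\to[0,\infty)$ such that for each real $1\le q<\infty$ the moments $\mathbb E(\tau^q)$ are bounded uniformly in $N$ by a constant depending on $m$ and $q$, and such that, for all sufficiently large $N$ and all $h_1,\dots,h_m\in\mathbb Z_N$ (not necessarily distinct), $$\mathbb E\bigl(\nu(x+h_1)\cdots\nu(x+h_m)\mid x\in\mathbb Z_N\bigr)\le\sum_{1\le i<j\le m}\tau(h_i-h_j).$$ \emph{The modified von Mangoldt function.} Given a function $w=w(N)$, let $W=\prod_{p\le w(N)}p$ be the product of the primes up to $w(N)$, and let $\widetilde\Lambda(n)=\frac{\phi(W)}{W}\log(Wn+1)$ if $Wn+1$ is prime and $\widetilde\Lambda(n)=0$ otherwise. Write $\epsilon_k:=\frac1{2^k(k+4)!}$. \textbf{Proposition.} Let $w(N)$ be any function tending to infinity sufficiently slowly; that is, for each $k\ge2$ there is a function $w_0(N)\to\infty$ such that the following holds for every real-valued function $w$ with $w(N)\to\infty$ and $w(N)\le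 w_0(N)$ for all large $N$. There is a $k$-pseudorandom measure $\nu=\nu_N:\mathbb Z_N\to[0,\infty)$ such that, for every sufficiently large prime $N$, $$\nu(n)\ge k^{-1}2^{-k-5}\,\widetilde\Lambda(n)\qquad\text{for all integers } n \text{ with } \epsilon_kN\le n\le 2\epsilon_kN .$$ -/

import Mathlib

open Filter Finset
open scoped BigOperators

noncomputable section

namespace PrimeMajorant

/-- The average `𝔼(f(x) | x ∈ A)` of a real function over a finite set `A`. -/
def avg {A : Type} [Fintype A] (f : A → ℝ) : ℝ :=
  (∑ x, f x) / (Fintype.card A : ℝ)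

/-- A rational number read as an element of `ℤ/Nℤ`, for `N` prime and larger than the denominator. -/
def ratMod (N : ℕ) (q : ℚ) : ZMod N :=
  (q.num : ZMod N) * ((q.den : ZMod N))⁻¹

/-- The affine form `ψ(x) = ∑ⱼ Lⱼ xⱼ + b` on `(ℤ/Nℤ)^t` with rational coefficients `Lⱼ`. -/
def affineForm (N : ℕ) {t : ℕ} (L : Fin t → ℚ) (b : ZMod N) (x : Fin t → ZMod N) : ZMod N :=
  ∑ j, ratMod N (L j) * x j + b

/- In the definitions below `ν` is a family of functions `ν N : ℤ/Nℤ → ℝ`, of which only the members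
with `N` a large prime matter, and `o(1)` refers to the limit `N → ∞` along the primes. -/

/-- `ν` is a measure: `ν ≥ 0` and `𝔼(ν) = 1 + o(1)`. -/
structure IsMeasure (ν : ∀ N : ℕ, ZMod N → ℝ) : Prop where
  nonneg : ∀ (N : ℕ) (x : ZMod N), 0 ≤ ν N x
  mean : ∀ ε : ℝ, 0 < ε → ∃ N₀ : ℕ, ∀ (N : ℕ) [Fact N.Prime], N₀ ≤ N →
    |avg (ν N) - 1| ≤ ε

/-- The `(m₀, t₀, L₀)`-linear forms condition. The error term is uniform in the number of forms, the
number of variables, the coefficients and the constant terms. -/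
def LinearFormsCondition (m₀ t₀ L₀ : ℕ) (ν : ∀ N : ℕ, ZMod N → ℝ) : Prop :=
  ∀ ε : ℝ, 0 < ε → ∃ N₀ : ℕ, ∀ (N : ℕ) [Fact N.Prime], N₀ ≤ N →
    ∀ m t : ℕ, 1 ≤ m → m ≤ m₀ → 1 ≤ t → t ≤ t₀ →
    ∀ (L : Fin m → Fin t → ℚ) (b : Fin m → ZMod N),
      (∀ i j, |(L i j).num| ≤ (L₀ : ℤ) ∧ (L i j).den ≤ L₀) →
      (∀ i, L i ≠ 0) →
      (∀ i i' : Fin m, i ≠ i' → ∀ c : ℚ, L i ≠ c • L i') →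
      |avg (fun x : Fin t → ZMod N => ∏ i, ν N (affineForm N (L i) (b i) x)) - 1| ≤ ε

/-- The `m₀`-correlation condition. The weights `τ N` depend on `m` and `N` only, and the bound `C` for
the `q`-th moment depends on `m` and `q` but not on `N`. -/
def CorrelationCondition (m₀ : ℕ) (ν : ∀ N : ℕ, ZMod N → ℝ) : Prop :=
  ∀ m : ℕ, 1 < m → m ≤ m₀ →
    ∃ τ : ∀ N : ℕ, ZMod N → ℝ,
      (∀ (N : ℕ) (x : ZMod N), 0 ≤ τ N x) ∧
      (∀ q : ℝ, 1 ≤ q → ∃ C : ℝ, ∀ (N : ℕ) [Fact N.Prime],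
        avg (fun x : ZMod N => τ N x ^ q) ≤ C) ∧
      ∃ N₀ : ℕ, ∀ (N : ℕ) [Fact N.Prime], N₀ ≤ N → ∀ h : Fin m → ZMod N,
        avg (fun x : ZMod N => ∏ i, ν N (x + h i)) ≤
          ∑ i : Fin m, ∑ j ∈ univ.filter (fun j : Fin m => i < j), τ N (h i - h j)

/-- `k`-pseudorandom measures. -/
structure IsPseudorandom (k : ℕ) (ν : ∀ N : ℕ, ZMod N → ℝ) : Prop where
  isMeasure : IsMeasure ν
  linearForms : LinearFormsCondition (k * 2 ^ (k - 1)) (3 * k - 4) k ν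
  correlation : CorrelationCondition (2 ^ (k - 1)) ν

/-- The product `W` of the primes `p ≤ w`. -/
def primeProd (w : ℝ) : ℕ := primorial ⌊w⌋₊

open Classical in
/-- The `W`-tricked von Mangoldt function. -/
def modLambda (W n : ℕ) : ℝ :=
  if (W * n + 1).Prime then (Nat.totient W : ℝ) / (W : ℝ) * Real.log ((W : ℝ) * n + 1) else 0

/-- `ε_k = 1 / (2^k (k+4)!)`. -/
def epsK (k : ℕ) : ℝ := 1 / (2 ^ k * (Nat.factorial (k + 4) : ℝ))

end PrimeMajorant

end

/-!
The majorant is a product of two sieves for the primes `Wn + 1`. With `r ≈ (log₂ N)^{1/4}`, Brun's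
pure sieve, truncated at `2r` prime factors, runs over the primes in `(w, 2^{r²}]`, and Selberg's
`Λ²` sieve of level `R = N^{1/e}`, where `e = k 2^{k+4}`, runs over the primes in `(2^{r²}, R]`. The
product is normalised by `H ∏ (1 - 1/p)⁻¹`, where `p` runs over the primes of Brun's sieve and
`H = ∑ 1/φ(d)` is the reciprocal of the value of Selberg's quadratic form (`sum_selbergCoeff_div`).

Averages of products of majorants along linear forms are computed by expanding all divisor sums. The
moduli are at most a small power of `N`. The average over `x` may be replaced by an average over a
short box of shifts of `x`, in which the integer representatives of the forms are affine unless one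
of them is close to `0` or `N`; so the Chinese remainder theorem evaluates each term as an average
over `x` of products of local densities (`abs_avg_prod_divInd_sub_le`,
`abs_avg_prod_majorant_sub_le`). No analytic information about primes is used to sum these terms: the
local densities are replaced by those of independent forms, `p^{-|I|}`, prime by prime and in
absolute value (`abs_tupleSum_sub_le`). Taking absolute values loses a power of `log N`. At the
primes of Selberg's sieve this is harmless, as `2^{r²}` exceeds all powers of `log N`, and for
independent forms the sum is a power of `1/H` exactly. At the primes of Brun's sieve, Rankin's trick
completes the truncated sums to Euler products (`abs_tupleSum_brun_sub_le`), whose factors are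
`1 + O(1/p²)` with `p > w`. This gives the linear forms condition
(`linearFormsCondition_majorantFamily`), and with it the mean value.

In the correlation condition the primes dividing differences of the shifts are exceptional. The small
ones contribute a factor `∏ (1 + O(1/p))`, and the large ones are too few to matter
(`exists_abs_localMean_le`). The weights `τ` are powers of divisor products
`∏_{p ∣ v} (1 + c/p)`, which have bounded moments (`exists_avg_corrWeight_rpow_le`); their value at
`0` is the trivial bound `e^{O(r³)}` for products of majorants, which is `N^{o(1)}`.

At a prime `Wn + 1` exceeding all sieving primes both sieves have the value `1`, so the majorant is
its normalising factor. This is at least `(φ(W)/W) log R`, since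
`H ∏_{p ≤ 2^{r²}} (1 - 1/p)⁻¹ ≥ ∑_{n ≤ R} 1/n` (`log_le_selbergSum_mul`, `totient_mul_log_le`).
-/


/-! ### Sums over tuples of squarefree numbers -/

namespace PrimeMajorant

variable {ι : Type*} [Fintype ι]

/-- Exchange of the products over the forms and over the primes: each prime is counted once for every
form whose modulus it divides. -/
theorem prod_prod_mem_eq (P : Finset ℕ) (g : ℕ → ℝ) (u : ι → Finset ℕ) (hu : ∀ i, u i ⊆ P) :
    ∏ i, ∏ p ∈ u i, g p = ∏ p ∈ P, g p ^ #({i | p ∈ u i} : Finset ι) := by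
  have h : ∀ i, ∏ p ∈ u i, g p = ∏ p ∈ P, if p ∈ u i then g p else 1 := by
    intro i
    rw [Finset.prod_ite_mem, inter_eq_right.2 (hu i)]
  simp_rw [h]
  rw [Finset.prod_comm]
  refine Finset.prod_congr rfl fun p _ => ?_
  rw [Finset.prod_ite]
  simp

theorem sum_pow_card (C : ℝ) : ∑ I : Finset ι, C ^ #I = (1 + C) ^ Fintype.card ι := by
  have := Fintype.sum_pow_mul_eq_add_pow ι C 1
  simp only [one_pow, mul_one] at this
  rw [this, add_comm]

/-- A perturbation bound for products. As the right-hand side is again a difference of products, it can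
be summed over tuples prime by prime. -/
theorem abs_prod_sub_prod_le {κ : Type*} (P : Finset κ) (x y γ ε : κ → ℝ)
    (hy : ∀ p ∈ P, |y p| ≤ γ p) (hxy : ∀ p ∈ P, |x p - y p| ≤ ε p) :
    |∏ p ∈ P, x p - ∏ p ∈ P, y p| ≤ ∏ p ∈ P, (γ p + ε p) - ∏ p ∈ P, γ p := by
  classical
  induction P using Finset.induction_on with
  | empty => simp
  | insert a s ha ih =>
    have ih := ih (fun p hp => hy p (mem_insert_of_mem hp)) (fun p hp => hxy p (mem_insert_of_mem hp))
    rw [prod_insert ha, prod_insert ha, prod_insert ha, prod_insert ha]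
    have h1 := hy a (mem_insert_self _ _)
    have h2 := hxy a (mem_insert_self _ _)
    have hYG : |∏ p ∈ s, y p| ≤ ∏ p ∈ s, γ p := by
      rw [abs_prod]
      exact prod_le_prod (fun _ _ => abs_nonneg _) fun p hp => hy p (mem_insert_of_mem hp)
    have hx : |x a| ≤ γ a + ε a := by
      calc |x a| = |y a + (x a - y a)| := by ring_nf
        _ ≤ |y a| + |x a - y a| := abs_add_le _ _
        _ ≤ _ := add_le_add h1 h2
    calc |x a * ∏ p ∈ s, x p - y a * ∏ p ∈ s, y p|
        = |x a * (∏ p ∈ s, x p - ∏ p ∈ s, y p) + (x a - y a) * ∏ p ∈ s, y p| := by ring_nf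
      _ ≤ |x a| * |∏ p ∈ s, x p - ∏ p ∈ s, y p| + |x a - y a| * |∏ p ∈ s, y p| := by
          rw [← abs_mul, ← abs_mul]; exact abs_add_le _ _
      _ ≤ (γ a + ε a) * (∏ p ∈ s, (γ p + ε p) - ∏ p ∈ s, γ p) + ε a * ∏ p ∈ s, γ p := by
          gcongr
          · exact (abs_nonneg _).trans hx
          · exact (abs_nonneg _).trans h2
      _ = _ := by ring

theorem prod_pow_card_eq (P : Finset ℕ) (C : ℝ) (u : ι → Finset ℕ) (hu : ∀ i, u i ⊆ P) :
    ∏ i, C ^ #(u i) = ∏ p ∈ P, C ^ #({i | p ∈ u i} : Finset ι) := by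
  rw [← prod_prod_mem_eq P (fun _ => C) u hu]
  simp

/-- A system of local densities: `α p I` stands for the probability that `p` divides all the forms
with index in `I`. It agrees with the independent model `p^{-|I|}` for `|I| ≤ 1`, and up to `δ p`
otherwise. -/
structure LocalDensities (P : Finset ℕ) (α : ℕ → Finset ι → ℝ) (δ : ℕ → ℝ) : Prop where
  prime : ∀ p ∈ P, p.Prime
  nonneg : ∀ p ∈ P, ∀ I, 0 ≤ α p I
  empty : ∀ p ∈ P, α p ∅ = 1
  le_inv : ∀ p ∈ P, ∀ I, I.Nonempty → α p I ≤ 1 / p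
  close : ∀ p ∈ P, ∀ I, |α p I - (1 / p : ℝ) ^ #I| ≤ if #I ≤ 1 then 0 else δ p
  delta_nonneg : ∀ p ∈ P, 0 ≤ δ p

/-- One Euler factor of the small primes, compared to that of the independent model. -/
theorem abs_euler_factor_sub_le {P : Finset ℕ} {α : ℕ → Finset ι → ℝ} {δ : ℕ → ℝ}
    (hα : LocalDensities P α δ) {p : ℕ} (hp : p ∈ P) :
    |(∑ I : Finset ι, (-1) ^ #I * α p I) / (1 - 1 / p : ℝ) ^ Fintype.card ι - 1| ≤
      4 ^ Fintype.card ι * δ p := by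
  have hp2 : (2 : ℝ) ≤ p := by exact_mod_cast (hα.prime p hp).two_le
  have hhalf : (1 / 2 : ℝ) ≤ 1 - 1 / p := by
    have : (1 : ℝ) / p ≤ 1 / 2 := one_div_le_one_div_of_le (by norm_num) hp2
    linarith
  have hpos : (0 : ℝ) < (1 - 1 / p : ℝ) ^ Fintype.card ι := pow_pos (by linarith) _
  have hmodel : (1 - 1 / p : ℝ) ^ Fintype.card ι = ∑ I : Finset ι, (-1) ^ #I * (1 / p : ℝ) ^ #I := by
    simp_rw [← mul_pow]
    rw [sum_pow_card]; ring
  have hdiff : |(∑ I : Finset ι, (-1) ^ #I * α p I) - (1 - 1 / p : ℝ) ^ Fintype.card ι| ≤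
      2 ^ Fintype.card ι * δ p := by
    rw [hmodel, ← sum_sub_distrib]
    refine (abs_sum_le_sum_abs _ _).trans ?_
    calc _ ≤ ∑ I : Finset ι, δ p := by
          refine sum_le_sum fun I _ => ?_
          rw [← mul_sub, abs_mul, abs_pow, abs_neg, abs_one, one_pow, one_mul]
          refine (hα.close p hp I).trans ?_
          split_ifs
          · exact hα.delta_nonneg p hp
          · exact le_rfl
      _ = _ := by simp
  rw [div_sub_one hpos.ne', abs_div, abs_of_pos hpos, div_le_iff₀ hpos]
  calc _ ≤ _ := hdiff
    _ = 4 ^ Fintype.card ι * δ p * (1 / 2) ^ Fintype.card ι := by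
        rw [mul_right_comm, ← mul_pow]; norm_num
    _ ≤ _ := by
        have := hα.delta_nonneg p hp
        gcongr

variable [DecidableEq ι]

/-- Squarefree numbers are encoded by the sets of their prime factors. This is the sum
`∑ ∏ᵢ c(uᵢ) ∏ₚ α_p({i : p ∈ uᵢ})` over all tuples `(uᵢ)` of subsets of `P`. -/
noncomputable def tupleSum (P : Finset ℕ) (α : ℕ → Finset ι → ℝ) (c : Finset ℕ → ℝ) : ℝ :=
  ∑ u ∈ Fintype.piFinset (fun _ : ι => P.powerset),
    (∏ i, c (u i)) * ∏ p ∈ P, α p {i | p ∈ u i}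

/-- A tuple of subsets of `P` amounts to the choice, for each `p ∈ P`, of the set of indices whose
member contains `p`; so sums of multiplicative functions over tuples are Euler products. -/
theorem sum_tuples_prod (P : Finset ℕ) (g : ℕ → Finset ι → ℝ) :
    ∑ u ∈ Fintype.piFinset (fun _ : ι => P.powerset), ∏ p ∈ P, g p {i | p ∈ u i} =
      ∏ p ∈ P, ∑ I : Finset ι, g p I := by
  rw [Finset.prod_sum]
  refine Finset.sum_bij' (fun u _ => fun p _ => ({i | p ∈ u i} : Finset ι))
    (fun φ _ => fun i => P.filter (fun p => ∃ h : p ∈ P, i ∈ φ p h)) ?_ ?_ ?_ ?_ ?_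
  · intro u _
    simp
  · intro φ _
    simp
  · intro u hu
    simp only [Fintype.mem_piFinset, mem_powerset] at hu
    funext i
    ext p
    simp only [mem_filter, mem_univ, true_and, exists_prop]
    exact ⟨fun h => h.2.2, fun h => ⟨hu i h, hu i h, h⟩⟩
  · intro φ _
    funext p hp
    ext i
    simp [hp]
  · intro u _
    exact (Finset.prod_attach P (fun p => g p {i | p ∈ u i})).symm

/-- The weighted sum at one prime of the bound `1` (if `I = ∅`) or `1/p` (otherwise) for local
densities. -/
theorem sum_local_le {C : ℝ} {p : ℕ} :
    (∑ I : Finset ι, C ^ #I * (if I = ∅ then 1 else 1 / (p : ℝ))) ≤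
      1 + (1 + C) ^ Fintype.card ι / p := by
  calc (∑ I : Finset ι, C ^ #I * (if I = ∅ then 1 else 1 / (p : ℝ)))
      ≤ ∑ I : Finset ι, ((if I = ∅ then 1 else 0) + C ^ #I / (p : ℝ)) := by
        refine sum_le_sum fun I _ => ?_
        split_ifs with h
        · subst h; simp
        · simp [div_eq_mul_inv]
    _ = _ := by
        rw [sum_add_distrib, ← sum_div, sum_pow_card]
        simp

theorem one_le_sum_local {C : ℝ} (hC : 0 ≤ C) {p : ℕ} :
    1 ≤ (∑ I : Finset ι, C ^ #I * (if I = ∅ then 1 else 1 / (p : ℝ))) := by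
  have := Finset.single_le_sum (f := fun I : Finset ι => C ^ #I * (if I = ∅ then 1 else 1 / (p : ℝ)))
    (s := univ) (fun I _ => by positivity) (mem_univ ∅)
  simpa using this

theorem sum_tuples_weighted (P : Finset ℕ) (C : ℝ) (g : ℕ → Finset ι → ℝ) :
    ∑ u ∈ Fintype.piFinset (fun _ : ι => P.powerset),
      (∏ i, C ^ #(u i)) * ∏ p ∈ P, g p {i | p ∈ u i} = ∏ p ∈ P, ∑ I : Finset ι, C ^ #I * g p I := by
  rw [← sum_tuples_prod P (fun p I => C ^ #I * g p I)]
  refine sum_congr rfl fun u hu => ?_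
  rw [prod_mul_distrib, prod_pow_card_eq P C u]
  simpa using hu

/-- Replacing the local densities `α` by the independent model changes a tuple sum little: the
difference is expanded prime by prime, in absolute values. -/
theorem abs_tupleSum_sub_le {P : Finset ℕ} {α : ℕ → Finset ι → ℝ} {δ : ℕ → ℝ}
    (hα : LocalDensities P α δ) {c : Finset ℕ → ℝ} {C : ℝ} (hC : 0 ≤ C)
    (hc : ∀ s ⊆ P, |c s| ≤ C ^ #s) :
    |tupleSum P α c - tupleSum P (fun p (I : Finset ι) => (1 / p : ℝ) ^ #I) c| ≤
      (∏ p ∈ P, (1 + (1 + C) ^ Fintype.card ι / (p : ℝ))) *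
        (Real.exp ((1 + C) ^ Fintype.card ι * ∑ p ∈ P, δ p) - 1) := by
  set M := (1 + C) ^ Fintype.card ι with hM
  have hM0 : 0 ≤ M := by positivity
  -- `γ` bounds the densities of the independent model, and `e` the deviation of `α` from it.
  set γ : ℕ → Finset ι → ℝ := fun p I => if I = ∅ then 1 else 1 / (p : ℝ) with hγ
  set e : ℕ → Finset ι → ℝ := fun p I => if I = ∅ then 0 else δ p with he
  have hγ0 : ∀ p I, 0 ≤ γ p I := fun p I => by simp only [hγ]; positivity
  have h1 : |tupleSum P α c - tupleSum P (fun p (I : Finset ι) => (1 / p : ℝ) ^ #I) c| ≤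
      ∏ p ∈ P, (∑ I : Finset ι, C ^ #I * (γ p I + e p I)) -
        ∏ p ∈ P, ∑ I : Finset ι, C ^ #I * γ p I := by
    rw [← sum_tuples_weighted, ← sum_tuples_weighted, tupleSum, tupleSum, ← sum_sub_distrib,
      ← sum_sub_distrib]
    refine (abs_sum_le_sum_abs _ _).trans (sum_le_sum fun u hu => ?_)
    rw [← mul_sub, ← mul_sub, abs_mul]
    have hu' : ∀ i, u i ⊆ P := by simpa using hu
    refine mul_le_mul ?_ ?_ (abs_nonneg _) (prod_nonneg fun _ _ => by positivity)
    · rw [abs_prod]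
      exact prod_le_prod (fun _ _ => abs_nonneg _) fun i _ => hc _ (hu' i)
    · refine abs_prod_sub_prod_le P _ _ _ _ (fun p hp => ?_) (fun p hp => ?_)
      · have hp1 : (1 : ℝ) ≤ p := by exact_mod_cast (hα.prime p hp).one_le
        simp only [hγ]
        split_ifs with h
        · rw [h]; simp
        · rw [abs_of_nonneg (by positivity)]
          refine pow_le_of_le_one (by positivity) ?_ ?_
          · rw [div_le_one (by positivity)]; exact hp1
          · simpa using h
      · refine (hα.close p hp _).trans ?_
        simp only [he]
        split_ifs with h h' h'
        · exact le_rfl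
        · exact hα.delta_nonneg p hp
        · rw [h'] at h; simp at h
        · exact le_rfl
  have hG1 : ∀ p, 1 ≤ ∑ I : Finset ι, C ^ #I * γ p I := fun p => one_le_sum_local hC
  have hG2 : ∀ p, ∑ I : Finset ι, C ^ #I * γ p I ≤ 1 + M / p := fun p => sum_local_le
  have hE : ∀ p ∈ P, ∑ I : Finset ι, C ^ #I * e p I ≤ M * δ p := by
    intro p hp
    rw [hM, ← sum_pow_card, sum_mul]
    refine sum_le_sum fun I _ => ?_
    gcongr
    simp only [he]
    split_ifs
    · exact hα.delta_nonneg p hp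
    · exact le_rfl
  have hprod : ∏ p ∈ P, (∑ I : Finset ι, C ^ #I * (γ p I + e p I)) ≤
      (∏ p ∈ P, ∑ I : Finset ι, C ^ #I * γ p I) * Real.exp (M * ∑ p ∈ P, δ p) := by
    rw [mul_sum, Real.exp_sum, ← prod_mul_distrib]
    refine prod_le_prod (fun p hp => sum_nonneg fun I _ => ?_) fun p hp => ?_
    · have : 0 ≤ e p I := by
        simp only [he]; split_ifs
        · exact le_rfl
        · exact hα.delta_nonneg p hp
      have := hγ0 p I
      positivity
    · have h2 : 1 + M * δ p ≤ Real.exp (M * δ p) := by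
        rw [add_comm]; exact Real.add_one_le_exp _
      have h3 : 0 ≤ M * δ p := mul_nonneg hM0 (hα.delta_nonneg p hp)
      simp_rw [mul_add]
      rw [sum_add_distrib]
      nlinarith [hE p hp, hG1 p]
  have hexp : 0 ≤ Real.exp (M * ∑ p ∈ P, δ p) - 1 := by
    have : 0 ≤ M * ∑ p ∈ P, δ p := mul_nonneg hM0 (sum_nonneg hα.delta_nonneg)
    linarith [Real.one_le_exp this]
  calc _ ≤ _ := h1
    _ ≤ (∏ p ∈ P, ∑ I : Finset ι, C ^ #I * γ p I) * (Real.exp (M * ∑ p ∈ P, δ p) - 1) := by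
        linarith
    _ ≤ _ := by
        gcongr with p hp
        exact hG2 p

/-- In the independent model a tuple sum factors over the forms. -/
theorem tupleSum_indep (P : Finset ℕ) (c : Finset ℕ → ℝ) :
    tupleSum P (fun p (I : Finset ι) => (1 / p : ℝ) ^ #I) c =
      (∑ s ∈ P.powerset, c s * ∏ p ∈ s, (1 / p : ℝ)) ^ Fintype.card ι := by
  have h := Finset.prod_univ_sum (fun _ : ι => P.powerset)
    (fun _ s => c s * ∏ p ∈ s, (1 / p : ℝ))
  rw [prod_const, card_univ] at h
  rw [h, tupleSum]
  refine sum_congr rfl fun u hu => ?_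
  rw [prod_mul_distrib, prod_prod_mem_eq P]
  simpa using hu

theorem LocalDensities.abs_le {ι : Type*} [DecidableEq ι] {P : Finset ℕ} {α : ℕ → Finset ι → ℝ} {δ : ℕ → ℝ}
    (hα : LocalDensities P α δ) {p : ℕ} (hp : p ∈ P) (I : Finset ι) :
    |α p I| ≤ if I = ∅ then 1 else 1 / (p : ℝ) := by
  rw [abs_of_nonneg (hα.nonneg p hp I)]
  split_ifs with h
  · rw [h, hα.empty p hp]
  · exact hα.le_inv p hp I (nonempty_iff_ne_empty.2 h)

/-- The coefficients of Brun's pure sieve, `μ` restricted to products of at most `2r` primes. -/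
noncomputable def brunWeight (r : ℕ) (s : Finset ℕ) : ℝ := if #s ≤ 2 * r then (-1) ^ #s else 0

/-- The truncation of the Möbius function costs little, by Rankin's trick: a tuple `u` lost by the
truncation has a member with more than `2r` elements, so that `(1/4)^r ∏ᵢ 2^{#uᵢ} ≥ 1`. -/
theorem abs_tupleSum_brun_sub_le {P : Finset ℕ} {α : ℕ → Finset ι → ℝ} {δ : ℕ → ℝ}
    (hα : LocalDensities P α δ) (r : ℕ) :
    |tupleSum P α (brunWeight r) - ∏ p ∈ P, ∑ I : Finset ι, (-1) ^ #I * α p I| ≤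
      (1 / 4) ^ r * ∏ p ∈ P, (1 + 3 ^ Fintype.card ι / (p : ℝ)) := by
  rw [← sum_tuples_weighted, tupleSum, ← sum_sub_distrib]
  have h3 : (1 + 2 : ℝ) = 3 := by norm_num
  calc |∑ u ∈ Fintype.piFinset fun _ : ι ↦ P.powerset,
        ((∏ i, brunWeight r (u i)) * ∏ p ∈ P, α p {i | p ∈ u i} -
          (∏ i, (-1) ^ #(u i)) * ∏ p ∈ P, α p {i | p ∈ u i})|
      ≤ ∑ u ∈ Fintype.piFinset fun _ : ι ↦ P.powerset, (1 / 4) ^ r *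
        ((∏ i, (2 : ℝ) ^ #(u i)) * ∏ p ∈ P, (if ({i | p ∈ u i} : Finset ι) = ∅ then 1 else 1 / (p : ℝ))) := by
        refine (abs_sum_le_sum_abs _ _).trans (sum_le_sum fun u hu => ?_)
        rw [← sub_mul, abs_mul, ← mul_assoc]
        refine mul_le_mul ?_ ?_ (abs_nonneg _) (by positivity)
        · by_cases h : ∀ i, #(u i) ≤ 2 * r
          · simp only [brunWeight, h, if_true, sub_self, abs_zero]
            positivity
          · push Not at h
            obtain ⟨i, hi⟩ := h
            rw [Finset.prod_eq_zero (i := i) (mem_univ i) (by simp [brunWeight, hi]), zero_sub, abs_neg,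
              abs_prod]
            simp only [abs_pow, abs_neg, abs_one, one_pow, prod_const_one]
            have h1 : (2 : ℝ) ^ (2 * r) ≤ ∏ j, (2 : ℝ) ^ #(u j) := by
              calc (2 : ℝ) ^ (2 * r) ≤ 2 ^ #(u i) := pow_le_pow_right₀ (by norm_num) hi.le
                _ ≤ _ := by
                  rw [← Finset.mul_prod_erase univ _ (mem_univ i)]
                  refine le_mul_of_one_le_right (by positivity) ?_
                  exact Finset.one_le_prod fun j _ => one_le_pow₀ (by norm_num)
            calc (1 : ℝ) = (1 / 4) ^ r * 2 ^ (2 * r) := by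
                  rw [pow_mul, ← mul_pow]; norm_num
              _ ≤ _ := by gcongr
        · rw [abs_prod]
          exact prod_le_prod (fun _ _ => abs_nonneg _) fun p hp => hα.abs_le hp _
    _ ≤ _ := by
        rw [← mul_sum, sum_tuples_weighted P 2 (fun p I => if I = ∅ then 1 else 1 / (p : ℝ))]
        gcongr with p hp
        have := sum_local_le (ι := ι) (C := 2) (p := p)
        rwa [h3] at this

end PrimeMajorant

/-! ### Averages over residues and local densities of linear forms -/

namespace PrimeMajorant

open Classical in
/-- The truth value of a proposition, as a real number. -/
noncomputable def ind (Q : Prop) : ℝ := if Q then 1 else 0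

theorem ind_eq (Q : Prop) [Decidable Q] : ind Q = if Q then 1 else 0 := by
  unfold ind; congr

theorem ind_nonneg (Q : Prop) : 0 ≤ ind Q := by
  unfold ind; split_ifs <;> norm_num

theorem ind_le_one (Q : Prop) : ind Q ≤ 1 := by
  unfold ind; split_ifs <;> norm_num

theorem ind_mono {Q Q' : Prop} (h : Q → Q') : ind Q ≤ ind Q' := by
  classical
  rw [ind_eq, ind_eq]
  split_ifs with h1 h2
  · exact le_rfl
  · exact absurd (h h1) h2
  · exact zero_le_one
  · exact le_rfl

section Avg

variable {A B : Type} [Fintype A] [Fintype B]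

theorem avg_mono {f g : A → ℝ} (h : ∀ x, f x ≤ g x) : avg f ≤ avg g := by
  unfold avg
  gcongr
  exact h _

theorem avg_nonneg {f : A → ℝ} (h : ∀ x, 0 ≤ f x) : 0 ≤ avg f :=
  div_nonneg (sum_nonneg fun x _ => h x) (Nat.cast_nonneg _)

theorem avg_const [Nonempty A] (c : ℝ) : avg (fun _ : A => c) = c := by
  simp [avg]

theorem avg_sub (f g : A → ℝ) : avg (fun x => f x - g x) = avg f - avg g := by
  simp [avg, sum_sub_distrib, sub_div]

theorem avg_mul_left (c : ℝ) (f : A → ℝ) : avg (fun x => c * f x) = c * avg f := by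
  simp [avg, ← mul_sum, mul_div_assoc]

theorem avg_sum {κ : Type*} (s : Finset κ) (f : κ → A → ℝ) :
    avg (fun x => ∑ i ∈ s, f i x) = ∑ i ∈ s, avg (f i) := by
  simp only [avg]
  rw [sum_comm, sum_div]

theorem abs_avg_le (f : A → ℝ) : |avg f| ≤ avg fun x => |f x| := by
  unfold avg
  rw [abs_div, Nat.abs_cast]
  gcongr
  exact abs_sum_le_sum_abs _ _

theorem avg_comm (f : A → B → ℝ) : avg (fun x => avg (f x)) = avg fun y => avg fun x => f x y := by
  simp only [avg]
  rw [← sum_div, ← sum_div, sum_comm, div_div, div_div, mul_comm]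

theorem avg_equiv (e : A ≃ B) (f : B → ℝ) : avg (fun x => f (e x)) = avg f := by
  simp only [avg]
  rw [Equiv.sum_comp e f, Fintype.card_congr e]

theorem avg_ind (Q : A → Prop) :
    avg (fun x => ind (Q x)) = Nat.card {x // Q x} / Fintype.card A := by
  classical
  simp only [avg, ind_eq]
  rw [Nat.card_eq_fintype_card, Fintype.card_subtype]
  simp

/-- A surjective homomorphism of finite groups preserves averages, since its fibres have equal size. -/
theorem avg_comp_surjective {G H : Type} [AddCommGroup G] [AddCommGroup H] [Fintype G] [Fintype H]
    (φ : G →+ H) (hφ : Function.Surjective φ) (F : H → ℝ) : avg (fun g => F (φ g)) = avg F := by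
  classical
  have hcard : ∀ h : H, #{g | φ g = h} = #{g | φ g = 0} := fun h =>
    AddMonoidHom.card_fiber_eq_of_mem_range φ (hφ h) (hφ 0)
  set c := #{g | φ g = 0} with hc
  have hG : Fintype.card G = Fintype.card H * c := by
    rw [← card_univ, Finset.card_eq_sum_card_fiberwise (f := φ) (t := univ) (by simp)]
    simp [hcard]
  have hsum : ∑ g, F (φ g) = c * ∑ h, F h := by
    rw [← Finset.sum_fiberwise univ φ, mul_sum]
    refine sum_congr rfl fun h _ => ?_
    rw [Finset.sum_congr rfl (g := fun _ => F h), sum_const, hcard, nsmul_eq_mul]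
    intro g hg
    rw [(mem_filter.1 hg).2]
  have hc0 : (c : ℝ) ≠ 0 := by
    have : 0 < Fintype.card G := Fintype.card_pos
    rw [hG] at this
    exact_mod_cast (Nat.pos_of_mul_pos_left this).ne'
  unfold avg
  rw [hsum, hG, Nat.cast_mul, mul_comm (c : ℝ), mul_div_mul_right _ _ hc0]

end Avg

/-- The linear form `y ↦ ∑ⱼ Lⱼ yⱼ` over a commutative ring, as an additive map. -/
def linForm {R : Type} [CommRing R] {t : ℕ} (L : Fin t → R) : (Fin t → R) →+ R where
  toFun y := ∑ j, L j * y j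
  map_zero' := by simp
  map_add' x y := by simp [mul_add, sum_add_distrib]

theorem linForm_apply {R : Type} [CommRing R] {t : ℕ} (L y : Fin t → R) :
    linForm L y = ∑ j, L j * y j := rfl

theorem linForm_single {R : Type} [CommRing R] {t : ℕ} (L : Fin t → R) (j : Fin t) (c : R) :
    linForm L (Pi.single j c) = L j * c := by
  rw [linForm_apply, Finset.sum_eq_single j] <;> simp +contextual

theorem linForm_surjective {K : Type} [Field K] {t : ℕ} {L : Fin t → K} (hL : L ≠ 0) :
    Function.Surjective (linForm L) := by
  obtain ⟨j, hj⟩ := Function.ne_iff.1 hL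
  intro v
  refine ⟨Pi.single j ((L j)⁻¹ * v), ?_⟩
  rw [linForm_single, mul_inv_cancel_left₀ hj]

theorem linForm_prod_surjective {K : Type} [Field K] {t : ℕ} {L L' : Fin t → K} {j j' : Fin t}
    (h : L j * L' j' - L j' * L' j ≠ 0) :
    Function.Surjective ((linForm L).prod (linForm L')) := by
  rintro ⟨v, v'⟩
  set d := L j * L' j' - L j' * L' j with hd
  refine ⟨Pi.single j ((L' j' * v - L j' * v') / d) + Pi.single j' ((L j * v' - L' j * v) / d), ?_⟩
  rw [AddMonoidHom.prod_apply, map_add, map_add, linForm_single, linForm_single, linForm_single,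
    linForm_single, Prod.mk.injEq]
  constructor
  · field_simp
    rw [hd]; ring
  · field_simp
    rw [hd]; ring

/-- The indicator function of the integers divisible by all elements of `s`. -/
noncomputable def divInd (s : Finset ℕ) (n : ℤ) : ℝ := ind (∀ p ∈ s, (p : ℤ) ∣ n)

theorem divInd_nonneg (s : Finset ℕ) (n : ℤ) : 0 ≤ divInd s n := ind_nonneg _

theorem divInd_le_one (s : Finset ℕ) (n : ℤ) : divInd s n ≤ 1 := ind_le_one _

theorem divInd_union (s t : Finset ℕ) (n : ℤ) : divInd (s ∪ t) n = divInd s n * divInd t n := by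
  classical
  simp only [divInd, ind_eq, mem_union, or_imp, forall_and]
  split_ifs <;> simp_all

variable {ι : Type*} {t : ℕ}

/-- The proportion of `y ∈ (ℤ/p)^t` at which `p` divides all the forms `aᵢ + ∑ⱼ ℓᵢⱼ yⱼ`, `i ∈ I`. -/
noncomputable def localDensity (a : ι → ℤ) (l : ι → Fin t → ℤ) (p : ℕ) (I : Finset ι) : ℝ :=
  (Nat.card {y : Fin t → ZMod p // ∀ i ∈ I, (a i : ZMod p) + ∑ j, (l i j : ZMod p) * y j = 0} : ℝ) /
    (p : ℝ) ^ t

theorem localDensity_nonneg (a : ι → ℤ) (l : ι → Fin t → ℤ) (p : ℕ) (I : Finset ι) :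
    0 ≤ localDensity a l p I := by
  unfold localDensity; positivity

section OnePrime

variable (a : ι → ℤ) (l : ι → Fin t → ℤ) (p : ℕ) [hp : Fact p.Prime]

theorem localDensity_eq_avg (I : Finset ι) :
    localDensity a l p I = avg (fun y : Fin t → ZMod p =>
      ind (∀ i ∈ I, (a i : ZMod p) + ∑ j, (l i j : ZMod p) * y j = 0)) := by
  rw [avg_ind, localDensity]
  simp [ZMod.card]

theorem localDensity_mono {I J : Finset ι} (h : J ⊆ I) :
    localDensity a l p I ≤ localDensity a l p J := by
  rw [localDensity_eq_avg, localDensity_eq_avg]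
  exact avg_mono fun y => ind_mono fun h1 i hi => h1 i (h hi)

theorem localDensity_empty : localDensity a l p ∅ = 1 := by
  rw [localDensity_eq_avg]
  simp [avg_const, ind_eq]

theorem localDensity_singleton {i : ι} (hl : ∃ j, (l i j : ZMod p) ≠ 0) :
    localDensity a l p {i} = 1 / p := by
  classical
  rw [localDensity_eq_avg]
  have h0 : (fun j => (l i j : ZMod p)) ≠ 0 := Function.ne_iff.2 hl
  have h := avg_comp_surjective _ (linForm_surjective h0)
    (fun v => ind ((a i : ZMod p) + v = 0))
  simp only [linForm_apply] at h
  simp only [mem_singleton, forall_eq]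
  rw [h, avg]
  simp [ind_eq, add_eq_zero_iff_neg_eq, ZMod.card]

theorem localDensity_le_inv {I : Finset ι} (hI : I.Nonempty)
    (hl : ∀ i, ∃ j, (l i j : ZMod p) ≠ 0) : localDensity a l p I ≤ 1 / p := by
  obtain ⟨i, hi⟩ := hI
  rw [← localDensity_singleton a l p (hl i)]
  exact localDensity_mono a l p (by simpa using hi)

/-- Two forms with a minor that is non-zero modulo `p` are independent modulo `p`. -/
theorem localDensity_pair {i i' : ι} [DecidableEq ι]
    (h : ∃ j j', ((l i j * l i' j' - l i j' * l i' j : ℤ) : ZMod p) ≠ 0) :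
    localDensity a l p {i, i'} = 1 / p ^ 2 := by
  classical
  obtain ⟨j, j', h⟩ := h
  push_cast at h
  rw [localDensity_eq_avg]
  have h := avg_comp_surjective _ (linForm_prod_surjective
    (L := fun j => (l i j : ZMod p)) (L' := fun j => (l i' j : ZMod p)) h)
    (fun v => ind ((a i : ZMod p) + v.1 = 0 ∧ (a i' : ZMod p) + v.2 = 0))
  simp only [linForm_apply, AddMonoidHom.prod_apply] at h
  simp only [mem_insert, mem_singleton, forall_eq_or_imp, forall_eq]
  rw [h, avg]
  have : ∀ v : ZMod p × ZMod p, ((a i : ZMod p) + v.1 = 0 ∧ (a i' : ZMod p) + v.2 = 0) ↔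
      v = (-(a i : ZMod p), -(a i' : ZMod p)) := by
    intro v
    rw [Prod.ext_iff, add_eq_zero_iff_neg_eq, add_eq_zero_iff_neg_eq, eq_comm, eq_comm (b := v.2)]
  simp_rw [this]
  simp [ind_eq, ZMod.card, sq]

end OnePrime

/-- The exceptional set `E` gives the error terms `1/p` for `p ∈ E` and `1/p²` otherwise. -/
noncomputable def errorTerm (E : Finset ℕ) (p : ℕ) : ℝ := if p ∈ E then 1 / (p : ℝ) else 1 / (p : ℝ) ^ 2

/-- The local densities of a system of forms, with `δ p = 1/p` at the primes of an exceptional set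
and `δ p = 1/p²` at the other primes. -/
theorem localDensities [DecidableEq ι] (a : ι → ℤ) (l : ι → Fin t → ℤ) {P : Finset ℕ}
    (hP : ∀ p ∈ P, p.Prime) (hl : ∀ p ∈ P, ∀ i, ∃ j, (l i j : ZMod p) ≠ 0) (E : Finset ℕ)
    (hE : ∀ p ∈ P, p ∉ E → ∀ i i', i ≠ i' → localDensity a l p {i, i'} ≤ 1 / (p : ℝ) ^ 2) :
    LocalDensities P (localDensity a l) (errorTerm E) where
  prime := hP
  nonneg p _ I := localDensity_nonneg a l p I
  empty p hp := by
    have := Fact.mk (hP p hp)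
    exact localDensity_empty a l p
  le_inv p hp I hI := by
    have := Fact.mk (hP p hp)
    exact localDensity_le_inv a l p hI (hl p hp)
  delta_nonneg p _ := by unfold errorTerm; positivity
  close p hp I := by
    have := Fact.mk (hP p hp)
    have hp1 : (1 : ℝ) ≤ p := by exact_mod_cast (hP p hp).one_le
    have hsq : 1 / (p : ℝ) ^ 2 ≤ 1 / p := by
      gcongr
      exact le_self_pow₀ hp1 two_ne_zero
    unfold errorTerm
    split_ifs with h1 h2
    · rcases Nat.le_one_iff_eq_zero_or_eq_one.1 h1 with h | h
      · rw [card_eq_zero.1 h, localDensity_empty]; simp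
      · obtain ⟨i, rfl⟩ := card_eq_one.1 h
        rw [localDensity_singleton a l p (hl p hp i)]; simp
    all_goals
      push Not at h1
      have h0 := localDensity_nonneg a l p I
      have hI : I.Nonempty := card_pos.1 (by omega)
      have h3 : (1 / p : ℝ) ^ #I ≤ 1 / (p : ℝ) ^ 2 := by
        rw [← one_div_pow]
        exact pow_le_pow_of_le_one (by positivity) ((div_le_one (by positivity)).2 hp1) h1
      have h4 : 0 ≤ (1 / p : ℝ) ^ #I := by positivity
      rw [abs_le]
    · have := localDensity_le_inv a l p hI (hl p hp)
      constructor <;> linarith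
    · obtain ⟨i, hi, i', hi', hne⟩ := one_lt_card.1 h1
      have := (localDensity_mono a l p (I := I) (J := {i, i'})
        (by intro x hx; simp only [mem_insert, mem_singleton] at hx; rcases hx with rfl | rfl <;> assumption)).trans
        (hE p hp h2 i i' hne)
      constructor <;> linarith

theorem natCast_val_zmod_cast {D p : ℕ} (hpD : p ∣ D) (hD : D ≠ 0) (y : ZMod D) :
    ((y.val : ℕ) : ZMod p) = ZMod.castHom hpD (ZMod p) y := by
  have : NeZero D := ⟨hD⟩
  conv_rhs => rw [← ZMod.natCast_zmod_val y]
  rw [map_natCast]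

/-- The Chinese remainder theorem for the densities. -/
theorem avg_divisibility_eq (a : ι → ℤ) (l : ι → Fin t → ℤ) {P : Finset ℕ}
    (hP : ∀ p ∈ P, p.Prime) (I : ℕ → Finset ι) {D : ℕ} [NeZero D] (hD : D = ∏ p : P, (p : ℕ)) :
    avg (fun y : Fin t → ZMod D =>
      ind (∀ p ∈ P, ∀ i ∈ I p, (p : ℤ) ∣ a i + ∑ j, l i j * ((y j).val : ℤ))) =
      ∏ p ∈ P, localDensity a l p (I p) := by
  subst hD
  have hcop : Pairwise (Function.onFun Nat.Coprime fun p : P => (p : ℕ)) := by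
    intro p q hpq
    exact (Nat.coprime_primes (hP p p.2) (hP q q.2)).2 fun h => hpq (Subtype.ext h)
  have hD0 : (∏ p : P, (p : ℕ)) ≠ 0 := NeZero.ne _
  set Q : (p : P) → (Fin t → ZMod p) → Prop := fun p y =>
    ∀ i ∈ I p, (a i : ZMod p) + ∑ j, (l i j : ZMod p) * y j = 0 with hQ
  let e : (Fin t → ZMod (∏ p : P, (p : ℕ))) ≃ ((p : P) → Fin t → ZMod p) :=
    (Equiv.piCongrRight fun _ => (ZMod.prodEquivPi (fun p : P => (p : ℕ)) hcop).toEquiv).trans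
      (Equiv.piComm _)
  have he : ∀ y p j, e y p j = (((y j).val : ℕ) : ZMod p) := by
    intro y p j
    rw [natCast_val_zmod_cast (dvd_prod_of_mem (fun p : P => (p : ℕ)) (mem_univ p)) hD0,
      ← ZMod.prodEquivPi_apply _ hcop]
    rfl
  have hcond : ∀ y, (∀ p ∈ P, ∀ i ∈ I p, (p : ℤ) ∣ a i + ∑ j, l i j * ((y j).val : ℤ)) ↔
      ∀ p : P, Q p (e y p) := by
    intro y
    simp only [hQ, he, Subtype.forall]
    refine forall₂_congr fun p hp => forall₂_congr fun i _ => ?_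
    rw [← ZMod.intCast_zmod_eq_zero_iff_dvd]
    push_cast
    rfl
  rw [avg_ind, Nat.card_congr ((e.subtypeEquiv hcond).trans (Equiv.subtypePiEquivPi)),
    Nat.card_pi]
  simp only [Fintype.card_pi, ZMod.card, prod_const, card_univ, Fintype.card_fin]
  rw [Nat.cast_prod, Nat.cast_pow, Nat.cast_prod, ← prod_pow, ← prod_div_distrib,
    ← Finset.prod_coe_sort P]
  rfl

theorem avg_affine {N : ℕ} [Fact N.Prime] {L : Fin t → ZMod N} (hL : L ≠ 0) (b : ZMod N)
    (F : ZMod N → ℝ) : avg (fun x : Fin t → ZMod N => F (∑ j, L j * x j + b)) = avg F := by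
  rw [← avg_equiv (Equiv.addRight b) F]
  exact avg_comp_surjective (linForm L) (linForm_surjective hL) fun v => F (v + b)

/-- Few residues are within `B` of a multiple of `N`. -/
theorem avg_near_ends_le {N : ℕ} [Fact N.Prime] (B : ℕ) :
    avg (fun v : ZMod N => ind (v.val < B ∨ N ≤ v.val + B)) ≤ 2 * B / N := by
  unfold avg
  rw [ZMod.card]
  gcongr
  simp only [ind_eq, sum_boole]
  have h : #{v : ZMod N | v.val < B ∨ N ≤ v.val + B} ≤ #(range B ∪ Ico (N - B) N) := by
    refine card_le_card_of_injOn ZMod.val ?_ (ZMod.val_injective N).injOn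
    intro v hv
    have := ZMod.val_lt v
    simp only [coe_filter, mem_univ, true_and, Set.mem_ofPred_eq] at hv
    simp only [coe_union, Set.mem_union, mem_coe, mem_range, mem_Ico]
    omega
  have h2 : #(range B ∪ Ico (N - B) N) ≤ 2 * B := by
    refine (card_union_le _ _).trans ?_
    rw [card_range, Nat.card_Ico]
    omega
  exact_mod_cast h.trans h2

theorem prod_divInd [Fintype ι] [DecidableEq ι] (u : ι → Finset ℕ) {P : Finset ℕ} (hu : ∀ i, u i ⊆ P)
    (n : ι → ℤ) :
    ∏ i, divInd (u i) (n i) =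
      ind (∀ p ∈ P, ∀ i ∈ ({i | p ∈ u i} : Finset ι), (p : ℤ) ∣ n i) := by
  classical
  simp only [divInd, ind_eq]
  rw [Finset.prod_ite_zero]
  simp only [prod_const_one, mem_univ, true_imp_iff, mem_filter, true_and]
  refine if_congr ⟨fun h p _ i hi => h i p hi, fun h i p hp => h p (hu i hp) i hp⟩ rfl rfl

/-- The proportion of `x` at which given primes divide given forms is the average of the products of
local densities. The average over `x` is unchanged by the shifts `x + M y`, `0 ≤ y < D`, and these
do not wrap around modulo `N` unless one of the forms is close to `0` or `N` at `x`. The factor `M`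
clears the denominators of the coefficients: along the shifts the forms vary with the small integer
coefficients `l`. -/
theorem abs_avg_prod_divInd_sub_le [Fintype ι] [DecidableEq ι] {N : ℕ} [Fact N.Prime] (M W C : ℕ)
    (L : ι → Fin t → ZMod N) (b : ι → ZMod N) (l : ι → Fin t → ℤ)
    (hl : ∀ i j, (M : ZMod N) * L i j = l i j) (hL : ∀ i, L i ≠ 0) (hC : ∀ i, ∑ j, |l i j| ≤ C)
    (u : ι → Finset ℕ) {P : Finset ℕ} (hP : ∀ p ∈ P, p.Prime) (hu : ∀ i, u i ⊆ P) :
    |avg (fun x : Fin t → ZMod N => ∏ i, divInd (u i) (W * (∑ j, L i j * x j + b i).val + 1)) -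
      avg (fun x : Fin t → ZMod N => ∏ p ∈ P, localDensity
        (fun i => (W * (∑ j, L i j * x j + b i).val + 1 : ℤ)) (fun i j => W * l i j) p {i | p ∈ u i})| ≤
      Fintype.card ι * (2 * (C * ∏ p ∈ P, (p : ℝ)) / N) := by
  set D := ∏ p : P, (p : ℕ) with hD
  have hDP : D = ∏ p ∈ P, p := by rw [hD, Finset.prod_coe_sort P (fun p => p)]
  have : NeZero D := ⟨by rw [hDP]; exact prod_ne_zero_iff.2 fun p hp => (hP p hp).ne_zero⟩
  set ψ : ι → (Fin t → ZMod N) → ZMod N := fun i x => ∑ j, L i j * x j + b i with hψ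
  set f : (Fin t → ZMod N) → ℝ := fun x => ∏ i, divInd (u i) (W * (ψ i x).val + 1) with hf
  set h : (Fin t → ZMod N) → ℝ := fun x => ∏ p ∈ P, localDensity
        (fun i => (W * (ψ i x).val + 1 : ℤ)) (fun i j => W * l i j) p {i | p ∈ u i} with hh
  set sh : (Fin t → ZMod D) → Fin t → ZMod N := fun y j => (M : ZMod N) * ((y j).val : ZMod N) with hsh
  set g : (Fin t → ZMod N) → ℝ := fun x => avg fun y : Fin t → ZMod D => f (x + sh y) with hg
  -- `g x` is the average of `f` over a box of shifts of `x`.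
  have hfg : avg f = avg g := by
    rw [hg, avg_comm]
    have : ∀ y : Fin t → ZMod D, avg (fun x => f (x + sh y)) = avg f := fun y =>
      avg_equiv (Equiv.addRight (sh y)) f
    simp_rw [this]
    rw [avg_const]
  -- Without wraparound, the representatives of the forms are affine in `y`, and the Chinese
  -- remainder theorem computes the average over the box exactly.
  have hgood : ∀ x, (∀ i, C * D ≤ (ψ i x).val ∧ (ψ i x).val + C * D < N) → g x = h x := by
    intro x hx
    rw [hh, hg]
    dsimp only
    rw [← avg_divisibility_eq _ _ hP _ hD]
    refine congrArg avg (funext fun y => ?_)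
    have hval : ∀ i, (((ψ i (x + sh y)).val : ℕ) : ℤ) = (ψ i x).val + ∑ j, l i j * ((y j).val : ℤ) := by
      intro i
      have hcast : ψ i (x + sh y) = (((ψ i x).val + ∑ j, l i j * ((y j).val : ℤ) : ℤ) : ZMod N) := by
        push_cast
        rw [ZMod.natCast_zmod_val]
        simp only [hψ, hsh, Pi.add_apply, mul_add, sum_add_distrib]
        have : ∀ j, L i j * ((M : ZMod N) * ((y j).val : ZMod N)) = (l i j : ZMod N) * ((y j).val : ZMod N) := by
          intro j; rw [← hl]; ring
        simp_rw [this]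
        ring
      have habs : |∑ j, l i j * ((y j).val : ℤ)| ≤ C * D := by
        calc |∑ j, l i j * ((y j).val : ℤ)| ≤ ∑ j, |l i j| * D := by
              refine (abs_sum_le_sum_abs _ _).trans (sum_le_sum fun j _ => ?_)
              rw [abs_mul, Nat.abs_cast]
              gcongr
              exact (ZMod.val_lt (y j)).le
          _ ≤ _ := by
              rw [← sum_mul]
              gcongr
              exact hC i
      obtain ⟨h1, h2⟩ := hx i
      have h1' : (C * D : ℤ) ≤ (ψ i x).val := by exact_mod_cast h1
      have h2' : ((ψ i x).val + C * D : ℤ) < N := by exact_mod_cast h2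
      rw [abs_le] at habs
      rw [hcast, ZMod.val_intCast]
      exact Int.emod_eq_of_lt (by linarith) (by linarith)
    rw [hf]
    dsimp only
    rw [prod_divInd u hu]
    refine congrArg ind (propext (forall₂_congr fun p _ => forall₂_congr fun i _ => ?_))
    rw [hval i, mul_add, mul_sum]
    simp only [mul_assoc]
    rw [add_right_comm]
  have hf01 : ∀ x, 0 ≤ f x ∧ f x ≤ 1 := fun x =>
    ⟨prod_nonneg fun _ _ => divInd_nonneg _ _,
      prod_le_one (fun _ _ => divInd_nonneg _ _) fun _ _ => divInd_le_one _ _⟩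
  have hg01 : ∀ x, 0 ≤ g x ∧ g x ≤ 1 := by
    intro x
    refine ⟨avg_nonneg fun y => (hf01 _).1, ?_⟩
    refine (avg_mono fun y => (hf01 _).2).trans ?_
    rw [avg_const]
  have hh01 : ∀ x, 0 ≤ h x ∧ h x ≤ 1 := by
    intro x
    refine ⟨prod_nonneg fun p _ => localDensity_nonneg _ _ _ _,
      prod_le_one (fun p _ => localDensity_nonneg _ _ _ _) fun p hp => ?_⟩
    have := Fact.mk (hP p hp)
    rw [← localDensity_empty (fun i => (W * (ψ i x).val + 1 : ℤ)) (fun i j => W * l i j) p]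
    exact localDensity_mono _ _ _ (empty_subset _)
  change |avg f - avg h| ≤ _
  rw [hfg, ← avg_sub]
  refine (abs_avg_le _).trans ?_
  have hbd : ∀ x, |g x - h x| ≤ ∑ i,
      ind ((ψ i x).val < C * D ∨ N ≤ (ψ i x).val + C * D) := by
    intro x
    by_cases hx : ∀ i, C * D ≤ (ψ i x).val ∧ (ψ i x).val + C * D < N
    · rw [hgood x hx, sub_self, abs_zero]
      exact sum_nonneg fun i _ => ind_nonneg _
    · push Not at hx
      obtain ⟨i, hi⟩ := hx
      refine le_trans ?_ (Finset.single_le_sum (fun i _ => ind_nonneg _) (mem_univ i))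
      classical
      rw [ind_eq, if_pos, abs_le]
      · constructor <;> linarith [(hg01 x).1, (hg01 x).2, (hh01 x).1, (hh01 x).2]
      · by_cases h1 : C * D ≤ (ψ i x).val
        · exact Or.inr (hi h1)
        · exact Or.inl (not_le.1 h1)
  refine (avg_mono hbd).trans ?_
  rw [avg_sum]
  calc _ ≤ ∑ i : ι, 2 * ((C * D : ℕ) : ℝ) / N := by
        refine sum_le_sum fun i _ => ?_
        have := avg_affine (hL i) (b i)
          (fun v => ind (v.val < C * D ∨ N ≤ v.val + C * D))
        simp only [hψ]
        rw [this]
        exact avg_near_ends_le (C * D)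
    _ = _ := by
        rw [sum_const, card_univ, nsmul_eq_mul, hDP]
        push_cast
        ring

end PrimeMajorant

/-! ### The weights of Brun and of Selberg -/

namespace PrimeMajorant

/-- Comparison of sums of non-negative terms along an injection of the index sets. -/
theorem sum_le_sum_of_injOn {κ κ' : Type*} {s : Finset κ} {t : Finset κ'} (i : κ → κ')
    {f : κ → ℝ} {g : κ' → ℝ} (hi : Set.InjOn i s) (hst : ∀ x ∈ s, i x ∈ t)
    (hfg : ∀ x ∈ s, f x ≤ g (i x)) (hg : ∀ y ∈ t, 0 ≤ g y) : ∑ x ∈ s, f x ≤ ∑ y ∈ t, g y := by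
  classical
  calc ∑ x ∈ s, f x ≤ ∑ x ∈ s, g (i x) := sum_le_sum hfg
    _ = ∑ y ∈ s.image i, g y := (sum_image hi).symm
    _ ≤ _ := by
        refine sum_le_sum_of_subset_of_nonneg (image_subset_iff.2 hst) fun y hy _ => hg y hy

theorem sum_mul_divInd (P : Finset ℕ) (c : Finset ℕ → ℝ) (n : ℤ) :
    ∑ s ∈ P.powerset, c s * divInd s n = ∑ s ∈ (P.filter fun p : ℕ => (p : ℤ) ∣ n).powerset, c s := by
  classical
  simp only [divInd, ind_eq, mul_ite, mul_one, mul_zero]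
  rw [← sum_filter]
  refine sum_congr ?_ fun _ _ => rfl
  ext s
  simp only [mem_filter, mem_powerset, subset_iff]
  exact ⟨fun h p hp => ⟨h.1 hp, h.2 p hp⟩, fun h => ⟨fun p hp => (h hp).1, fun p hp => (h hp).2⟩⟩

/-- Brun's pure sieve, `∑ μ(d)` over the `d ∣ n` composed of at most `2r` primes of `P`. -/
noncomputable def brunSum (P : Finset ℕ) (r : ℕ) (n : ℤ) : ℝ :=
  ∑ s ∈ P.powerset, brunWeight r s * divInd s n

theorem sum_brunWeight_powerset (r : ℕ) (q : Finset ℕ) :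
    ∑ s ∈ q.powerset, brunWeight r s =
      ((∑ j ∈ range (2 * r + 1), (-1) ^ j * ((#q).choose j : ℤ) : ℤ) : ℝ) := by
  have h := sum_powerset_apply_card (fun j => if j ≤ 2 * r then (-1 : ℝ) ^ j else 0) (x := q)
  simp only [brunWeight]
  rw [h]
  push_cast
  simp only [nsmul_eq_mul, mul_ite, mul_zero]
  rw [← sum_filter]
  have hsub : (range (#q + 1)).filter (fun j => j ≤ 2 * r) ⊆ range (2 * r + 1) := by
    intro j hj
    simp only [mem_filter, mem_range] at hj ⊢
    omega
  rw [sum_subset hsub]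
  · exact sum_congr rfl fun j _ => mul_comm _ _
  · intro j hj hj'
    simp only [mem_filter, mem_range] at hj hj'
    rw [Nat.choose_eq_zero_of_lt (by omega)]
    simp

/-- Truncating `∑ μ(d)` after an even number of prime factors gives an upper bound for the sieve: the
alternating sum of the binomial coefficients up to `2r` is again a binomial coefficient. -/
theorem brunSum_nonneg (P : Finset ℕ) (r : ℕ) (n : ℤ) : 0 ≤ brunSum P r n := by
  rw [brunSum, sum_mul_divInd, sum_brunWeight_powerset]
  rcases Nat.eq_zero_or_eq_succ_pred (#(P.filter fun p : ℕ => (p : ℤ) ∣ n)) with h | h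
  · rw [h, Int.cast_nonneg_iff, Finset.sum_eq_single 0]
    · simp
    · intro j _ hj
      rw [Nat.choose_eq_zero_of_lt (by omega)]
      simp
    · simp
  · rw [h, Int.cast_nonneg_iff, Nat.succ_eq_add_one, Int.alternating_sum_range_choose_eq_choose]
    simp

theorem brunSum_eq_one {P : Finset ℕ} {n : ℤ} (r : ℕ) (h : ∀ p ∈ P, ¬ (p : ℤ) ∣ n) :
    brunSum P r n = 1 := by
  rw [brunSum, sum_mul_divInd, filter_false_of_mem h]
  simp [brunWeight]

/-- The multiplicative function `∏ 1/(p-1)`, that is `1/φ` on squarefree numbers. -/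
noncomputable def invTotient (s : Finset ℕ) : ℝ := ∏ p ∈ s, 1 / ((p : ℝ) - 1)

/-- The subsets of `P` whose product is at most `R`. -/
def boundedSubsets (P : Finset ℕ) (R : ℕ) : Finset (Finset ℕ) :=
  P.powerset.filter fun s => ∏ p ∈ s, p ≤ R

/-- The sum `∑ 1/φ(d)` over the squarefree `d ≤ R` composed of primes of `P`. -/
noncomputable def selbergSum (P : Finset ℕ) (R : ℕ) : ℝ := ∑ v ∈ boundedSubsets P R, invTotient v

/-- Selberg's weights `λ_d`, in the form `λ_d = d μ(d) H⁻¹ ∑ 1/φ(v)`, where `v` ranges over the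
multiples of `d` with `v ≤ R`. -/
noncomputable def selbergWeight (P : Finset ℕ) (R : ℕ) (s : Finset ℕ) : ℝ :=
  (∏ p ∈ s, (p : ℝ)) * (-1) ^ #s / selbergSum P R *
    ∑ v ∈ boundedSubsets P R with s ⊆ v, invTotient v

variable {P : Finset ℕ} {R : ℕ}

theorem invTotient_nonneg {s : Finset ℕ} (hs : ∀ p ∈ s, p.Prime) : 0 ≤ invTotient s :=
  prod_nonneg fun p hp => by
    have : (1 : ℝ) ≤ p := by exact_mod_cast (hs p hp).one_le
    exact one_div_nonneg.2 (by linarith)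

theorem mem_boundedSubsets {s : Finset ℕ} :
    s ∈ boundedSubsets P R ↔ s ⊆ P ∧ ∏ p ∈ s, p ≤ R := by
  simp [boundedSubsets]

theorem one_le_selbergSum (hP : ∀ p ∈ P, p.Prime) (hR : 1 ≤ R) : 1 ≤ selbergSum P R := by
  have := Finset.single_le_sum (f := invTotient) (s := boundedSubsets P R)
    (fun s hs => invTotient_nonneg fun p hp => hP p ((mem_boundedSubsets.1 hs).1 hp))
    (a := ∅) (mem_boundedSubsets.2 (by simpa using hR))
  rw [invTotient, prod_empty] at this
  exact this

theorem selbergWeight_empty (hP : ∀ p ∈ P, p.Prime) (hR : 1 ≤ R) : selbergWeight P R ∅ = 1 := by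
  have := one_le_selbergSum hP hR
  unfold selbergWeight
  simp only [prod_empty, card_empty, pow_zero, mul_one, empty_subset, filter_true]
  rw [← selbergSum, one_div_mul_cancel (by linarith)]

theorem prod_natCast_pos {s : Finset ℕ} (hs : ∀ p ∈ s, p.Prime) : 0 < ∏ p ∈ s, p :=
  prod_pos fun p hp => (hs p hp).pos

theorem prod_le_prod_of_subset_primes {s v : Finset ℕ} (hv : ∀ p ∈ v, p.Prime) (h : s ⊆ v) :
    ∏ p ∈ s, p ≤ ∏ p ∈ v, p :=
  prod_le_prod_of_subset_of_one_le' h fun p hp _ => (hv p hp).one_le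

theorem selbergWeight_eq_zero (hP : ∀ p ∈ P, p.Prime) {s : Finset ℕ} (hs : R < ∏ p ∈ s, p) :
    selbergWeight P R s = 0 := by
  unfold selbergWeight
  rw [filter_false_of_mem, sum_empty, mul_zero]
  intro v hv hsv
  obtain ⟨hvP, hvR⟩ := mem_boundedSubsets.1 hv
  have := prod_le_prod_of_subset_primes (fun p hp => hP p (hvP hp)) hsv
  omega

/-- The weights are bounded by `d/φ(d) ≤ 2^{ω(d)}`: removing `d` from its multiples `v`
injects these into the range of summation of `H`. -/
theorem abs_selbergWeight_le (hP : ∀ p ∈ P, p.Prime) (hR : 1 ≤ R) {s : Finset ℕ} (hs : s ⊆ P) :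
    |selbergWeight P R s| ≤ 2 ^ #s := by
  have hH := one_le_selbergSum hP hR
  have hsP : ∀ p ∈ s, p.Prime := fun p hp => hP p (hs hp)
  have hsum : ∑ v ∈ boundedSubsets P R with s ⊆ v, invTotient v ≤
      invTotient s * selbergSum P R := by
    rw [selbergSum, mul_sum]
    refine sum_le_sum_of_injOn (fun v => v \ s) ?_ ?_ ?_ ?_
    · intro v hv v' hv' h
      simp only [coe_filter, Set.mem_ofPred_eq] at hv hv'
      rw [← sdiff_union_of_subset hv.2, ← sdiff_union_of_subset hv'.2]
      exact congrArg (· ∪ s) h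
    · intro v hv
      rw [mem_filter, mem_boundedSubsets] at hv
      rw [mem_boundedSubsets]
      exact ⟨sdiff_subset.trans hv.1.1,
        (prod_le_prod_of_subset_primes (fun p hp => hP p (hv.1.1 hp)) sdiff_subset).trans hv.1.2⟩
    · intro v hv
      rw [mem_filter] at hv
      rw [invTotient, invTotient, invTotient, mul_comm, prod_sdiff hv.2]
    · intro v hv
      exact mul_nonneg (invTotient_nonneg hsP)
        (invTotient_nonneg fun p hp => hP p ((mem_boundedSubsets.1 hv).1 hp))
  have h0 : 0 ≤ ∑ v ∈ boundedSubsets P R with s ⊆ v, invTotient v := by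
    refine sum_nonneg fun v hv => invTotient_nonneg fun p hp => ?_
    exact hP p ((mem_boundedSubsets.1 (mem_filter.1 hv).1).1 hp)
  have hprod : (∏ p ∈ s, (p : ℝ)) * invTotient s ≤ 2 ^ #s := by
    rw [invTotient, ← prod_mul_distrib, ← prod_const]
    refine prod_le_prod (fun p hp => ?_) fun p hp => ?_
    all_goals have : (2 : ℝ) ≤ p := by exact_mod_cast (hsP p hp).two_le
    · exact mul_nonneg (by linarith) (one_div_nonneg.2 (by linarith))
    · rw [mul_one_div, div_le_iff₀ (by linarith)]; linarith
  have hpos : (0 : ℝ) ≤ ∏ p ∈ s, (p : ℝ) := prod_nonneg fun _ _ => Nat.cast_nonneg _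
  unfold selbergWeight
  rw [abs_mul, abs_div, abs_mul, abs_pow, abs_neg, abs_one, one_pow, mul_one, abs_of_nonneg hpos,
    abs_of_nonneg h0, abs_of_nonneg (by linarith : 0 ≤ selbergSum P R), div_mul_eq_mul_div,
    div_le_iff₀ (by linarith)]
  calc _ ≤ (∏ p ∈ s, (p : ℝ)) * (invTotient s * selbergSum P R) := by gcongr
    _ = ((∏ p ∈ s, (p : ℝ)) * invTotient s) * selbergSum P R := by ring
    _ ≤ _ := by gcongr

/-- The coefficients of the square of Selberg's divisor sum, `∑ λ_d λ_d'` over `lcm(d, d') = b`. -/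
noncomputable def selbergCoeff (P : Finset ℕ) (R : ℕ) (b : Finset ℕ) : ℝ :=
  ∑ q ∈ P.powerset ×ˢ P.powerset with q.1 ∪ q.2 = b, selbergWeight P R q.1 * selbergWeight P R q.2

theorem sum_selbergCoeff_mul (f : Finset ℕ → ℝ) :
    ∑ b ∈ P.powerset, selbergCoeff P R b * f b =
      ∑ s ∈ P.powerset, ∑ s' ∈ P.powerset,
        selbergWeight P R s * selbergWeight P R s' * f (s ∪ s') := by
  rw [← sum_product', ← sum_fiberwise_of_maps_to (g := fun q : Finset ℕ × Finset ℕ => q.1 ∪ q.2)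
    (t := P.powerset)]
  · refine sum_congr rfl fun b _ => ?_
    rw [selbergCoeff, sum_mul]
    refine sum_congr rfl fun q hq => ?_
    rw [(mem_filter.1 hq).2]
  · intro q hq
    simp only [mem_product, mem_powerset] at hq ⊢
    exact union_subset hq.1 hq.2

theorem sum_selbergCoeff_divInd (n : ℤ) :
    ∑ b ∈ P.powerset, selbergCoeff P R b * divInd b n =
      (∑ s ∈ P.powerset, selbergWeight P R s * divInd s n) ^ 2 := by
  rw [sum_selbergCoeff_mul, sq, sum_mul_sum]
  refine sum_congr rfl fun s _ => sum_congr rfl fun s' _ => ?_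
  rw [divInd_union]; ring

theorem abs_selbergCoeff_le (hP : ∀ p ∈ P, p.Prime) (hR : 1 ≤ R) (b : Finset ℕ) :
    |selbergCoeff P R b| ≤ 16 ^ #b := by
  unfold selbergCoeff
  calc _ ≤ ∑ q ∈ P.powerset ×ˢ P.powerset with q.1 ∪ q.2 = b, (4 : ℝ) ^ #b := by
        refine (abs_sum_le_sum_abs _ _).trans (sum_le_sum fun q hq => ?_)
        simp only [mem_filter, mem_product, mem_powerset] at hq
        have h1 : #q.1 ≤ #b := card_le_card (hq.2 ▸ subset_union_left)
        have h2 : #q.2 ≤ #b := card_le_card (hq.2 ▸ subset_union_right)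
        rw [abs_mul]
        calc _ ≤ (2 : ℝ) ^ #q.1 * 2 ^ #q.2 := by
              gcongr
              · exact abs_selbergWeight_le hP hR hq.1.1
              · exact abs_selbergWeight_le hP hR hq.1.2
          _ ≤ (2 : ℝ) ^ #b * 2 ^ #b := by gcongr <;> norm_num
          _ = 4 ^ #b := by rw [← mul_pow]; norm_num
    _ ≤ (2 ^ #b * 2 ^ #b : ℕ) * (4 : ℝ) ^ #b := by
        rw [sum_const, nsmul_eq_mul]
        gcongr
        rw [← card_powerset, ← card_product]
        refine card_le_card fun q hq => ?_
        simp only [mem_filter, mem_product, mem_powerset] at hq ⊢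
        exact ⟨hq.2 ▸ subset_union_left, hq.2 ▸ subset_union_right⟩
    _ = _ := by push_cast; rw [← mul_pow, ← mul_pow]; norm_num

theorem selbergCoeff_eq_zero (hP : ∀ p ∈ P, p.Prime) {b : Finset ℕ} (hb : R ^ 2 < ∏ p ∈ b, p) :
    selbergCoeff P R b = 0 := by
  refine sum_eq_zero fun q hq => ?_
  simp only [mem_filter, mem_product, mem_powerset] at hq
  by_contra hne
  have h1 : ∏ p ∈ q.1, p ≤ R := by
    by_contra h
    exact hne (by rw [selbergWeight_eq_zero hP (not_le.1 h), zero_mul])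
  have h2 : ∏ p ∈ q.2, p ≤ R := by
    by_contra h
    exact hne (by rw [selbergWeight_eq_zero hP (not_le.1 h), mul_zero])
  have h3 : ∏ p ∈ b, p ≤ (∏ p ∈ q.1, p) * ∏ p ∈ q.2, p := by
    rw [← prod_union_inter, hq.2]
    exact Nat.le_mul_of_pos_right _
      (prod_natCast_pos fun p hp => hP p (hq.1.1 (mem_inter.1 hp).1))
  have := Nat.mul_le_mul h1 h2
  rw [sq] at hb
  omega

theorem sum_Icc_neg_one_pow_card (u v : Finset ℕ) :
    ∑ s ∈ Icc u v, (-1 : ℝ) ^ #s = if u = v then (-1) ^ #u else 0 := by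
  by_cases h : u ⊆ v
  · rw [Icc_eq_image_powerset h, sum_image]
    · have : ∀ t ∈ (v \ u).powerset, (-1 : ℝ) ^ #(u ∪ t) = (-1) ^ #u * (-1) ^ #t := by
        intro t ht
        rw [card_union_of_disjoint, pow_add]
        exact (disjoint_sdiff.mono_right (mem_powerset.1 ht))
      rw [sum_congr rfl this, ← mul_sum]
      have h2 := congrArg (Int.cast : ℤ → ℝ) (sum_powerset_neg_one_pow_card (x := v \ u))
      push_cast at h2
      rw [h2]
      simp only [sdiff_eq_empty_iff_subset]
      split_ifs with h3 h4 h4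
      · simp
      · exact absurd (h.antisymm h3) h4
      · exact absurd h4.symm.subset h3
      · simp
    · intro t ht t' ht' htt'
      have hd : Disjoint u t := disjoint_sdiff.mono_right (mem_powerset.1 ht)
      have hd' : Disjoint u t' := disjoint_sdiff.mono_right (mem_powerset.1 ht')
      have := congrArg (· \ u) htt'
      simpa [union_sdiff_cancel_left hd, union_sdiff_cancel_left hd'] using this
  · rw [Icc_eq_empty h, sum_empty, if_neg]
    rintro rfl
    exact h subset_rfl

/-- The diagonalising variables of Selberg's quadratic form, obtained by Möbius inversion over the
multiples of `u`. -/
theorem sum_selbergWeight_div (hP : ∀ p ∈ P, p.Prime) (u : Finset ℕ) :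
    ∑ s ∈ P.powerset with u ⊆ s, selbergWeight P R s * ∏ p ∈ s, (1 / p : ℝ) =
      if u ∈ boundedSubsets P R then (-1) ^ #u * invTotient u / selbergSum P R else 0 := by
  have h1 : ∀ s ∈ P.powerset, selbergWeight P R s * ∏ p ∈ s, (1 / p : ℝ) =
      ∑ v ∈ boundedSubsets P R, if s ⊆ v then (-1) ^ #s * (invTotient v / selbergSum P R) else 0 := by
    intro s hs
    have hne : ∏ p ∈ s, (p : ℝ) ≠ 0 := prod_ne_zero_iff.2 fun p hp => by
      exact_mod_cast (hP p (mem_powerset.1 hs hp)).ne_zero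
    rw [selbergWeight, ← sum_filter, ← mul_sum, ← sum_div, prod_div_distrib, prod_const_one]
    field_simp
  rw [sum_congr rfl fun s hs => h1 s (mem_filter.1 hs).1, sum_comm]
  have h2 : ∀ v ∈ boundedSubsets P R, (∑ s ∈ P.powerset with u ⊆ s,
      if s ⊆ v then (-1) ^ #s * (invTotient v / selbergSum P R) else 0) =
      if u = v then (-1) ^ #u * (invTotient v / selbergSum P R) else 0 := by
    intro v hv
    rw [← sum_filter, ← sum_mul]
    have : (P.powerset.filter fun s => u ⊆ s).filter (fun s => s ⊆ v) = Icc u v := by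
      ext s
      simp only [mem_filter, mem_powerset, mem_Icc]
      exact ⟨fun h => ⟨h.1.2, h.2⟩, fun h => ⟨⟨h.2.trans (mem_boundedSubsets.1 hv).1, h.1⟩, h.2⟩⟩
    rw [this, sum_Icc_neg_one_pow_card, ite_mul, zero_mul]
  rw [sum_congr rfl h2, sum_ite_eq]
  simp only [mul_div_assoc]

/-- Selberg's quadratic form `∑ λ_d λ_d' / lcm(d, d')` takes the value `1/H` at his weights. It is
diagonalised by the identity `gcd(d, d') = ∑ φ(u)` over the common divisors `u` of `d` and `d'`. -/
theorem sum_selbergCoeff_div (hP : ∀ p ∈ P, p.Prime) (hR : 1 ≤ R) :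
    ∑ b ∈ P.powerset, selbergCoeff P R b * ∏ p ∈ b, (1 / p : ℝ) = 1 / selbergSum P R := by
  have hH := one_le_selbergSum hP hR
  rw [sum_selbergCoeff_mul]
  have hp1 : ∀ p ∈ P, (1 : ℝ) < p := fun p hp => by exact_mod_cast (hP p hp).one_lt
  have h1 : ∀ s ∈ P.powerset, ∀ s' ∈ P.powerset, (∏ p ∈ s ∪ s', (1 / p : ℝ)) =
      ∑ u ∈ P.powerset, (if u ⊆ s then ∏ p ∈ s, (1 / p : ℝ) else 0) *
        (if u ⊆ s' then ∏ p ∈ s', (1 / p : ℝ) else 0) * ∏ p ∈ u, ((p : ℝ) - 1) := by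
    intro s hs s' hs'
    rw [mem_powerset] at hs hs'
    have e1 : ∏ p ∈ s ∩ s', (p : ℝ) = ∑ u ∈ (s ∩ s').powerset, ∏ p ∈ u, ((p : ℝ) - 1) := by
      rw [← prod_one_add]
      exact prod_congr rfl fun p _ => by ring
    have e2 : (∏ p ∈ s ∪ s', (1 / p : ℝ)) = (∏ p ∈ s, (1 / p : ℝ)) * (∏ p ∈ s', (1 / p : ℝ)) *
        ∏ p ∈ s ∩ s', (p : ℝ) := by
      rw [← prod_union_inter, mul_assoc, ← prod_mul_distrib,
        prod_congr rfl (g := fun _ => (1 : ℝ)) (s₁ := s ∩ s'), prod_const_one, mul_one]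
      · intro p hp
        have := hp1 p (hs (mem_inter.1 hp).1)
        rw [one_div_mul_cancel (by linarith)]
    have e3 : (s ∩ s').powerset = P.powerset.filter fun u => u ⊆ s ∧ u ⊆ s' := by
      ext u
      simp only [mem_powerset, mem_filter, subset_inter_iff]
      exact ⟨fun h => ⟨h.1.trans hs, h⟩, fun h => h.2⟩
    rw [e2, e1, e3, sum_filter, mul_sum]
    refine sum_congr rfl fun u _ => ?_
    by_cases hu : u ⊆ s <;> by_cases hu' : u ⊆ s' <;> simp [hu, hu']
  have h2 : ∑ s ∈ P.powerset, ∑ s' ∈ P.powerset,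
      selbergWeight P R s * selbergWeight P R s' * ∏ p ∈ s ∪ s', (1 / p : ℝ) =
      ∑ u ∈ P.powerset, (∏ p ∈ u, ((p : ℝ) - 1)) *
        (∑ s ∈ P.powerset with u ⊆ s, selbergWeight P R s * ∏ p ∈ s, (1 / p : ℝ)) ^ 2 := by
    calc _ = ∑ s ∈ P.powerset, ∑ s' ∈ P.powerset, ∑ u ∈ P.powerset, (∏ p ∈ u, ((p : ℝ) - 1)) *
          ((if u ⊆ s then selbergWeight P R s * ∏ p ∈ s, (1 / p : ℝ) else 0) *
          (if u ⊆ s' then selbergWeight P R s' * ∏ p ∈ s', (1 / p : ℝ) else 0)) := by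
          refine sum_congr rfl fun s hs => sum_congr rfl fun s' hs' => ?_
          rw [h1 s hs s' hs', mul_sum]
          refine sum_congr rfl fun u _ => ?_
          by_cases hu : u ⊆ s <;> by_cases hu' : u ⊆ s' <;> simp only [hu, hu', if_true, if_false] <;> ring
      _ = _ := by
          rw [sum_congr rfl fun s _ => sum_comm, sum_comm]
          refine sum_congr rfl fun u _ => ?_
          rw [sq, sum_filter, sum_mul_sum, mul_sum]
          refine sum_congr rfl fun s _ => ?_
          rw [mul_sum]
  rw [h2]
  have h3 : ∀ u ∈ P.powerset, (∏ p ∈ u, ((p : ℝ) - 1)) *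
        (∑ s ∈ P.powerset with u ⊆ s, selbergWeight P R s * ∏ p ∈ s, (1 / p : ℝ)) ^ 2 =
      if u ∈ boundedSubsets P R then invTotient u / selbergSum P R ^ 2 else 0 := by
    intro u hu
    rw [sum_selbergWeight_div hP]
    split_ifs
    · have : (∏ p ∈ u, ((p : ℝ) - 1)) * invTotient u = 1 := by
        rw [invTotient, ← prod_mul_distrib, prod_congr rfl, prod_const_one]
        intro p hp
        have := hp1 p (mem_powerset.1 hu hp)
        rw [mul_one_div_cancel (by linarith)]
      have hs : ((-1 : ℝ) ^ #u) ^ 2 = 1 := by rw [← pow_mul, mul_comm, pow_mul]; simp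
      rw [div_pow, mul_pow, hs, one_mul, sq (invTotient u), mul_div_assoc', ← mul_assoc, this, one_mul]
    · simp
  rw [sum_congr rfl h3, ← sum_filter]
  have h4 : P.powerset.filter (fun u => u ∈ boundedSubsets P R) = boundedSubsets P R := by
    ext u; simp only [mem_filter, mem_powerset, mem_boundedSubsets]; tauto
  rw [h4, ← sum_div, ← selbergSum, sq, ← div_div, div_self (by linarith)]

end PrimeMajorant

/-! ### Sums and products over primes -/

namespace PrimeMajorant

/-- The product of the primes in `(2^i, 2^{i+1}]` is at most `4^{2^{i+1}}`, which bounds their number. -/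
theorem sum_inv_dyadic_le {i : ℕ} (hi : 1 ≤ i) :
    ∑ p ∈ (Nat.primesLE (2 ^ (i + 1))).filter (fun p => 2 ^ i < p), (1 / p : ℝ) ≤ 4 / i := by
  set S := (Nat.primesLE (2 ^ (i + 1))).filter (fun p => 2 ^ i < p) with hS
  have hi0 : (0 : ℝ) < i := by exact_mod_cast hi
  have h1 : (2 ^ i) ^ #S ≤ 4 ^ (2 ^ (i + 1)) := by
    calc (2 ^ i) ^ #S ≤ ∏ p ∈ S, p := by
          rw [← prod_const]
          exact prod_le_prod' fun p hp => (mem_filter.1 hp).2.le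
      _ ≤ ∏ p ∈ Nat.primesLE (2 ^ (i + 1)), p :=
          prod_le_prod_of_subset_primes (fun p hp => (Nat.mem_primesLE.1 hp).2) (filter_subset _ _)
      _ ≤ _ := primorial_le_four_pow _
  have h2 : i * #S ≤ 4 * 2 ^ i := by
    have : 2 ^ (i * #S) ≤ 2 ^ (4 * 2 ^ i) := by
      calc 2 ^ (i * #S) = (2 ^ i) ^ #S := by rw [pow_mul]
        _ ≤ _ := h1
        _ = 2 ^ (4 * 2 ^ i) := by
          rw [show (4 : ℕ) = 2 ^ 2 by norm_num, ← pow_mul]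
          congr 1
          ring
    exact (Nat.pow_le_pow_iff_right (by norm_num)).1 this
  calc ∑ p ∈ S, (1 / p : ℝ) ≤ ∑ p ∈ S, (1 / 2 ^ i : ℝ) := by
        refine sum_le_sum fun p hp => ?_
        have : ((2 : ℝ) ^ i) ≤ p := by exact_mod_cast (mem_filter.1 hp).2.le
        gcongr
    _ = #S / 2 ^ i := by rw [sum_const, nsmul_eq_mul, mul_one_div]
    _ ≤ 4 / i := by
        rw [div_le_div_iff₀ (by positivity) hi0, mul_comm]
        exact_mod_cast h2

/-- A weak form of Mertens' second theorem: the dyadic bounds add up to a harmonic sum. -/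
theorem sum_inv_primesLE_le (j : ℕ) :
    ∑ p ∈ Nat.primesLE (2 ^ (j + 1)), (1 / p : ℝ) ≤ 5 + 4 * Real.log (j + 1) := by
  have h : ∑ p ∈ Nat.primesLE (2 ^ (j + 1)), (1 / p : ℝ) ≤ 1 + 4 * (harmonic j : ℚ) := by
    induction j with
    | zero =>
      have : Nat.primesLE (2 ^ (0 + 1)) = {2} := by decide
      rw [this]
      norm_num
    | succ j ih =>
      have hsplit : ∑ p ∈ Nat.primesLE (2 ^ (j + 1 + 1)), (1 / p : ℝ) =
          ∑ p ∈ Nat.primesLE (2 ^ (j + 1)), (1 / p : ℝ) +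
          ∑ p ∈ (Nat.primesLE (2 ^ (j + 1 + 1))).filter (fun p => 2 ^ (j + 1) < p), (1 / p : ℝ) := by
        rw [← sum_filter_not_add_sum_filter _ (fun p => 2 ^ (j + 1) < p)]
        congr 1
        refine sum_congr ?_ fun _ _ => rfl
        ext p
        simp only [mem_filter, Nat.mem_primesLE, not_lt]
        have : 2 ^ (j + 1) ≤ 2 ^ (j + 1 + 1) := Nat.pow_le_pow_right (by norm_num) (by omega)
        constructor
        · rintro ⟨⟨_, h1⟩, h2⟩; exact ⟨h2, h1⟩
        · rintro ⟨h1, h2⟩; exact ⟨⟨h1.trans this, h2⟩, h1⟩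
      have := sum_inv_dyadic_le (i := j + 1) (by omega)
      rw [hsplit, harmonic_succ]
      push_cast at this ⊢
      rw [div_eq_mul_inv] at this
      linarith
  have h2 := harmonic_le_one_add_log j
  have h3 : Real.log j ≤ Real.log (j + 1) := by
    rcases Nat.eq_zero_or_pos j with rfl | hj
    · simp
    · exact Real.log_le_log (by exact_mod_cast hj) (by linarith)
  linarith

theorem prod_one_add_div_le (M : ℕ) {j : ℕ} {P : Finset ℕ} (hP : P ⊆ Nat.primesLE (2 ^ (j + 1))) :
    ∏ p ∈ P, (1 + M / p : ℝ) ≤ Real.exp (5 * M) * (j + 1) ^ (4 * M) := by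
  have hj : (0 : ℝ) < j + 1 := by positivity
  calc ∏ p ∈ P, (1 + M / p : ℝ) ≤ Real.exp (∑ p ∈ P, (M / p : ℝ)) :=
        Real.prod_one_add_le_exp_sum _ fun p => by positivity
    _ ≤ Real.exp (M * (5 + 4 * Real.log (j + 1))) := by
        refine Real.exp_le_exp.2 ?_
        calc ∑ p ∈ P, (M / p : ℝ) = M * ∑ p ∈ P, (1 / p : ℝ) := by
              rw [mul_sum]; simp [div_eq_mul_inv]
          _ ≤ M * ∑ p ∈ Nat.primesLE (2 ^ (j + 1)), (1 / p : ℝ) := by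
              gcongr
          _ ≤ _ := by gcongr; exact sum_inv_primesLE_le j
    _ = _ := by
        rw [← Real.exp_log (pow_pos hj (4 * M)), ← Real.exp_add, Real.log_pow]
        push_cast
        ring_nf

theorem sum_inv_sq_le {P : Finset ℕ} {z : ℕ} (hz : z ≠ 0) (hP : ∀ p ∈ P, z < p) :
    ∑ p ∈ P, (1 / (p : ℝ) ^ 2) ≤ (1 / z : ℝ) := by
  -- Any upper bound for the elements of `P` serves.
  set X := z + ∑ p ∈ P, p
  have hsub : P ⊆ Ioc z X := by
    intro p hp
    have := Finset.single_le_sum (f := fun p => p) (s := P) (fun _ _ => Nat.zero_le _) hp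
    exact mem_Ioc.2 ⟨hP p hp, by omega⟩
  have h := sum_Ioc_inv_sq_le_sub (α := ℝ) hz (show z ≤ X by omega)
  have hX : (0 : ℝ) ≤ (X : ℝ)⁻¹ := by positivity
  calc _ ≤ ∑ p ∈ Ioc z X, (1 / (p : ℝ) ^ 2) :=
        sum_le_sum_of_subset_of_nonneg hsub fun _ _ _ => by positivity
    _ ≤ _ := by simp only [one_div]; linarith

theorem totient_primorial_div (n : ℕ) :
    (Nat.totient (primorial n) : ℝ) / primorial n = ∏ p ∈ Nat.primesLE n, (1 - 1 / p : ℝ) := by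
  have h := congrArg (Rat.cast : ℚ → ℝ) (Nat.totient_eq_mul_prod_factors (primorial n))
  have h0 : (primorial n : ℝ) ≠ 0 := by exact_mod_cast primorial_ne_zero n
  push_cast at h
  rw [h, mul_div_cancel_left₀ _ h0, primeFactors_primorial]
  simp

theorem factorization_pos_of_mem_primeFactors {n p : ℕ} (h : p ∈ n.primeFactors) :
    0 < n.factorization p :=
  (Nat.prime_of_mem_primeFactors h).factorization_pos_of_dvd
    (Nat.mem_primeFactors.1 h).2.2 (Nat.dvd_of_mem_primeFactors h)

/-- The sum of `1/n` over the `n ≤ R` with prime divisors exactly `s` is at most `∏ 1/(p-1)`, by the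
geometric series. -/
theorem sum_inv_primeFactors_eq_le {s : Finset ℕ} (hs : ∀ p ∈ s, p.Prime) (R : ℕ) :
    ∑ n ∈ Icc 1 R with n.primeFactors = s, (1 / n : ℝ) ≤ invTotient s := by
  have hgeom : ∀ p ∈ s, ∑ e ∈ range R, (1 / p : ℝ) ^ (e + 1) ≤ 1 / ((p : ℝ) - 1) := by
    intro p hp
    have hp2 : (2 : ℝ) ≤ p := by exact_mod_cast (hs p hp).two_le
    have h1 : (1 / p : ℝ) < 1 := by rw [div_lt_one] <;> linarith
    simp_rw [pow_succ]
    rw [← sum_mul, geom_sum_eq h1.ne]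
    have h2 : 0 ≤ (1 / p : ℝ) ^ R := by positivity
    have h3 : ((1 / p : ℝ) ^ R - 1) / (1 / p - 1) * (1 / p) = (1 - (1 / p : ℝ) ^ R) / (p - 1) := by
      have : (p : ℝ) - 1 ≠ 0 := by linarith
      have : (1 : ℝ) - p ≠ 0 := by linarith
      have h5 : (1 / p - 1 : ℝ) = (1 - p) / p := by field_simp
      rw [h5]
      field_simp
      ring
    rw [h3]
    have : 0 < (p : ℝ) - 1 := by linarith
    gcongr
    linarith
  calc _ ≤ ∏ p ∈ s, ∑ e ∈ range R, (1 / p : ℝ) ^ (e + 1) := by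
        rw [prod_sum]
        refine sum_le_sum_of_injOn (fun n => fun p _ => n.factorization p - 1) ?_ ?_ ?_ ?_
        · intro n hn n' hn' h
          simp only [coe_filter, mem_Icc, Set.mem_ofPred_eq] at hn hn'
          refine Nat.eq_of_factorization_eq (by omega) (by omega) fun p => ?_
          by_cases hp : p ∈ s
          · have h1 := congrFun (congrFun h p) hp
            simp only at h1
            have h2 : 0 < n.factorization p :=
              factorization_pos_of_mem_primeFactors (hn.2 ▸ hp)
            have h3 : 0 < n'.factorization p :=
              factorization_pos_of_mem_primeFactors (hn'.2 ▸ hp)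
            omega
          · rw [Finsupp.notMem_support_iff.1 (by rw [Nat.support_factorization, hn.2]; exact hp),
              Finsupp.notMem_support_iff.1 (by rw [Nat.support_factorization, hn'.2]; exact hp)]
        · intro n hn
          simp only [mem_filter, mem_Icc] at hn
          simp only [Finset.mem_pi, mem_range]
          intro p hp
          have := Nat.factorization_lt (n := n) p (by omega)
          omega
        · intro n hn
          simp only [mem_filter, mem_Icc] at hn
          have h1 : (n : ℝ) = ∏ p ∈ s, (p : ℝ) ^ n.factorization p := by
            conv_lhs => rw [← Nat.prod_factorization_pow_eq_self (show n ≠ 0 by omega)]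
            rw [Finsupp.prod, Nat.support_factorization, hn.2]
            push_cast
            rfl
          rw [prod_attach s fun p => (1 / p : ℝ) ^ (n.factorization p - 1 + 1)]
          conv_lhs => rw [h1]
          rw [one_div, ← prod_inv_distrib]
          refine le_of_eq (prod_congr rfl fun p hp => ?_)
          have h2 : 0 < n.factorization p :=
            factorization_pos_of_mem_primeFactors (hn.2 ▸ hp)
          rw [Nat.sub_add_cancel h2, one_div, inv_pow]
        · intro e _
          exact prod_nonneg fun _ _ => by positivity
    _ ≤ _ := prod_le_prod (fun p _ => sum_nonneg fun _ _ => by positivity) hgeom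

theorem sum_invTotient_powerset {P : Finset ℕ} (hP : ∀ p ∈ P, p.Prime) :
    ∑ s ∈ P.powerset, invTotient s = ∏ p ∈ P, (1 - 1 / p : ℝ)⁻¹ := by
  have : ∀ s, invTotient s = ∏ p ∈ s, 1 / ((p : ℝ) - 1) := fun s => rfl
  simp_rw [this]
  rw [← prod_one_add]
  refine prod_congr rfl fun p hp => ?_
  have hp2 : (2 : ℝ) ≤ p := by exact_mod_cast (hP p hp).two_le
  have h1 : (p : ℝ) - 1 ≠ 0 := by linarith
  rw [one_sub_div (by linarith), inv_div]
  field_simp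
  ring

/-- The lower bound for the sum of `1/φ` in Selberg's sieve: grouping the `n ≤ R` by their sets of
prime factors bounds `∑ 1/n` by a sum of `1/φ` over squarefree numbers, and every squarefree number
is the product of one composed of primes `≤ z` and one composed of primes `> z`. -/
theorem log_le_selbergSum_mul (z R : ℕ) :
    Real.log (R + 1) ≤ selbergSum ((Nat.primesLE R).filter (fun p => z < p)) R *
      ∏ p ∈ Nat.primesLE z, (1 - 1 / p : ℝ)⁻¹ := by
  set P := (Nat.primesLE R).filter (fun p => z < p) with hP
  have hPp : ∀ p ∈ P, p.Prime := fun p hp => (Nat.mem_primesLE.1 (mem_filter.1 hp).1).2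
  have hQp : ∀ p ∈ Nat.primesLE z, p.Prime := fun p hp => (Nat.mem_primesLE.1 hp).2
  have hRp : ∀ p ∈ Nat.primesLE R, p.Prime := fun p hp => (Nat.mem_primesLE.1 hp).2
  have h1 : Real.log (R + 1) ≤ ∑ n ∈ Icc 1 R, (1 / n : ℝ) := by
    have := log_add_one_le_harmonic R
    rw [harmonic_eq_sum_Icc] at this
    push_cast at this
    simpa [add_comm] using this
  have h2 : ∑ n ∈ Icc 1 R, (1 / n : ℝ) ≤ ∑ s ∈ boundedSubsets (Nat.primesLE R) R, invTotient s := by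
    rw [← sum_fiberwise_of_maps_to (g := Nat.primeFactors) (t := boundedSubsets (Nat.primesLE R) R)]
    · refine sum_le_sum fun s hs => ?_
      exact sum_inv_primeFactors_eq_le (fun p hp => hRp p ((mem_boundedSubsets.1 hs).1 hp)) R
    · intro n hn
      rw [mem_Icc] at hn
      rw [mem_boundedSubsets]
      have hle : ∏ p ∈ n.primeFactors, p ≤ n := Nat.le_of_dvd hn.1 (Nat.prod_primeFactors_dvd n)
      refine ⟨fun p hp => ?_, hle.trans hn.2⟩
      exact Nat.mem_primesLE.2 ⟨(Nat.le_of_mem_primeFactors hp).trans hn.2,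
        Nat.prime_of_mem_primeFactors hp⟩
  have h3 : ∑ s ∈ boundedSubsets (Nat.primesLE R) R, invTotient s ≤
      ∑ q ∈ boundedSubsets P R ×ˢ (Nat.primesLE z).powerset, invTotient q.1 * invTotient q.2 := by
    refine sum_le_sum_of_injOn (fun s => (s.filter (fun p => z < p), s.filter (fun p => ¬ z < p)))
      ?_ ?_ ?_ ?_
    · intro s _ s' _ h
      rw [Prod.mk.injEq] at h
      rw [← filter_union_filter_not_eq (fun p => z < p) s, h.1, h.2, filter_union_filter_not_eq]
    · intro s hs
      rw [mem_boundedSubsets] at hs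
      rw [mem_product, mem_boundedSubsets, mem_powerset]
      refine ⟨⟨filter_subset_filter _ hs.1, (prod_le_prod_of_subset_primes
        (fun p hp => hRp p (hs.1 hp)) (filter_subset _ _)).trans hs.2⟩, fun p hp => ?_⟩
      rw [mem_filter, not_lt] at hp
      exact Nat.mem_primesLE.2 ⟨hp.2, hRp p (hs.1 hp.1)⟩
    · intro s _
      exact le_of_eq (prod_filter_mul_prod_filter_not s (fun p => z < p) _).symm
    · intro q hq
      rw [mem_product, mem_boundedSubsets, mem_powerset] at hq
      exact mul_nonneg (invTotient_nonneg fun p hp => hPp p (hq.1.1 hp))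
        (invTotient_nonneg fun p hp => hQp p (hq.2 hp))
  rw [← sum_invTotient_powerset hQp, selbergSum, sum_mul_sum, ← sum_product']
  exact h1.trans (h2.trans h3)

theorem selbergSum_le {P : Finset ℕ} (hP : ∀ p ∈ P, p.Prime) (R : ℕ) :
    selbergSum P R ≤ ∏ p ∈ P, (1 - 1 / p : ℝ)⁻¹ := by
  rw [← sum_invTotient_powerset hP]
  refine sum_le_sum_of_subset_of_nonneg (filter_subset _ _) fun s hs _ => ?_
  exact invTotient_nonneg fun p hp => hP p (mem_powerset.1 hs hp)

theorem prod_inv_one_sub_le {P : Finset ℕ} (hP : ∀ p ∈ P, p.Prime) :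
    ∏ p ∈ P, (1 - 1 / p : ℝ)⁻¹ ≤ ∏ p ∈ P, (1 + (2 : ℕ) / p : ℝ) := by
  refine prod_le_prod (fun p hp => ?_) fun p hp => ?_
  all_goals have hp2 : (2 : ℝ) ≤ p := by exact_mod_cast (hP p hp).two_le
  · rw [inv_nonneg, sub_nonneg, div_le_one] <;> linarith
  · have h1 : (p : ℝ) - 1 ≠ 0 := by linarith
    rw [one_sub_div (by linarith), inv_div, div_le_iff₀ (by linarith)]
    have : (1 + (2 : ℕ) / p : ℝ) * (p - 1) = p + (1 - 2 / p) := by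
      push_cast
      field_simp
      ring
    rw [this]
    have : (2 : ℝ) / p ≤ 1 := by rw [div_le_one] <;> linarith
    linarith

/-- The average of `∏_{p ∣ v} (1 + C/p)` is bounded. -/
theorem sum_prod_primeFactors_le {C : ℝ} (hC : 0 ≤ C) (X : ℕ) :
    ∑ v ∈ Icc 1 X, ∏ p ∈ v.primeFactors, (1 + C / p) ≤ X * Real.exp (C * 2) := by
  have h1 : ∀ v ∈ Icc 1 X, ∏ p ∈ v.primeFactors, (1 + C / p) =
      ∑ s ∈ (Nat.primesLE X).powerset, if s ⊆ v.primeFactors then ∏ p ∈ s, (C / p) else 0 := by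
    intro v hv
    rw [mem_Icc] at hv
    rw [prod_one_add, ← sum_filter]
    refine sum_congr ?_ fun _ _ => rfl
    ext s
    simp only [mem_powerset, mem_filter]
    refine ⟨fun h => ⟨fun p hp => ?_, h⟩, fun h => h.2⟩
    exact Nat.mem_primesLE.2 ⟨(Nat.le_of_mem_primeFactors (h hp)).trans hv.2,
        Nat.prime_of_mem_primeFactors (h hp)⟩
  rw [sum_congr rfl h1, sum_comm]
  have h2 : ∀ s ∈ (Nat.primesLE X).powerset,
      (∑ v ∈ Icc 1 X, if s ⊆ v.primeFactors then ∏ p ∈ s, (C / p) else 0) ≤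
        X * ∏ p ∈ s, (C / (p : ℝ) ^ 2) := by
    intro s hs
    have hsp : ∀ p ∈ s, p.Prime := fun p hp => (Nat.mem_primesLE.1 (mem_powerset.1 hs hp)).2
    rw [← sum_filter, sum_const, nsmul_eq_mul]
    have h3 : #((Icc 1 X).filter fun v => s ⊆ v.primeFactors) ≤ X / ∏ p ∈ s, p := by
      rw [← Nat.Ioc_filter_dvd_card_eq_div]
      refine card_le_card fun v hv => ?_
      simp only [mem_filter, mem_Icc, mem_Ioc] at hv ⊢
      refine ⟨by omega, ?_⟩
      exact (prod_dvd_prod_of_subset _ _ _ hv.2).trans (Nat.prod_primeFactors_dvd v)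
    have h4 : (#((Icc 1 X).filter fun v => s ⊆ v.primeFactors) : ℝ) ≤ X / ∏ p ∈ s, (p : ℝ) := by
      refine (Nat.cast_le.2 h3).trans ?_
      refine Nat.cast_div_le.trans ?_
      push_cast
      exact le_rfl
    calc _ ≤ (X / ∏ p ∈ s, (p : ℝ)) * ∏ p ∈ s, (C / p) := by
          have : 0 ≤ ∏ p ∈ s, (C / p : ℝ) := prod_nonneg fun _ _ => by positivity
          gcongr
      _ = _ := by
          rw [prod_div_distrib, prod_div_distrib, prod_pow]
          field_simp
  refine (sum_le_sum h2).trans ?_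
  rw [← mul_sum, ← prod_one_add]
  gcongr
  refine (Real.prod_one_add_le_exp_sum _ fun p => by positivity).trans (Real.exp_le_exp.2 ?_)
  have h5 : ∑ p ∈ Nat.primesLE X, (1 / (p : ℝ) ^ 2) ≤ 2 := by
    have := sum_inv_sq_le (P := Nat.primesLE X) (z := 1) one_ne_zero
      (fun p hp => (Nat.mem_primesLE.1 hp).2.one_lt)
    norm_num at this ⊢
    linarith
  calc _ = C * ∑ p ∈ Nat.primesLE X, (1 / (p : ℝ) ^ 2) := by
        rw [mul_sum]; simp [div_eq_mul_inv]
    _ ≤ _ := by gcongr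

/-- A non-zero number has few large prime factors. -/
theorem pow_card_le_of_dvd {P : Finset ℕ} {z : ℕ} (hP : ∀ p ∈ P, p.Prime) (hz : ∀ p ∈ P, z < p)
    {n : ℕ} (hn : n ≠ 0) (h : ∀ p ∈ P, p ∣ n) : z ^ #P ≤ n := by
  calc z ^ #P ≤ ∏ p ∈ P, p := by
        rw [← prod_const]; exact prod_le_prod' fun p hp => (hz p hp).le
    _ ≤ n := Nat.le_of_dvd (Nat.pos_of_ne_zero hn)
        (Finset.prod_primes_dvd n (fun p hp => (hP p hp).prime) h)

end PrimeMajorant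

/-! ### The majorant and its expansion -/

namespace PrimeMajorant

/-- The majorant, a product of Brun's pure sieve over the primes of `P` and Selberg's sieve over the
primes of `Q`, normalised to have mean value close to `1`. The parameter `r` truncates Brun's sieve
at `2r` prime factors, and `R` is the level of Selberg's sieve. -/
noncomputable def majorant (P Q : Finset ℕ) (r R : ℕ) (n : ℤ) : ℝ :=
  selbergSum Q R * (∏ p ∈ P, (1 - 1 / p : ℝ)⁻¹) * brunSum P r n *
    (∑ s ∈ Q.powerset, selbergWeight Q R s * divInd s n) ^ 2

theorem selbergSum_nonneg {Q : Finset ℕ} (hQ : ∀ p ∈ Q, p.Prime) (R : ℕ) : 0 ≤ selbergSum Q R :=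
  sum_nonneg fun _ hv => invTotient_nonneg fun p hp => hQ p ((mem_boundedSubsets.1 hv).1 hp)

theorem prod_inv_one_sub_nonneg {P : Finset ℕ} (hP : ∀ p ∈ P, p.Prime) :
    0 ≤ ∏ p ∈ P, (1 - 1 / p : ℝ)⁻¹ := by
  refine prod_nonneg fun p hp => ?_
  have hp1 : (1 : ℝ) ≤ p := by exact_mod_cast (hP p hp).one_le
  rw [inv_nonneg, sub_nonneg, div_le_one] <;> linarith

theorem majorant_nonneg {P Q : Finset ℕ} (hP : ∀ p ∈ P, p.Prime) (hQ : ∀ p ∈ Q, p.Prime) (r R : ℕ)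
    (n : ℤ) : 0 ≤ majorant P Q r R n :=
  mul_nonneg (mul_nonneg (mul_nonneg (selbergSum_nonneg hQ R) (prod_inv_one_sub_nonneg hP))
    (brunSum_nonneg P r n)) (sq_nonneg _)

theorem prod_biUnion_le {ι : Type*} [Fintype ι] {P : Finset ℕ} (hP : ∀ p ∈ P, p.Prime) (u : ι → Finset ℕ)
    (hu : ∀ i, u i ⊆ P) :
    ∏ p ∈ univ.biUnion u, (p : ℝ) ≤ ∏ i, ∏ p ∈ u i, (p : ℝ) := by
  rw [prod_prod_mem_eq (univ.biUnion u) (fun p => (p : ℝ)) u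
    (fun i => subset_biUnion_of_mem u (mem_univ i))]
  refine prod_le_prod (fun _ _ => Nat.cast_nonneg _) fun p hp => ?_
  obtain ⟨i, -, hi⟩ := mem_biUnion.1 hp
  have : (1 : ℝ) ≤ p := by exact_mod_cast (hP p (hu i hi)).one_le
  refine le_self_pow₀ this ?_
  rw [Ne, card_eq_zero, ← Ne, ← nonempty_iff_ne_empty]
  exact ⟨i, by simpa using hi⟩

/-- The local factors of the two sieves combine to those of the products of their moduli. -/
theorem prod_local_mul {ι : Type*} [Fintype ι] {P Q : Finset ℕ} (hPQ : Disjoint P Q) {α : ℕ → Finset ι → ℝ}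
    (hα : ∀ p ∈ P ∪ Q, α p ∅ = 1) {a b : ι → Finset ℕ} (ha : ∀ i, a i ⊆ P) (hb : ∀ i, b i ⊆ Q) :
    (∏ p ∈ P, α p {i | p ∈ a i}) * ∏ p ∈ Q, α p {i | p ∈ b i} =
      ∏ p ∈ univ.biUnion (fun i => a i ∪ b i), α p {i | p ∈ a i ∪ b i} := by
  have hsub : univ.biUnion (fun i => a i ∪ b i) ⊆ P ∪ Q :=
    biUnion_subset.2 fun i _ => union_subset_union (ha i) (hb i)
  rw [prod_subset hsub, prod_union hPQ]
  · congr 1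
    · refine prod_congr rfl fun p hp => ?_
      congr 1
      ext i
      simp only [mem_filter, mem_univ, true_and, mem_union]
      exact ⟨Or.inl, fun h => h.resolve_right fun h' => disjoint_left.1 hPQ hp (hb i h')⟩
    · refine prod_congr rfl fun p hp => ?_
      congr 1
      ext i
      simp only [mem_filter, mem_univ, true_and, mem_union]
      exact ⟨Or.inr, fun h => h.resolve_left fun h' => disjoint_left.1 hPQ (ha i h') hp⟩
  · intro p hp hp'
    have : ({i | p ∈ a i ∪ b i} : Finset ι) = ∅ := by
      refine filter_false_of_mem fun i _ hi => hp' (mem_biUnion.2 ⟨i, mem_univ i, hi⟩)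
    rw [this, hα p hp]

variable {ι : Type*} [Fintype ι] [DecidableEq ι]

/-- The average of a product of majorants of forms according to the local densities `α`. -/
noncomputable def localMean (P Q : Finset ℕ) (r R : ℕ) (α : ℕ → Finset ι → ℝ) : ℝ :=
  (selbergSum Q R * ∏ p ∈ P, (1 - 1 / p : ℝ)⁻¹) ^ Fintype.card ι *
    (tupleSum P α (brunWeight r) * tupleSum Q α (selbergCoeff Q R))

/-- Averages of products of majorants of linear forms are averages of their local means: all divisor
sums are expanded, and the equidistribution of the forms is applied to each term. -/
theorem abs_avg_prod_majorant_sub_le {t N : ℕ} [Fact N.Prime] (M W C : ℕ)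
    (L : ι → Fin t → ZMod N) (b : ι → ZMod N) (l : ι → Fin t → ℤ)
    (hl : ∀ i j, (M : ZMod N) * L i j = l i j) (hL : ∀ i, L i ≠ 0) (hC : ∀ i, ∑ j, |l i j| ≤ C)
    {P Q : Finset ℕ} (hP : ∀ p ∈ P, p.Prime) (hQ : ∀ p ∈ Q, p.Prime) (hPQ : Disjoint P Q) (r R : ℕ) :
    |avg (fun x : Fin t → ZMod N => ∏ i, majorant P Q r R (W * (∑ j, L i j * x j + b i).val + 1)) -
      avg (fun x : Fin t → ZMod N => localMean P Q r R (localDensity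
        (fun i => (W * (∑ j, L i j * x j + b i).val + 1 : ℤ)) (fun i j => W * l i j)))| ≤
      (selbergSum Q R * ∏ p ∈ P, (1 - 1 / p : ℝ)⁻¹) ^ Fintype.card ι *
        (Fintype.card ι * (2 * C / N)) *
        ((∑ s ∈ P.powerset, |brunWeight r s| * ∏ p ∈ s, (p : ℝ)) *
          ∑ s ∈ Q.powerset, |selbergCoeff Q R s| * ∏ p ∈ s, (p : ℝ)) ^ Fintype.card ι := by
  set K := (selbergSum Q R * ∏ p ∈ P, (1 - 1 / p : ℝ)⁻¹) with hK
  have hK0 : 0 ≤ K := mul_nonneg (selbergSum_nonneg hQ R) (prod_inv_one_sub_nonneg hP)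
  set ψ : ι → (Fin t → ZMod N) → ℤ := fun i x => W * (∑ j, L i j * x j + b i).val + 1 with hψ
  set α : (Fin t → ZMod N) → ℕ → Finset ι → ℝ :=
    fun x => localDensity (fun i => ψ i x) (fun i j => W * l i j) with hα
  have hPQp : ∀ p ∈ P ∪ Q, p.Prime := fun p hp => (mem_union.1 hp).elim (hP p) (hQ p)
  set TP := Fintype.piFinset (fun _ : ι => P.powerset) with hTP
  set TQ := Fintype.piFinset (fun _ : ι => Q.powerset) with hTQ
  set c : (ι → Finset ℕ) → (ι → Finset ℕ) → ℝ :=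
    fun a d => K ^ Fintype.card ι * ((∏ i, brunWeight r (a i)) * ∏ i, selbergCoeff Q R (d i)) with hc
  have h1 : ∀ x, ∏ i, majorant P Q r R (ψ i x) =
      ∑ a ∈ TP, ∑ d ∈ TQ, c a d * ∏ i, divInd (a i ∪ d i) (ψ i x) := by
    intro x
    simp only [majorant, ← hK, ← sum_selbergCoeff_divInd, prod_mul_distrib, prod_const, card_univ,
      brunSum]
    rw [Finset.prod_univ_sum, Finset.prod_univ_sum, mul_assoc, sum_mul_sum, mul_sum]
    refine sum_congr rfl fun a _ => ?_
    rw [mul_sum]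
    refine sum_congr rfl fun d _ => ?_
    simp only [divInd_union, prod_mul_distrib, hc]
    ring
  have h2 : ∀ x, localMean P Q r R (α x) = ∑ a ∈ TP, ∑ d ∈ TQ, c a d *
      ∏ p ∈ univ.biUnion (fun i => a i ∪ d i), α x p {i | p ∈ a i ∪ d i} := by
    intro x
    rw [localMean, tupleSum, tupleSum, sum_mul_sum, mul_sum]
    refine sum_congr rfl fun a ha => ?_
    rw [mul_sum]
    refine sum_congr rfl fun d hd => ?_
    rw [← prod_local_mul hPQ (fun p hp => ?_) (by simpa [hTP] using ha) (by simpa [hTQ] using hd)]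
    · simp only [hc, hK]; ring
    · have := Fact.mk (hPQp p hp)
      exact localDensity_empty _ _ p
  change |avg (fun x => ∏ i, majorant P Q r R (ψ i x)) -
    avg (fun x => localMean P Q r R (α x))| ≤ _
  simp_rw [h1, h2]
  rw [← avg_sub]
  simp_rw [← sum_sub_distrib]
  rw [avg_sum]
  have h3 : ∀ a ∈ TP, ∀ d ∈ TQ, |avg (fun x => c a d * ∏ i, divInd (a i ∪ d i) (ψ i x) - c a d *
      ∏ p ∈ univ.biUnion (fun i => a i ∪ d i), α x p {i | p ∈ a i ∪ d i})| ≤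
      K ^ Fintype.card ι * (Fintype.card ι * (2 * C / N)) *
        ((∏ i, |brunWeight r (a i)| * ∏ p ∈ a i, (p : ℝ)) *
          ∏ i, |selbergCoeff Q R (d i)| * ∏ p ∈ d i, (p : ℝ)) := by
    intro a ha d hd
    have ha' : ∀ i, a i ⊆ P := by simpa [hTP] using ha
    have hd' : ∀ i, d i ⊆ Q := by simpa [hTQ] using hd
    have hu : ∀ i, a i ∪ d i ⊆ P ∪ Q := fun i => union_subset_union (ha' i) (hd' i)
    rw [avg_sub, avg_mul_left, avg_mul_left, ← mul_sub, abs_mul]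
    have h4 := abs_avg_prod_divInd_sub_le M W C L b l hl hL hC (fun i => a i ∪ d i)
      (P := univ.biUnion fun i => a i ∪ d i)
      (fun p hp => by
        obtain ⟨i, -, hi⟩ := mem_biUnion.1 hp
        exact hPQp p (hu i hi))
      (fun i => subset_biUnion_of_mem (fun i => a i ∪ d i) (mem_univ i))
    have h5 : ∏ p ∈ univ.biUnion (fun i => a i ∪ d i), (p : ℝ) ≤
        (∏ i, ∏ p ∈ a i, (p : ℝ)) * ∏ i, ∏ p ∈ d i, (p : ℝ) := by
      refine (prod_biUnion_le hPQp _ hu).trans (le_of_eq ?_)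
      rw [← prod_mul_distrib]
      refine prod_congr rfl fun i _ => prod_union ?_
      exact (hPQ.mono_left (ha' i)).mono_right (hd' i)
    have h6 : |c a d| = K ^ Fintype.card ι *
        ((∏ i, |brunWeight r (a i)|) * ∏ i, |selbergCoeff Q R (d i)|) := by
      simp only [hc]
      rw [abs_mul, abs_mul, abs_prod, abs_prod, abs_of_nonneg (pow_nonneg hK0 _)]
    have h7 : (Fintype.card ι : ℝ) * (2 * (C * ∏ p ∈ univ.biUnion (fun i => a i ∪ d i), (p : ℝ)) / N) ≤
        Fintype.card ι * (2 * C / N) * ((∏ i, ∏ p ∈ a i, (p : ℝ)) * ∏ i, ∏ p ∈ d i, (p : ℝ)) := by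
      calc _ = Fintype.card ι * (2 * C / N) * ∏ p ∈ univ.biUnion (fun i => a i ∪ d i), (p : ℝ) := by
            ring
        _ ≤ _ := by gcongr
    calc _ ≤ |c a d| * (Fintype.card ι * (2 * C / N) *
          ((∏ i, ∏ p ∈ a i, (p : ℝ)) * ∏ i, ∏ p ∈ d i, (p : ℝ))) :=
          mul_le_mul_of_nonneg_left (h4.trans h7) (abs_nonneg _)
      _ = _ := by rw [h6, prod_mul_distrib, prod_mul_distrib]; ring
  calc _ ≤ ∑ a ∈ TP, ∑ d ∈ TQ, K ^ Fintype.card ι * (Fintype.card ι * (2 * C / N)) *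
        ((∏ i, |brunWeight r (a i)| * ∏ p ∈ a i, (p : ℝ)) *
          ∏ i, |selbergCoeff Q R (d i)| * ∏ p ∈ d i, (p : ℝ)) := by
        refine (abs_sum_le_sum_abs _ _).trans (sum_le_sum fun a ha => ?_)
        rw [avg_sum]
        exact (abs_sum_le_sum_abs _ _).trans (sum_le_sum fun d hd => h3 a ha d hd)
    _ = _ := by
        have hA := Finset.prod_univ_sum (fun _ : ι => P.powerset)
          (fun _ s => |brunWeight r s| * ∏ p ∈ s, (p : ℝ))
        have hB := Finset.prod_univ_sum (fun _ : ι => Q.powerset)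
          (fun _ s => |selbergCoeff Q R s| * ∏ p ∈ s, (p : ℝ))
        rw [prod_const, card_univ] at hA hB
        rw [mul_pow (∑ s ∈ P.powerset, |brunWeight r s| * ∏ p ∈ s, (p : ℝ)), hA, hB, sum_mul_sum,
          mul_sum]
        refine sum_congr rfl fun a _ => ?_
        rw [mul_sum]

/-- The moduli of Brun's sieve are at most `z^{2r}`, so `d ≤ z^{4r}/d` for each of them. -/
theorem sum_abs_brunWeight_le {P : Finset ℕ} (hP : ∀ p ∈ P, p.Prime) {z : ℕ} (hz : ∀ p ∈ P, p ≤ z)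
    (hz1 : 1 ≤ z) (r : ℕ) :
    ∑ s ∈ P.powerset, |brunWeight r s| * ∏ p ∈ s, (p : ℝ) ≤
      (z : ℝ) ^ (4 * r) * ∏ p ∈ P, (1 + (1 : ℕ) / p : ℝ) := by
  rw [prod_one_add, mul_sum]
  refine sum_le_sum fun s hs => ?_
  have hs' := mem_powerset.1 hs
  have hpos : 0 < ∏ p ∈ s, (p : ℝ) := prod_pos fun p hp => by exact_mod_cast (hP p (hs' hp)).pos
  have hz1' : (1 : ℝ) ≤ z := by exact_mod_cast hz1
  unfold brunWeight
  split_ifs with h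
  · rw [abs_pow, abs_neg, abs_one, one_pow, one_mul, prod_div_distrib, prod_congr rfl (fun _ _ => Nat.cast_one),
      prod_const_one, mul_one_div, le_div_iff₀ hpos]
    have : ∏ p ∈ s, (p : ℝ) ≤ z ^ (2 * r) := by
      calc ∏ p ∈ s, (p : ℝ) ≤ ∏ p ∈ s, (z : ℝ) := by
            refine prod_le_prod (fun _ _ => Nat.cast_nonneg _) fun p hp => ?_
            exact_mod_cast hz p (hs' hp)
        _ = z ^ #s := by rw [prod_const]
        _ ≤ _ := pow_le_pow_right₀ hz1' h
    calc _ ≤ (z : ℝ) ^ (2 * r) * z ^ (2 * r) := by gcongr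
      _ = _ := by rw [← pow_add]; congr 1; ring
  · rw [abs_zero, zero_mul]
    exact mul_nonneg (by positivity) (prod_nonneg fun _ _ => by positivity)

/-- The moduli of Selberg's sieve are at most `R²`, so `d ≤ R⁴/d` for each of them. -/
theorem sum_abs_selbergCoeff_le {Q : Finset ℕ} (hQ : ∀ p ∈ Q, p.Prime) {R : ℕ} (hR : 1 ≤ R) :
    ∑ s ∈ Q.powerset, |selbergCoeff Q R s| * ∏ p ∈ s, (p : ℝ) ≤
      (R : ℝ) ^ 4 * ∏ p ∈ Q, (1 + (16 : ℕ) / p : ℝ) := by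
  rw [prod_one_add, mul_sum]
  refine sum_le_sum fun s hs => ?_
  have hs' := mem_powerset.1 hs
  have hpos : 0 < ∏ p ∈ s, (p : ℝ) := prod_pos fun p hp => by exact_mod_cast (hQ p (hs' hp)).pos
  rcases lt_or_ge (R ^ 2) (∏ p ∈ s, p) with h | h
  · rw [selbergCoeff_eq_zero hQ h, abs_zero, zero_mul]
    exact mul_nonneg (by positivity) (prod_nonneg fun _ _ => by positivity)
  · have h' : ∏ p ∈ s, (p : ℝ) ≤ (R : ℝ) ^ 2 := by
      have := (Nat.cast_le (α := ℝ)).2 h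
      push_cast at this
      exact this
    rw [prod_div_distrib, prod_const, mul_div_assoc', le_div_iff₀ hpos]
    calc _ ≤ (16 : ℝ) ^ #s * R ^ 2 * R ^ 2 := by
          gcongr
          exact abs_selbergCoeff_le hQ hR s
      _ = _ := by push_cast; ring

end PrimeMajorant

/-! ### Local means of products of majorants -/

namespace PrimeMajorant

/-- The bound `e^{5M} (r+1)^{16M}` for the products `∏ (1 + M/p)` over primes `p ≤ 2^{(r+1)^4}`.
These bounds are polynomial in `r`, hence negligible against `2^r`, and they multiply by adding the
exponents `M`. -/
noncomputable def polyBound (M r : ℕ) : ℝ := Real.exp (5 * M) * ((r : ℝ) + 1) ^ (16 * M)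

theorem polyBound_pos (M r : ℕ) : 0 < polyBound M r := by unfold polyBound; positivity

theorem polyBound_add (M M' r : ℕ) : polyBound (M + M') r = polyBound M r * polyBound M' r := by
  unfold polyBound
  push_cast
  rw [mul_add, mul_add, Real.exp_add, pow_add]
  ring

theorem polyBound_mul (M n r : ℕ) : polyBound (n * M) r = polyBound M r ^ n := by
  unfold polyBound
  push_cast
  rw [mul_pow, ← Real.exp_nat_mul, ← pow_mul]
  congr 2 <;> ring

theorem one_le_polyBound (M r : ℕ) : 1 ≤ polyBound M r := by
  unfold polyBound
  refine one_le_mul_of_one_le_of_one_le (Real.one_le_exp (by positivity)) (one_le_pow₀ ?_)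
  have : (0 : ℝ) ≤ r := Nat.cast_nonneg r
  linarith

theorem natCast_le_polyBound (M r : ℕ) : (M : ℝ) ≤ polyBound M r := by
  unfold polyBound
  have h1 : (M : ℝ) ≤ Real.exp (5 * M) := by
    have := Real.add_one_le_exp (5 * M : ℝ)
    have : (0 : ℝ) ≤ M := Nat.cast_nonneg M
    linarith
  have h2 : (1 : ℝ) ≤ ((r : ℝ) + 1) ^ (16 * M) := one_le_pow₀ (by linarith [Nat.cast_nonneg (α := ℝ) r])
  calc (M : ℝ) = M * 1 := (mul_one _).symm
    _ ≤ _ := by gcongr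

theorem prod_one_add_div_le_polyBound (M r : ℕ) {P : Finset ℕ}
    (hP : P ⊆ Nat.primesLE (2 ^ (r + 1) ^ 4)) : ∏ p ∈ P, (1 + M / p : ℝ) ≤ polyBound M r := by
  have h4 : (r + 1) ^ 4 = ((r + 1) ^ 4 - 1) + 1 := by
    have : 0 < (r + 1) ^ 4 := by positivity
    omega
  rw [h4] at hP
  refine (prod_one_add_div_le M hP).trans (le_of_eq ?_)
  have h5 : (((r + 1) ^ 4 - 1 : ℕ) : ℝ) + 1 = ((r : ℝ) + 1) ^ 4 := by
    have := congrArg (Nat.cast : ℕ → ℝ) h4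
    push_cast at this
    exact this.symm
  rw [h5, polyBound, ← pow_mul]
  congr 2
  ring

theorem tendsto_polyBound_div (M : ℕ) :
    Tendsto (fun r : ℕ => polyBound M r / 2 ^ r) atTop (nhds 0) := by
  have h := (tendsto_pow_const_div_const_pow_of_one_lt (16 * M) (r := (2 : ℝ)) (by norm_num)).comp
    (tendsto_add_atTop_nat 1)
  have h2 := h.const_mul (Real.exp (5 * M) * 2)
  rw [mul_zero] at h2
  refine h2.congr fun r => ?_
  simp only [Function.comp_apply, polyBound]
  push_cast
  rw [pow_succ]
  field_simp

theorem polyBound_le_exp (M : ℕ) {r : ℕ} (hr : 1 ≤ r) : polyBound M r ≤ Real.exp (21 * M * r) := by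
  have hr' : (1 : ℝ) ≤ r := by exact_mod_cast hr
  unfold polyBound
  calc _ ≤ Real.exp (5 * M * r) * Real.exp r ^ (16 * M) := by
        refine mul_le_mul ?_ ?_ (by positivity) (Real.exp_pos _).le
        · exact Real.exp_le_exp.2 (le_mul_of_one_le_right (by positivity) hr')
        · exact pow_le_pow_left₀ (by positivity) (Real.add_one_le_exp _) _
    _ = _ := by
        rw [← Real.exp_nat_mul, ← Real.exp_add]
        push_cast
        ring_nf

theorem exp_sub_one_le {x : ℝ} (h0 : 0 ≤ x) (h1 : x ≤ 1) : Real.exp x - 1 ≤ 2 * x := by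
  have h := Real.abs_exp_sub_one_le (x := x) (by rwa [abs_of_nonneg h0])
  rw [abs_of_nonneg h0] at h
  exact (le_abs_self _).trans h

variable {ι : Type*} [Fintype ι] [DecidableEq ι]

/-- The Selberg part of a local mean is close to `1`: all primes of `Q` are so large that the error
terms `δ p` outweigh the polynomial losses from taking absolute values. -/
theorem abs_selberg_mean_sub_one_le {Q : Finset ℕ} {α : ℕ → Finset ι → ℝ} {δ : ℕ → ℝ}
    (hα : LocalDensities Q α δ) {r R : ℕ} (hR : 1 ≤ R) (hQ : Q ⊆ Nat.primesLE (2 ^ (r + 1) ^ 4))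
    {K : ℕ} (hδ : ∑ p ∈ Q, δ p ≤ polyBound K r / 2 ^ r)
    (hsmall : polyBound (17 ^ Fintype.card ι + K) r / 2 ^ r ≤ 1) :
    |selbergSum Q R ^ Fintype.card ι * tupleSum Q α (selbergCoeff Q R) - 1| ≤
      2 * (polyBound (Fintype.card ι * 2 + 17 ^ Fintype.card ι + (17 ^ Fintype.card ι + K)) r / 2 ^ r) := by
  have hH := one_le_selbergSum hα.prime hR
  have hH2 : selbergSum Q R ≤ polyBound 2 r :=
    (selbergSum_le hα.prime R).trans ((prod_inv_one_sub_le hα.prime).trans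
      (prod_one_add_div_le_polyBound 2 r hQ))
  have h1 := abs_tupleSum_sub_le hα (c := selbergCoeff Q R) (C := 16) (by norm_num)
    fun s _ => abs_selbergCoeff_le hα.prime hR s
  rw [tupleSum_indep, sum_selbergCoeff_div hα.prime hR] at h1
  have h17 : (1 + 16 : ℝ) ^ Fintype.card ι = ((17 ^ Fintype.card ι : ℕ) : ℝ) := by push_cast; norm_num
  rw [h17] at h1
  set M := 17 ^ Fintype.card ι with hM
  have hx0 : 0 ≤ (M : ℝ) * ∑ p ∈ Q, δ p := mul_nonneg (Nat.cast_nonneg _) (sum_nonneg hα.delta_nonneg)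
  have hx1 : (M : ℝ) * ∑ p ∈ Q, δ p ≤ polyBound (M + K) r / 2 ^ r := by
    rw [polyBound_add, mul_div_assoc]
    exact mul_le_mul (natCast_le_polyBound M r) hδ (sum_nonneg hα.delta_nonneg) (polyBound_pos _ _).le
  have h2 := exp_sub_one_le hx0 (hx1.trans hsmall)
  have h3 : selbergSum Q R ^ Fintype.card ι * (1 / selbergSum Q R) ^ Fintype.card ι = 1 := by
    rw [← mul_pow, mul_one_div_cancel (by linarith), one_pow]
  have h4 : |selbergSum Q R ^ Fintype.card ι * tupleSum Q α (selbergCoeff Q R) - 1| =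
      selbergSum Q R ^ Fintype.card ι *
        |tupleSum Q α (selbergCoeff Q R) - (1 / selbergSum Q R) ^ Fintype.card ι| := by
    rw [← abs_of_nonneg (pow_nonneg (zero_le_one.trans hH) (Fintype.card ι)), ← abs_mul, mul_sub,
      abs_of_nonneg (pow_nonneg (zero_le_one.trans hH) (Fintype.card ι)), h3]
  rw [h4]
  calc _ ≤ polyBound 2 r ^ Fintype.card ι * (polyBound M r * (2 * (polyBound (M + K) r / 2 ^ r))) := by
        refine mul_le_mul (pow_le_pow_left₀ (by linarith) hH2 _) ?_ (abs_nonneg _)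
          (pow_nonneg (polyBound_pos _ _).le _)
        refine h1.trans (mul_le_mul (prod_one_add_div_le_polyBound M r hQ)
          (h2.trans (mul_le_mul_of_nonneg_left hx1 (by norm_num))) ?_ (polyBound_pos _ _).le)
        linarith [Real.one_le_exp hx0]
    _ = _ := by
        rw [← polyBound_mul, polyBound_add (Fintype.card ι * 2 + M), polyBound_add (Fintype.card ι * 2)]
        ring

/-- The Brun part of a local mean is close to the product of its normalised Euler factors, as the
truncation error `4^{-r}` outweighs the polynomial losses. -/
theorem abs_brun_mean_sub_le {P : Finset ℕ} {α : ℕ → Finset ι → ℝ} {δ : ℕ → ℝ}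
    (hα : LocalDensities P α δ) {r : ℕ} (hP : P ⊆ Nat.primesLE (2 ^ (r + 1) ^ 4)) :
    |(∏ p ∈ P, (1 - 1 / p : ℝ)⁻¹) ^ Fintype.card ι * tupleSum P α (brunWeight r) -
      ∏ p ∈ P, (∑ I : Finset ι, (-1) ^ #I * α p I) / (1 - 1 / p : ℝ) ^ Fintype.card ι| ≤
      polyBound (Fintype.card ι * 2 + 3 ^ Fintype.card ι) r / 2 ^ r := by
  have h0 := prod_inv_one_sub_nonneg hα.prime
  have h2 : ∏ p ∈ P, (1 - 1 / p : ℝ)⁻¹ ≤ polyBound 2 r := (prod_inv_one_sub_le hα.prime).trans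
      (prod_one_add_div_le_polyBound 2 r hP)
  have h1 := abs_tupleSum_brun_sub_le hα r
  have h3 : ∏ p ∈ P, (∑ I : Finset ι, (-1) ^ #I * α p I) / (1 - 1 / p : ℝ) ^ Fintype.card ι =
      (∏ p ∈ P, (1 - 1 / p : ℝ)⁻¹) ^ Fintype.card ι * ∏ p ∈ P, ∑ I : Finset ι, (-1) ^ #I * α p I := by
    rw [← prod_pow, ← prod_mul_distrib]
    exact prod_congr rfl fun p _ => by rw [inv_pow, div_eq_inv_mul]
  rw [h3, ← mul_sub, abs_mul, abs_of_nonneg (pow_nonneg h0 _)]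
  have h4 : ∏ p ∈ P, (1 + 3 ^ Fintype.card ι / p : ℝ) ≤ polyBound (3 ^ Fintype.card ι) r := by
    have := prod_one_add_div_le_polyBound (3 ^ Fintype.card ι) r hP
    push_cast at this
    exact this
  calc _ ≤ polyBound 2 r ^ Fintype.card ι * ((1 / 2) ^ r * polyBound (3 ^ Fintype.card ι) r) := by
        refine mul_le_mul (pow_le_pow_left₀ h0 h2 _) (h1.trans ?_) (abs_nonneg _)
          (pow_nonneg (polyBound_pos _ _).le _)
        gcongr
        norm_num
    _ = _ := by rw [← polyBound_mul, polyBound_add, one_div, inv_pow]; ring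

theorem localMean_eq (P Q : Finset ℕ) (r R : ℕ) (α : ℕ → Finset ι → ℝ) :
    localMean P Q r R α =
      ((∏ p ∈ P, (1 - 1 / p : ℝ)⁻¹) ^ Fintype.card ι * tupleSum P α (brunWeight r)) *
      (selbergSum Q R ^ Fintype.card ι * tupleSum Q α (selbergCoeff Q R)) := by
  rw [localMean, mul_pow]; ring

/-- The primes in `(w, 2^{r²}]`, over which Brun's sieve runs. -/
def smallPrimes (w r : ℕ) : Finset ℕ := (Nat.primesLE (2 ^ r ^ 2)).filter fun p => w < p

/-- The primes in `(2^{r²}, R]`, over which Selberg's sieve runs. -/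
def largePrimes (r R : ℕ) : Finset ℕ := (Nat.primesLE R).filter fun p => 2 ^ r ^ 2 < p

theorem mem_smallPrimes {w r p : ℕ} : p ∈ smallPrimes w r ↔ p.Prime ∧ w < p ∧ p ≤ 2 ^ r ^ 2 := by
  simp only [smallPrimes, mem_filter, Nat.mem_primesLE]; tauto

theorem mem_largePrimes {r R p : ℕ} : p ∈ largePrimes r R ↔ p.Prime ∧ 2 ^ r ^ 2 < p ∧ p ≤ R := by
  simp only [largePrimes, mem_filter, Nat.mem_primesLE]; tauto

theorem disjoint_smallPrimes_largePrimes (w r R : ℕ) :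
    Disjoint (smallPrimes w r) (largePrimes r R) := by
  refine disjoint_left.2 fun p hp hp' => ?_
  rw [mem_smallPrimes] at hp
  rw [mem_largePrimes] at hp'
  omega

theorem smallPrimes_subset (w r : ℕ) : smallPrimes w r ⊆ Nat.primesLE (2 ^ (r + 1) ^ 4) := by
  intro p hp
  rw [mem_smallPrimes] at hp
  refine Nat.mem_primesLE.2 ⟨hp.2.2.trans (Nat.pow_le_pow_right (by norm_num) ?_), hp.1⟩
  calc r ^ 2 ≤ (r + 1) ^ 2 := Nat.pow_le_pow_left (by omega) 2
    _ ≤ (r + 1) ^ 4 := Nat.pow_le_pow_right (by omega) (by norm_num)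

theorem largePrimes_subset {r R : ℕ} (hR : R ≤ 2 ^ (r + 1) ^ 4) :
    largePrimes r R ⊆ Nat.primesLE (2 ^ (r + 1) ^ 4) := by
  intro p hp
  rw [mem_largePrimes] at hp
  exact Nat.mem_primesLE.2 ⟨hp.2.2.trans hR, hp.1⟩

theorem le_sq_nat (r : ℕ) : r ≤ r ^ 2 := Nat.le_self_pow two_ne_zero r

/-- Few large exceptional primes contribute little to the sum of the error terms `δ p`. -/
theorem sum_delta_largePrimes_le (r R : ℕ) (E : Finset ℕ) {K : ℕ}
    (hE : #((largePrimes r R).filter (· ∈ E)) ≤ polyBound K r) :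
    ∑ p ∈ largePrimes r R, errorTerm E p ≤
      polyBound (1 + K) r / 2 ^ r := by
  have hz : ∀ p ∈ largePrimes r R, (2 : ℝ) ^ r ≤ p := by
    intro p hp
    have h1 : 2 ^ r ≤ p := (Nat.pow_le_pow_right (by norm_num) (le_sq_nat r)).trans
      (mem_largePrimes.1 hp).2.1.le
    exact_mod_cast h1
  have h2r : (0 : ℝ) < 2 ^ r := by positivity
  simp only [errorTerm]
  rw [sum_ite]
  have h1 : ∑ p ∈ largePrimes r R with p ∈ E, 1 / (p : ℝ) ≤ polyBound K r / 2 ^ r := by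
    calc _ ≤ ∑ p ∈ largePrimes r R with p ∈ E, (1 / 2 ^ r : ℝ) := by
          refine sum_le_sum fun p hp => ?_
          have := hz p (mem_filter.1 hp).1
          gcongr
      _ = #((largePrimes r R).filter (· ∈ E)) / 2 ^ r := by
          rw [sum_const, nsmul_eq_mul, mul_one_div]
      _ ≤ _ := by gcongr
  have h2 : ∑ p ∈ largePrimes r R with p ∉ E, 1 / (p : ℝ) ^ 2 ≤ 1 / 2 ^ r := by
    have h3 := sum_inv_sq_le (P := (largePrimes r R).filter (· ∉ E)) (z := 2 ^ r) (by positivity)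
      fun p hp => lt_of_le_of_lt (Nat.pow_le_pow_right (by norm_num) (le_sq_nat r))
        (mem_largePrimes.1 (mem_filter.1 hp).1).2.1
    push_cast at h3
    exact h3
  calc _ ≤ polyBound K r / 2 ^ r + 1 / 2 ^ r := add_le_add h1 h2
    _ = (polyBound K r + 1) / 2 ^ r := by rw [add_div]
    _ ≤ _ := by
        gcongr
        rw [polyBound_add]
        have h4 := one_le_polyBound K r
        have h5 : 2 ≤ polyBound 1 r := by
          have := Real.add_one_le_exp (5 : ℝ)
          have h6 : (1 : ℝ) ≤ ((r : ℝ) + 1) ^ (16 * 1) :=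
            one_le_pow₀ (by linarith [Nat.cast_nonneg (α := ℝ) r])
          unfold polyBound
          rw [Nat.cast_one, mul_one]
          nlinarith
        nlinarith

end PrimeMajorant

/-! ### Local means with few exceptional primes -/

namespace PrimeMajorant

section LocalMean

variable {ι : Type*} [Fintype ι] [DecidableEq ι]

theorem exists_eventually_polyBound (M : ℕ) {ε : ℝ} (hε : 0 < ε) :
    ∃ r₀ : ℕ, ∀ r, r₀ ≤ r → polyBound M r / 2 ^ r ≤ ε :=
  eventually_atTop.1 ((tendsto_polyBound_div M).eventually_le_const hε)

/-- Without exceptional primes, the local mean of a product of majorants is close to `1`. -/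
theorem exists_abs_localMean_sub_one_le {ε : ℝ} (hε : 0 < ε) :
    ∃ w₀ r₀ : ℕ, ∀ w r R : ℕ, w₀ ≤ w → r₀ ≤ r → 1 ≤ R → R ≤ 2 ^ (r + 1) ^ 4 →
      ∀ α : ℕ → Finset ι → ℝ,
        LocalDensities (smallPrimes w r) α (errorTerm ∅) →
        LocalDensities (largePrimes r R) α (errorTerm ∅) →
        |localMean (smallPrimes w r) (largePrimes r R) r R α - 1| ≤ ε := by
  set η : ℝ := min (ε / 4) 1 with hη
  have hη0 : 0 < η := by positivity
  set n := Fintype.card ι with hn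
  obtain ⟨r₁, hr₁⟩ := exists_eventually_polyBound (17 ^ n + (1 + 0)) (ε := 1) one_pos
  obtain ⟨r₂, hr₂⟩ := exists_eventually_polyBound (n * 2 + 17 ^ n + (17 ^ n + (1 + 0)))
    (ε := η / 2) (by positivity)
  obtain ⟨r₃, hr₃⟩ := exists_eventually_polyBound (n * 2 + 3 ^ n) (ε := η / 2) (by positivity)
  obtain ⟨w₀, hw₀⟩ := exists_nat_ge (4 ^ n * 4 / η)
  refine ⟨max 1 w₀, max r₁ (max r₂ r₃), fun w r R hw hr hR hR' α hα hβ => ?_⟩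
  simp only [max_le_iff] at hw hr
  have hw1 : (0 : ℝ) < w := by exact_mod_cast hw.1
  have h4w : (4 : ℝ) ^ n / w ≤ η / 4 := by
    have h1 : (4 : ℝ) ^ n * 4 / η ≤ w := hw₀.trans (by exact_mod_cast hw.2)
    rw [div_le_iff₀ hη0] at h1
    rw [div_le_iff₀ hw1]
    linarith
  have hB := abs_selberg_mean_sub_one_le hβ hR (largePrimes_subset hR') (K := 1 + 0)
    (sum_delta_largePrimes_le r R ∅ (by simpa using (polyBound_pos 0 r).le)) (hr₁ r hr.1)
  have hA := abs_brun_mean_sub_le hα (smallPrimes_subset w r)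
  -- The Euler factors are `1 + O(1/p²)` with `p > w`, so their product is `1 + O(1/w)`.
  have hE : |∏ p ∈ smallPrimes w r, (∑ I : Finset ι, (-1) ^ #I * α p I) / (1 - 1 / p : ℝ) ^ n - 1| ≤
      η / 2 := by
    have h1 := Finset.norm_prod_one_add_sub_one_le (smallPrimes w r)
      (fun p => (∑ I : Finset ι, (-1) ^ #I * α p I) / (1 - 1 / p : ℝ) ^ n - 1)
    simp only [add_sub_cancel, Real.norm_eq_abs] at h1
    have h2 : ∑ p ∈ smallPrimes w r,
        |(∑ I : Finset ι, (-1) ^ #I * α p I) / (1 - 1 / p : ℝ) ^ n - 1| ≤ 4 ^ n / w := by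
      calc _ ≤ ∑ p ∈ smallPrimes w r, (4 : ℝ) ^ n * (1 / (p : ℝ) ^ 2) := by
            refine sum_le_sum fun p hp => ?_
            have := abs_euler_factor_sub_le hα hp
            simpa [errorTerm] using this
        _ ≤ _ := by
            rw [← mul_sum, div_eq_mul_one_div]
            gcongr
            exact sum_inv_sq_le (by omega) fun p hp => (mem_smallPrimes.1 hp).2.1
    have h3 : (0 : ℝ) ≤ 4 ^ n / w := by positivity
    have h4 := exp_sub_one_le h3 (h4w.trans (by linarith [min_le_right (ε / 4) 1]))
    have h5 := Real.exp_le_exp.2 h2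
    linarith
  rw [localMean_eq]
  set A := (∏ p ∈ smallPrimes w r, (1 - 1 / p : ℝ)⁻¹) ^ n *
    tupleSum (smallPrimes w r) α (brunWeight r)
  set B := selbergSum (largePrimes r R) R ^ n *
    tupleSum (largePrimes r R) α (selbergCoeff (largePrimes r R) R)
  have hA1 : |A - 1| ≤ η := by
    have := (abs_sub_le A _ 1).trans (add_le_add (hA.trans (hr₃ r hr.2.2)) hE)
    linarith
  have hB1 : |B - 1| ≤ η := by
    have := hr₂ r hr.2.1
    linarith
  have h1 : η ≤ ε / 4 := min_le_left _ _
  have h2 : η ≤ 1 := min_le_right _ _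
  calc |A * B - 1| = |(A - 1) * (B - 1) + (A - 1) + (B - 1)| := by ring_nf
    _ ≤ |(A - 1) * (B - 1)| + |A - 1| + |B - 1| := abs_add_three _ _ _
    _ ≤ η * 1 + η + η := by
        rw [abs_mul]
        gcongr
        exact hB1.trans h2
    _ ≤ ε := by linarith

/-- In general, the local mean is bounded by a product over the small exceptional primes, as long as
there are not too many large ones. -/
theorem exists_abs_localMean_le (K : ℕ) :
    ∃ r₀ : ℕ, ∀ w r R : ℕ, r₀ ≤ r → 1 ≤ R → R ≤ 2 ^ (r + 1) ^ 4 →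
      ∀ (E : Finset ℕ) (α : ℕ → Finset ι → ℝ),
        LocalDensities (smallPrimes w r) α (errorTerm E) →
        LocalDensities (largePrimes r R) α (errorTerm E) →
        (#((largePrimes r R).filter (· ∈ E)) : ℝ) ≤ polyBound K r →
        |localMean (smallPrimes w r) (largePrimes r R) r R α| ≤
          2 * (1 + Real.exp (4 ^ Fintype.card ι)) *
            ∏ p ∈ (smallPrimes w r).filter (· ∈ E), (1 + 4 ^ Fintype.card ι / (p : ℝ)) := by
  set n := Fintype.card ι with hn
  obtain ⟨r₁, hr₁⟩ := exists_eventually_polyBound (17 ^ n + (1 + K)) (ε := 1) one_pos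
  obtain ⟨r₂, hr₂⟩ := exists_eventually_polyBound (n * 2 + 17 ^ n + (17 ^ n + (1 + K)))
    (ε := 1 / 2) (by positivity)
  obtain ⟨r₃, hr₃⟩ := exists_eventually_polyBound (n * 2 + 3 ^ n) (ε := 1) (by positivity)
  refine ⟨max r₁ (max r₂ r₃), fun w r R hr hR hR' E α hα hβ hE => ?_⟩
  simp only [max_le_iff] at hr
  have hB := abs_selberg_mean_sub_one_le hβ hR (largePrimes_subset hR') (K := 1 + K)
    (sum_delta_largePrimes_le r R E hE) (hr₁ r hr.1)
  have hA := abs_brun_mean_sub_le hα (smallPrimes_subset w r)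
  rw [localMean_eq]
  set A := (∏ p ∈ smallPrimes w r, (1 - 1 / p : ℝ)⁻¹) ^ n *
    tupleSum (smallPrimes w r) α (brunWeight r)
  set B := selbergSum (largePrimes r R) R ^ n *
    tupleSum (largePrimes r R) α (selbergCoeff (largePrimes r R) R)
  set G := ∏ p ∈ smallPrimes w r, (∑ I : Finset ι, (-1) ^ #I * α p I) / (1 - 1 / p : ℝ) ^ n
  set X := ∏ p ∈ (smallPrimes w r).filter (· ∈ E), (1 + 4 ^ n / (p : ℝ))
  have hX : 1 ≤ X := one_le_prod fun p _ => by
    have : (0 : ℝ) ≤ 4 ^ n / (p : ℝ) := by positivity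
    linarith
  have hG : |G| ≤ Real.exp (4 ^ n) * X := by
    calc |G| ≤ ∏ p ∈ smallPrimes w r, (1 + 4 ^ n * errorTerm E p) := by
          rw [abs_prod]
          refine prod_le_prod (fun _ _ => abs_nonneg _) fun p hp => ?_
          have h1 := abs_euler_factor_sub_le hα hp
          have h2 := abs_sub_abs_le_abs_sub
            ((∑ I : Finset ι, (-1) ^ #I * α p I) / (1 - 1 / p : ℝ) ^ n) 1
          rw [abs_one] at h2
          linarith
      _ = X * ∏ p ∈ (smallPrimes w r).filter (· ∉ E), (1 + 4 ^ n * (1 / (p : ℝ) ^ 2)) := by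
          rw [← prod_filter_mul_prod_filter_not _ (· ∈ E)]
          congr 1
          · refine prod_congr rfl fun p hp => ?_
            rw [errorTerm, if_pos (mem_filter.1 hp).2, mul_one_div]
          · refine prod_congr rfl fun p hp => ?_
            rw [errorTerm, if_neg (mem_filter.1 hp).2]
      _ ≤ X * Real.exp (4 ^ n) := by
          refine mul_le_mul_of_nonneg_left ?_ (by linarith)
          refine (Real.prod_one_add_le_exp_sum _ fun p => by positivity).trans (Real.exp_le_exp.2 ?_)
          rw [← mul_sum]
          have h1 := sum_inv_sq_le (P := (smallPrimes w r).filter (· ∉ E)) (z := 1) one_ne_zero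
            fun p hp => (mem_smallPrimes.1 (mem_filter.1 hp).1).1.one_lt
          have h2 : (0 : ℝ) ≤ 4 ^ n := by positivity
          rw [Nat.cast_one, div_one] at h1
          nlinarith
      _ = _ := mul_comm _ _
  have hA1 : |A| ≤ 1 + Real.exp (4 ^ n) * X := by
    have h1 := abs_sub_abs_le_abs_sub A G
    have h2 := hr₃ r hr.2.2
    linarith
  have hB1 : |B| ≤ 2 := by
    have h1 := abs_sub_abs_le_abs_sub B 1
    have h2 := hr₂ r hr.2.1
    rw [abs_one] at h1
    linarith
  rw [abs_mul]
  calc |A| * |B| ≤ (1 + Real.exp (4 ^ n) * X) * 2 := by gcongr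
    _ ≤ (X + Real.exp (4 ^ n) * X) * 2 := by gcongr
    _ = _ := by ring

end LocalMean

/-! ### The size of the majorant -/

theorem two_pow_sq_pow (r : ℕ) : ((2 : ℝ) ^ r ^ 2) ^ (4 * r) = 2 ^ (4 * r ^ 3) := by
  rw [← pow_mul]; congr 1; ring

theorem sieve_normalization_le {w r R : ℕ} (hR' : R ≤ 2 ^ (r + 1) ^ 4) :
    selbergSum (largePrimes r R) R * ∏ p ∈ smallPrimes w r, (1 - 1 / p : ℝ)⁻¹ ≤ polyBound 4 r := by
  have hP : ∀ p ∈ smallPrimes w r, p.Prime := fun p hp => (mem_smallPrimes.1 hp).1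
  have hQ : ∀ p ∈ largePrimes r R, p.Prime := fun p hp => (mem_largePrimes.1 hp).1
  rw [show 4 = 2 + 2 by norm_num, polyBound_add]
  refine mul_le_mul ?_ ?_ (prod_inv_one_sub_nonneg hP) (polyBound_pos _ _).le
  · exact (selbergSum_le hQ R).trans ((prod_inv_one_sub_le hQ).trans
      (prod_one_add_div_le_polyBound 2 r (largePrimes_subset hR')))
  · exact (prod_inv_one_sub_le hP).trans (prod_one_add_div_le_polyBound 2 r (smallPrimes_subset w r))

theorem sum_abs_brunWeight_smallPrimes_le (w r : ℕ) :
    ∑ s ∈ (smallPrimes w r).powerset, |brunWeight r s| * ∏ p ∈ s, (p : ℝ) ≤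
      2 ^ (4 * r ^ 3) * polyBound 1 r := by
  refine (sum_abs_brunWeight_le (fun p hp => (mem_smallPrimes.1 hp).1)
    (fun p hp => (mem_smallPrimes.1 hp).2.2) Nat.one_le_two_pow r).trans ?_
  push_cast
  rw [two_pow_sq_pow]
  have := prod_one_add_div_le_polyBound 1 r (smallPrimes_subset w r)
  push_cast at this
  gcongr

/-- The error made in passing from averages of products of majorants to local means: the moduli of
the two sieves are at most `2^{O(r³)}` and `R²` for each form, which is small against `N ≥ 2^{r⁴}`. -/
theorem counting_error_le {n C N w r R : ℕ} (hN : 2 ^ r ^ 4 ≤ N) (hR : 1 ≤ R)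
    (hR' : R ≤ 2 ^ (r + 1) ^ 4) (hRN : R ^ (8 * n) ≤ N) (hr : 2 * (4 * n * r ^ 3 + r) ≤ r ^ 4) :
    (selbergSum (largePrimes r R) R * ∏ p ∈ smallPrimes w r, (1 - 1 / p : ℝ)⁻¹) ^ n *
        (n * (2 * C / N)) *
        ((∑ s ∈ (smallPrimes w r).powerset, |brunWeight r s| * ∏ p ∈ s, (p : ℝ)) *
          ∑ s ∈ (largePrimes r R).powerset, |selbergCoeff (largePrimes r R) R s| *
            ∏ p ∈ s, (p : ℝ)) ^ n ≤
      2 * n * C * (polyBound (n * 21) r / 2 ^ r) := by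
  have hP : ∀ p ∈ smallPrimes w r, p.Prime := fun p hp => (mem_smallPrimes.1 hp).1
  have hQ : ∀ p ∈ largePrimes r R, p.Prime := fun p hp => (mem_largePrimes.1 hp).1
  have hN0 : (0 : ℝ) < N := by exact_mod_cast lt_of_lt_of_le (by positivity) hN
  have h2 := sum_abs_selbergCoeff_le hQ hR
  have h3 : ∏ p ∈ largePrimes r R, (1 + (16 : ℕ) / p : ℝ) ≤ polyBound 16 r :=
    prod_one_add_div_le_polyBound 16 r (largePrimes_subset hR')
  have hpow : (2 : ℝ) ^ (4 * n * r ^ 3) * R ^ (4 * n) * 2 ^ r ≤ N := by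
    have h4 : (2 ^ (4 * n * r ^ 3 + r) * R ^ (4 * n)) ^ 2 ≤ N ^ 2 := by
      calc (2 ^ (4 * n * r ^ 3 + r) * R ^ (4 * n)) ^ 2
          = 2 ^ (2 * (4 * n * r ^ 3 + r)) * R ^ (8 * n) := by
            rw [mul_pow, ← pow_mul, ← pow_mul]
            congr 2 <;> ring
        _ ≤ N * N := Nat.mul_le_mul ((Nat.pow_le_pow_right (by norm_num) hr).trans hN) hRN
        _ = _ := (sq N).symm
    have h5 := (Nat.pow_le_pow_iff_left two_ne_zero).1 h4
    calc _ = ((2 ^ (4 * n * r ^ 3 + r) * R ^ (4 * n) : ℕ) : ℝ) := by push_cast; ring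
      _ ≤ N := by exact_mod_cast h5
  have hS0 : 0 ≤ ∑ s ∈ (smallPrimes w r).powerset, |brunWeight r s| * ∏ p ∈ s, (p : ℝ) :=
    sum_nonneg fun s _ => mul_nonneg (abs_nonneg _) (prod_nonneg fun _ _ => Nat.cast_nonneg _)
  have hT0 : 0 ≤ ∑ s ∈ (largePrimes r R).powerset, |selbergCoeff (largePrimes r R) R s| *
      ∏ p ∈ s, (p : ℝ) :=
    sum_nonneg fun s _ => mul_nonneg (abs_nonneg _) (prod_nonneg fun _ _ => Nat.cast_nonneg _)
  have hK0 : 0 ≤ selbergSum (largePrimes r R) R * ∏ p ∈ smallPrimes w r, (1 - 1 / p : ℝ)⁻¹ :=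
    mul_nonneg (selbergSum_nonneg hQ R) (prod_inv_one_sub_nonneg hP)
  calc _ ≤ polyBound 4 r ^ n * (n * (2 * C / N)) *
        ((2 ^ (4 * r ^ 3) * polyBound 1 r) * (R ^ 4 * polyBound 16 r)) ^ n := by
        refine mul_le_mul ?_ ?_ (pow_nonneg (mul_nonneg hS0 hT0) _) ?_
        · refine mul_le_mul_of_nonneg_right (pow_le_pow_left₀ hK0 (sieve_normalization_le hR') _) ?_
          positivity
        · refine pow_le_pow_left₀ (mul_nonneg hS0 hT0) ?_ _
          refine mul_le_mul (sum_abs_brunWeight_smallPrimes_le w r) (h2.trans ?_) hT0 ?_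
          · gcongr
          · exact mul_nonneg (by positivity) (polyBound_pos _ _).le
        · exact mul_nonneg (pow_nonneg (polyBound_pos _ _).le _) (by positivity)
    _ = 2 * n * C * (polyBound (n * 21) r) * ((2 ^ (4 * n * r ^ 3) * R ^ (4 * n)) / N) := by
        rw [polyBound_mul, show 21 = 4 + 1 + 16 by norm_num, polyBound_add, polyBound_add, mul_pow,
          mul_pow, mul_pow, mul_pow, mul_pow, ← pow_mul, ← pow_mul,
          show 4 * r ^ 3 * n = 4 * n * r ^ 3 by ring]
        ring
    _ ≤ 2 * n * C * (polyBound (n * 21) r) * (1 / 2 ^ r) := by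
        have : 0 ≤ 2 * n * C * (polyBound (n * 21) r) :=
          mul_nonneg (by positivity) (polyBound_pos _ _).le
        refine mul_le_mul_of_nonneg_left ?_ this
        rw [div_le_div_iff₀ hN0 (by positivity), one_mul]
        exact hpow
    _ = _ := by ring

/-- A crude upper bound for the majorant. A number `n ≤ 2^{2(r+1)⁴}` has `O(r²)` prime factors larger
than `2^{r²}`, which bounds the number of terms in Selberg's sum; Brun's sum is bounded by the sum
of its moduli. -/
theorem majorant_le {w r R : ℕ} (hr : 1 ≤ r) (hR : 1 ≤ R) (hR' : R ≤ 2 ^ (r + 1) ^ 4) {n : ℕ}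
    (hn0 : n ≠ 0) (hn : n ≤ 2 ^ (2 * (r + 1) ^ 4)) :
    majorant (smallPrimes w r) (largePrimes r R) r R n ≤ Real.exp (237 * r ^ 3) := by
  have hP : ∀ p ∈ smallPrimes w r, p.Prime := fun p hp => (mem_smallPrimes.1 hp).1
  have hQ : ∀ p ∈ largePrimes r R, p.Prime := fun p hp => (mem_largePrimes.1 hp).1
  have hr1 : (1 : ℝ) ≤ r := by exact_mod_cast hr
  have hK0 : 0 ≤ selbergSum (largePrimes r R) R * ∏ p ∈ smallPrimes w r, (1 - 1 / p : ℝ)⁻¹ :=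
    mul_nonneg (selbergSum_nonneg hQ R) (prod_inv_one_sub_nonneg hP)
  have hbrun : brunSum (smallPrimes w r) r n ≤ 2 ^ (4 * r ^ 3) * polyBound 1 r := by
    refine le_trans (sum_le_sum fun s hs => ?_) (sum_abs_brunWeight_smallPrimes_le w r)
    have h1 : (1 : ℝ) ≤ ∏ p ∈ s, (p : ℝ) := one_le_prod fun p hp => by
      exact_mod_cast (hP p (mem_powerset.1 hs hp)).one_le
    calc brunWeight r s * divInd s n ≤ |brunWeight r s| * 1 :=
          mul_le_mul (le_abs_self _) (divInd_le_one _ _) (divInd_nonneg _ _) (abs_nonneg _)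
      _ ≤ _ := by gcongr
  set q := (largePrimes r R).filter fun p : ℕ => (p : ℤ) ∣ n with hq
  have hcard : #q ≤ 32 * r ^ 2 := by
    have h1 : (2 ^ r ^ 2) ^ #q ≤ n := by
      refine pow_card_le_of_dvd (fun p hp => hQ p (mem_filter.1 hp).1)
        (fun p hp => (mem_largePrimes.1 (mem_filter.1 hp).1).2.1) hn0 fun p hp => ?_
      exact_mod_cast (mem_filter.1 hp).2
    rw [← pow_mul] at h1
    have h2 : r ^ 2 * #q ≤ 2 * (r + 1) ^ 4 :=
      (Nat.pow_le_pow_iff_right (by norm_num)).1 (h1.trans hn)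
    have h3 : (r + 1) ^ 4 ≤ (2 * r) ^ 4 := Nat.pow_le_pow_left (by omega) 4
    have h4 : r ^ 2 * #q ≤ r ^ 2 * (32 * r ^ 2) := by
      calc _ ≤ 2 * (2 * r) ^ 4 := by omega
        _ = _ := by ring
    exact Nat.le_of_mul_le_mul_left h4 (by positivity)
  have hselberg : |∑ s ∈ (largePrimes r R).powerset, selbergWeight (largePrimes r R) R s * divInd s n| ≤
      3 ^ #q := by
    rw [sum_mul_divInd]
    calc _ ≤ ∑ s ∈ q.powerset, (2 : ℝ) ^ #s := by
          refine (abs_sum_le_sum_abs _ _).trans (sum_le_sum fun s hs => ?_)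
          exact abs_selbergWeight_le hQ hR ((mem_powerset.1 hs).trans (filter_subset _ _))
      _ = 3 ^ #q := by
          have := Finset.prod_one_add (f := fun _ : ℕ => (2 : ℝ)) q
          simp only [prod_const] at this
          rw [← this]; norm_num
  have h3e : (3 : ℝ) ≤ Real.exp 2 := by have := Real.add_one_le_exp (2 : ℝ); linarith
  have h2e : (2 : ℝ) ≤ Real.exp 1 := by have := Real.add_one_le_exp (1 : ℝ); linarith
  have hsq : (∑ s ∈ (largePrimes r R).powerset, selbergWeight (largePrimes r R) R s * divInd s n) ^ 2 ≤
      Real.exp (128 * r ^ 3) := by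
    rw [← sq_abs]
    calc _ ≤ ((3 : ℝ) ^ #q) ^ 2 := pow_le_pow_left₀ (abs_nonneg _) hselberg 2
      _ ≤ (3 ^ (32 * r ^ 2)) ^ 2 := by gcongr; norm_num
      _ ≤ (Real.exp 2 ^ (32 * r ^ 2)) ^ 2 := by gcongr
      _ = Real.exp (128 * r ^ 2) := by
          rw [← pow_mul, ← Real.exp_nat_mul]
          push_cast
          ring_nf
      _ ≤ _ := by
          refine Real.exp_le_exp.2 ?_
          have : (r : ℝ) ^ 2 ≤ r ^ 3 := pow_le_pow_right₀ hr1 (by norm_num)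
          linarith
  have hpoly : polyBound 5 r ≤ Real.exp (105 * r ^ 3) := by
    refine (polyBound_le_exp 5 hr).trans (Real.exp_le_exp.2 ?_)
    have : (r : ℝ) ≤ r ^ 3 := le_self_pow₀ hr1 (by norm_num)
    push_cast
    linarith
  -- The exponents add up to `105 + 4 + 128 = 237`.
  calc _ ≤ polyBound 4 r * (2 ^ (4 * r ^ 3) * polyBound 1 r) * Real.exp (128 * r ^ 3) := by
        refine mul_le_mul (mul_le_mul (sieve_normalization_le hR') hbrun (brunSum_nonneg _ _ _)
          (polyBound_pos _ _).le) hsq (sq_nonneg _) ?_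
        exact mul_nonneg (polyBound_pos _ _).le (mul_nonneg (by positivity) (polyBound_pos _ _).le)
    _ = polyBound 5 r * 2 ^ (4 * r ^ 3) * Real.exp (128 * r ^ 3) := by
        rw [show 5 = 4 + 1 by norm_num, polyBound_add]; ring
    _ ≤ Real.exp (105 * r ^ 3) * Real.exp 1 ^ (4 * r ^ 3) * Real.exp (128 * r ^ 3) := by gcongr
    _ = _ := by
        rw [← Real.exp_nat_mul, ← Real.exp_add, ← Real.exp_add]
        push_cast
        ring_nf

/-- At a prime that exceeds all sieving primes, both sieves take the value `1`. -/
theorem majorant_prime {w r R q : ℕ} (hR : 1 ≤ R) (hq : q.Prime) (hzq : 2 ^ r ^ 2 < q) (hRq : R < q) :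
    majorant (smallPrimes w r) (largePrimes r R) r R q =
      selbergSum (largePrimes r R) R * ∏ p ∈ smallPrimes w r, (1 - 1 / p : ℝ)⁻¹ := by
  have h1 : ∀ p : ℕ, p.Prime → p < q → ¬ (p : ℤ) ∣ (q : ℤ) := by
    intro p hp hpq h
    have := (Nat.prime_dvd_prime_iff_eq hp hq).1 (by exact_mod_cast h)
    omega
  have hQ : ∀ p ∈ largePrimes r R, p.Prime := fun p hp => (mem_largePrimes.1 hp).1
  rw [majorant, brunSum_eq_one, sum_mul_divInd, filter_false_of_mem, powerset_empty, sum_singleton,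
    selbergWeight_empty hQ hR, one_pow, mul_one, mul_one]
  · intro p hp
    rw [mem_largePrimes] at hp
    exact h1 p hp.1 (by omega)
  · intro p hp
    rw [mem_smallPrimes] at hp
    exact h1 p hp.1 (by omega)

/-- Lower bound for the normalising factor of the majorant: the primes `p ≤ w`, over which it does not
sieve, account for the factor `φ(W)/W`. -/
theorem totient_mul_log_le {w r R : ℕ} (hw : w ≤ 2 ^ r ^ 2) :
    (Nat.totient (primorial w) : ℝ) / primorial w * Real.log (R + 1) ≤
      selbergSum (largePrimes r R) R * ∏ p ∈ smallPrimes w r, (1 - 1 / p : ℝ)⁻¹ := by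
  have h := log_le_selbergSum_mul (2 ^ r ^ 2) R
  have hpos : ∀ p ∈ Nat.primesLE w, 0 < (1 - 1 / p : ℝ) := by
    intro p hp
    have : (1 : ℝ) < p := by exact_mod_cast (Nat.mem_primesLE.1 hp).2.one_lt
    rw [sub_pos, div_lt_one] <;> linarith
  have hsplit : ∏ p ∈ Nat.primesLE (2 ^ r ^ 2), (1 - 1 / p : ℝ)⁻¹ =
      (∏ p ∈ smallPrimes w r, (1 - 1 / p : ℝ)⁻¹) * (∏ p ∈ Nat.primesLE w, (1 - 1 / p : ℝ))⁻¹ := by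
    rw [← prod_inv_distrib, ← prod_filter_mul_prod_filter_not _ (fun p => w < p), smallPrimes]
    congr 1
    refine prod_congr ?_ fun _ _ => rfl
    ext p
    simp only [mem_filter, Nat.mem_primesLE, not_lt]
    constructor
    · rintro ⟨⟨_, h1⟩, h2⟩; exact ⟨h2, h1⟩
    · rintro ⟨h1, h2⟩; exact ⟨⟨h1.trans hw, h2⟩, h1⟩
  rw [hsplit, ← mul_assoc] at h
  rw [totient_primorial_div]
  have h0 := prod_pos hpos
  rw [← div_eq_mul_inv, le_div_iff₀ h0] at h
  rw [mul_comm]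
  exact h

end PrimeMajorant

/-! ### The family of majorants and the linear forms condition -/

namespace PrimeMajorant

/-- The parameter `r ≈ (log₂ N)^{1/4}` of the sieves, with `2^{r⁴} ≤ N < 2^{(r+1)⁴}`. The sieves
change over at `2^{r²} = exp(O((log N)^{1/2}))`, which exceeds all powers of `log N`, while the moduli
`2^{O(r³)}` of Brun's sieve are smaller than all powers of `N`. -/
def scale (N : ℕ) : ℕ := Nat.sqrt (Nat.sqrt (Nat.log 2 N))

/-- The level `R = ⌊N^{1/e}⌋` of Selberg's sieve. -/
noncomputable def level (e N : ℕ) : ℕ := ⌊(N : ℝ) ^ (1 / e : ℝ)⌋₊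

theorem two_pow_scale_le {N : ℕ} (hN : N ≠ 0) : 2 ^ scale N ^ 4 ≤ N := by
  refine le_trans (Nat.pow_le_pow_right (by norm_num) ?_) (Nat.pow_log_le_self 2 hN)
  calc scale N ^ 4 = (scale N ^ 2) ^ 2 := by ring
    _ ≤ (Nat.sqrt (Nat.log 2 N)) ^ 2 := Nat.pow_le_pow_left (Nat.sqrt_le' _) 2
    _ ≤ _ := Nat.sqrt_le' _

theorem lt_two_pow_scale (N : ℕ) : N < 2 ^ (scale N + 1) ^ 4 := by
  refine lt_of_lt_of_le (Nat.lt_pow_succ_log_self (by norm_num) N)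
    (Nat.pow_le_pow_right (by norm_num) ?_)
  have h1 : Nat.log 2 N < (Nat.sqrt (Nat.log 2 N) + 1) ^ 2 := Nat.lt_succ_sqrt' _
  have h2 : Nat.sqrt (Nat.log 2 N) < (scale N + 1) ^ 2 := Nat.lt_succ_sqrt' _
  calc Nat.log 2 N + 1 ≤ (Nat.sqrt (Nat.log 2 N) + 1) ^ 2 := h1
    _ ≤ ((scale N + 1) ^ 2) ^ 2 := Nat.pow_le_pow_left h2 2
    _ = _ := by ring

theorem tendsto_scale : Tendsto scale atTop atTop := by
  refine tendsto_atTop.2 fun b => ?_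
  filter_upwards [eventually_ge_atTop (2 ^ b ^ 4)] with N hN
  rw [scale, Nat.le_sqrt', Nat.le_sqrt', ← pow_mul]
  exact Nat.le_log_of_pow_le (by norm_num) hN

theorem level_pow_le {e : ℕ} (he : e ≠ 0) (N : ℕ) : level e N ^ e ≤ N := by
  have h0 : (0 : ℝ) ≤ (N : ℝ) ^ (1 / e : ℝ) := by positivity
  have h1 : (level e N : ℝ) ^ e ≤ N := by
    calc (level e N : ℝ) ^ e ≤ ((N : ℝ) ^ (1 / e : ℝ)) ^ e :=
          pow_le_pow_left₀ (Nat.cast_nonneg _) (Nat.floor_le h0) e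
      _ = N := by
          rw [one_div, Real.rpow_inv_natCast_pow (Nat.cast_nonneg _) he]
  exact_mod_cast h1

theorem one_le_level {e N : ℕ} (hN : 1 ≤ N) : 1 ≤ level e N := by
  refine Nat.le_floor ?_
  push_cast
  exact Real.one_le_rpow (by exact_mod_cast hN) (by positivity)

theorem level_pow_le_of_le {e a N : ℕ} (hN : 1 ≤ N) (ha : a ≤ e) (he : e ≠ 0) : level e N ^ a ≤ N :=
  (Nat.pow_le_pow_right (one_le_level hN) ha).trans (level_pow_le he N)

theorem level_le {e N : ℕ} (hN : 1 ≤ N) (he : e ≠ 0) : level e N ≤ N := by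
  have := level_pow_le_of_le (a := 1) hN (by omega) he
  rwa [pow_one] at this

theorem log_div_le_log_level (e : ℕ) {N : ℕ} (hN : 1 ≤ N) :
    Real.log N / e ≤ Real.log (level e N + 1) := by
  have hN0 : (0 : ℝ) < N := by exact_mod_cast hN
  have h1 : Real.log N / e = Real.log ((N : ℝ) ^ (1 / e : ℝ)) := by
    rw [Real.log_rpow hN0]; ring
  rw [h1]
  refine Real.log_le_log (by positivity) ?_
  exact (Nat.lt_floor_add_one _).le

/-- The family of majorants on `ℤ/N`: a residue `x` is represented by an integer in `[0, N)`, and the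
majorant is evaluated at `W x + 1`. -/
noncomputable def majorantFamily (e : ℕ) (w : ℕ → ℝ) (N : ℕ) (x : ZMod N) : ℝ :=
  majorant (smallPrimes ⌊w N⌋₊ (scale N)) (largePrimes (scale N) (level e N)) (scale N) (level e N)
    (primeProd (w N) * x.val + 1)

theorem majorantFamily_nonneg (e : ℕ) (w : ℕ → ℝ) (N : ℕ) (x : ZMod N) : 0 ≤ majorantFamily e w N x :=
  majorant_nonneg (fun _ hp => (mem_smallPrimes.1 hp).1) (fun _ hp => (mem_largePrimes.1 hp).1) _ _ _

theorem eventually_scale_large (n : ℕ) :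
    ∀ᶠ N in atTop, 2 * (4 * n * scale N ^ 3 + scale N) ≤ scale N ^ 4 := by
  filter_upwards [tendsto_scale.eventually_ge_atTop (8 * n + 2)] with N hN
  set r := scale N
  have h1 : r ≤ r ^ 3 := Nat.le_self_pow (by norm_num) r
  calc 2 * (4 * n * r ^ 3 + r) ≤ 2 * (4 * n * r ^ 3 + r ^ 3) := by omega
    _ = (8 * n + 2) * r ^ 3 := by ring
    _ ≤ r * r ^ 3 := Nat.mul_le_mul_right _ hN
    _ = r ^ 4 := by ring

section Forms

variable {ι : Type*} [Fintype ι] [DecidableEq ι] {t : ℕ}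

/-- The local mean of the family of majorants along the forms `∑ⱼ Lᵢⱼ xⱼ + bᵢ`, near the point `x`. -/
noncomputable def formMean (e : ℕ) (w : ℕ → ℝ) {N : ℕ} (L : ι → Fin t → ZMod N) (b : ι → ZMod N)
    (l : ι → Fin t → ℤ) (x : Fin t → ZMod N) : ℝ :=
  localMean (smallPrimes ⌊w N⌋₊ (scale N)) (largePrimes (scale N) (level e N)) (scale N) (level e N)
    (localDensity (fun i => (primeProd (w N) * (∑ j, L i j * x j + b i).val + 1 : ℤ))
      (fun i j => primeProd (w N) * l i j))

/-- Averages of products of members of the family are averages of local means, uniformly in the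
coefficients and the constants of the forms. -/
theorem eventually_abs_avg_sub_formMean_le {e : ℕ} (he : e ≠ 0) (hι : 8 * Fintype.card ι ≤ e)
    (w : ℕ → ℝ) (C : ℕ) {ε : ℝ} (hε : 0 < ε) :
    ∀ᶠ N in atTop, ∀ [Fact N.Prime] (M : ℕ) (L : ι → Fin t → ZMod N) (b : ι → ZMod N)
      (l : ι → Fin t → ℤ), (∀ i j, (M : ZMod N) * L i j = (l i j : ZMod N)) → (∀ i, L i ≠ 0) →
      (∀ i, ∑ j, |l i j| ≤ C) →
      |avg (fun x : Fin t → ZMod N => ∏ i, majorantFamily e w N (∑ j, L i j * x j + b i)) -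
        avg (formMean e w L b l)| ≤ ε := by
  set n := Fintype.card ι with hn
  obtain ⟨r₀, hr₀⟩ := exists_eventually_polyBound (n * 21) (ε := ε / (2 * n * C + 1)) (by positivity)
  filter_upwards [tendsto_scale.eventually_ge_atTop r₀, eventually_scale_large n,
    eventually_ge_atTop 1] with N hN1 hN2 hN3 _ M L b l hl hL hC
  have h1 := abs_avg_prod_majorant_sub_le M (primeProd (w N)) C L b l hl hL hC
    (P := smallPrimes ⌊w N⌋₊ (scale N)) (Q := largePrimes (scale N) (level e N))
    (fun _ hp => (mem_smallPrimes.1 hp).1) (fun _ hp => (mem_largePrimes.1 hp).1)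
    (disjoint_smallPrimes_largePrimes _ _ _) (scale N) (level e N)
  have h2 := counting_error_le (n := n) (C := C) (w := ⌊w N⌋₊) (two_pow_scale_le (by omega))
    (one_le_level (e := e) hN3)
    ((level_le hN3 he).trans (lt_two_pow_scale N).le) (level_pow_le_of_le hN3 hι he) hN2
  refine h1.trans (h2.trans ?_)
  have h3 := hr₀ _ hN1
  have h4 : (0 : ℝ) ≤ 2 * n * C := by positivity
  calc 2 * n * C * (polyBound (n * 21) (scale N) / 2 ^ scale N)
      ≤ 2 * n * C * (ε / (2 * n * C + 1)) := by gcongr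
    _ ≤ ε := by
        rw [mul_div_assoc', div_le_iff₀ (by positivity)]
        nlinarith

end Forms

theorem not_dvd_primeProd {w : ℝ} {p : ℕ} (hp : p.Prime) (h : ⌊w⌋₊ < p) : ¬ p ∣ primeProd w := by
  rw [primeProd, hp.dvd_primorial_iff]
  omega

/-- For `w ≤ r` all sieving primes are larger than `w`, so none of them divides `W`. -/
theorem lt_of_mem_sieving {w r R p : ℕ} (hw : w ≤ r) (hp : p ∈ smallPrimes w r ∪ largePrimes r R) :
    p.Prime ∧ w < p := by
  rcases mem_union.1 hp with h | h
  · rw [mem_smallPrimes] at h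
    exact ⟨h.1, h.2.1⟩
  · rw [mem_largePrimes] at h
    have h1 : r ^ 2 < 2 ^ r ^ 2 := Nat.lt_two_pow_self
    have h2 := le_sq_nat r
    exact ⟨h.1, by omega⟩

theorem intCast_ne_zero_of_abs_lt {p : ℕ} {a : ℤ} (ha : a ≠ 0) (h : a.natAbs < p) : (a : ZMod p) ≠ 0 := by
  rw [Ne, ZMod.intCast_zmod_eq_zero_iff_dvd]
  intro hd
  have := Nat.le_of_dvd (Int.natAbs_pos.2 ha) (Int.natCast_dvd.1 hd)
  omega

/-- Two rational vectors that are not proportional have a non-zero minor. -/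
theorem exists_minor_ne_zero {t : ℕ} {u v : Fin t → ℚ} (hv : v ≠ 0) (h : ∀ c : ℚ, u ≠ c • v) :
    ∃ j j', u j * v j' - u j' * v j ≠ 0 := by
  obtain ⟨j', hj'⟩ := Function.ne_iff.1 hv
  obtain ⟨j, hj⟩ := Function.ne_iff.1 (h (u j' / v j'))
  refine ⟨j, j', fun h0 => hj ?_⟩
  rw [Pi.zero_apply] at hj'
  simp only [Pi.smul_apply, smul_eq_mul]
  field_simp
  linarith

/-- Multiplication by a common denominator turns rational coefficients modulo `N` into integers. -/
theorem ratMod_mul {N : ℕ} [Fact N.Prime] {q : ℚ} {M : ℕ} {a : ℤ} (hden : q.den < N)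
    (ha : (a : ℚ) = M * q) : (M : ZMod N) * ratMod N q = a := by
  have h0 : ((q.den : ℕ) : ZMod N) ≠ 0 := by
    rw [Ne, ZMod.natCast_eq_zero_iff]
    intro h
    have := Nat.le_of_dvd q.den_pos h
    omega
  have h1 : (a * q.den : ℤ) = M * q.num := by
    have h2 : (a : ℚ) * q.den = M * q.num := by
      rw [ha, mul_assoc, Rat.mul_den_eq_num]
    exact_mod_cast h2
  have h3 := congrArg (Int.cast : ℤ → ZMod N) h1
  push_cast at h3
  rw [ratMod, ← mul_assoc, ← h3, mul_assoc, mul_inv_cancel₀ h0, mul_one]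

theorem finite_rat_bounded (n : ℕ) : {q : ℚ | |q.num| ≤ (n : ℤ) ∧ q.den ≤ n}.Finite := by
  have hf : (Set.Icc (-(n : ℤ)) n ×ˢ Set.Iic n).Finite := (Set.finite_Icc _ _).prod (Set.finite_Iic n)
  refine Set.Finite.of_finite_image (f := fun q : ℚ => (q.num, q.den)) (hf.subset ?_) ?_
  · rintro _ ⟨q, hq, rfl⟩
    exact ⟨abs_le.1 hq.1, hq.2⟩
  · intro q _ q' _ h
    rw [Prod.mk.injEq] at h
    exact Rat.ext h.1 h.2

/-- The linear forms condition for one system of homogeneous parts, uniformly in the constants. -/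
theorem eventually_linear_forms {e : ℕ} (he : e ≠ 0) {w : ℕ → ℝ} (hw : Tendsto w atTop atTop)
    (hws : ∀ᶠ N in atTop, w N ≤ scale N) {m t : ℕ} (hm : 8 * m ≤ e) (L : Fin m → Fin t → ℚ) (hL0 : ∀ i, L i ≠ 0)
    (hL : ∀ i i' : Fin m, i ≠ i' → ∀ c : ℚ, L i ≠ c • L i') {ε : ℝ} (hε : 0 < ε) :
    ∀ᶠ N in atTop, ∀ [Fact N.Prime] (b : Fin m → ZMod N),
      |avg (fun x : Fin t → ZMod N =>
        ∏ i, majorantFamily e w N (affineForm N (L i) (b i) x)) - 1| ≤ ε := by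
  set M : ℕ := ∏ i, ∏ j, (L i j).den with hM
  have hM0 : M ≠ 0 := prod_ne_zero_iff.2 fun i _ => prod_ne_zero_iff.2 fun j _ => (L i j).den_nz
  have hM0' : (M : ℚ) ≠ 0 := by exact_mod_cast hM0
  have hint : ∀ i j, ∃ a : ℤ, (a : ℚ) = M * L i j := by
    intro i j
    have hd : (L i j).den ∣ M := (dvd_prod_of_mem (fun j => (L i j).den) (mem_univ j)).trans
      (dvd_prod_of_mem (fun i => ∏ j, (L i j).den) (mem_univ i))
    obtain ⟨d, hd⟩ := hd
    refine ⟨d * (L i j).num, ?_⟩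
    rw [hd]
    push_cast
    rw [mul_right_comm, mul_comm ((L i j).den : ℚ), Rat.mul_den_eq_num, mul_comm]
  choose l hl using hint
  -- Crude bounds for the integer coefficients, their minors, and the denominators: the sieving primes
  -- exceed `C` and `B`, so they divide no non-zero coefficient and no non-zero minor.
  set C : ℕ := ∑ i, ∑ j, (l i j).natAbs with hC
  set B : ℕ := ∑ i, ∑ j, ∑ i', ∑ j', (l i j * l i' j' - l i j' * l i' j).natAbs with hB
  set D : ℕ := ∑ i, ∑ j, (L i j).den with hD
  have hlC : ∀ i j, (l i j).natAbs ≤ C := fun i j =>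
    (Finset.single_le_sum (f := fun j => (l i j).natAbs) (fun _ _ => Nat.zero_le _) (mem_univ j)).trans
      (Finset.single_le_sum (f := fun i => ∑ j, (l i j).natAbs) (fun _ _ => Nat.zero_le _) (mem_univ i))
  have hLD : ∀ i j, (L i j).den ≤ D := fun i j =>
    (Finset.single_le_sum (f := fun j => (L i j).den) (fun _ _ => Nat.zero_le _) (mem_univ j)).trans
      (Finset.single_le_sum (f := fun i => ∑ j, (L i j).den) (fun _ _ => Nat.zero_le _) (mem_univ i))
  have hlB : ∀ i j i' j', (l i j * l i' j' - l i j' * l i' j).natAbs ≤ B := by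
    intro i j i' j'
    have h1 := Finset.single_le_sum (f := fun j' => (l i j * l i' j' - l i j' * l i' j).natAbs)
      (fun _ _ => Nat.zero_le _) (mem_univ j')
    have h2 := Finset.single_le_sum (f := fun i' => ∑ j', (l i j * l i' j' - l i j' * l i' j).natAbs)
      (fun _ _ => Nat.zero_le _) (mem_univ i')
    have h3 := Finset.single_le_sum
      (f := fun j => ∑ i', ∑ j', (l i j * l i' j' - l i j' * l i' j).natAbs)
      (fun _ _ => Nat.zero_le _) (mem_univ j)
    have h4 := Finset.single_le_sum
      (f := fun i => ∑ j, ∑ i', ∑ j', (l i j * l i' j' - l i j' * l i' j).natAbs)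
      (fun _ _ => Nat.zero_le _) (mem_univ i)
    exact h1.trans (h2.trans (h3.trans h4))
  have hlne : ∀ i, ∃ j, l i j ≠ 0 := by
    intro i
    obtain ⟨j, hj⟩ := Function.ne_iff.1 (hL0 i)
    refine ⟨j, fun h => hj ?_⟩
    have h1 := hl i j
    rw [h, Int.cast_zero, eq_comm, mul_eq_zero] at h1
    exact h1.resolve_left hM0'
  have hminor : ∀ i i', i ≠ i' → ∃ j j', l i j * l i' j' - l i j' * l i' j ≠ 0 := by
    intro i i' hii'
    obtain ⟨j, j', h⟩ := exists_minor_ne_zero (hL0 i') (hL i i' hii')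
    refine ⟨j, j', fun h0 => h ?_⟩
    have h1 := congrArg (Int.cast : ℤ → ℚ) h0
    push_cast at h1
    rw [hl, hl, hl, hl] at h1
    have h2 : (M : ℚ) ^ 2 * (L i j * L i' j' - L i j' * L i' j) = 0 := by linarith
    exact (mul_eq_zero.1 h2).resolve_left (pow_ne_zero 2 hM0')
  obtain ⟨w₀, r₀, hmean⟩ := exists_abs_localMean_sub_one_le (ι := Fin m) (ε := ε / 2) (by positivity)
  have hfloor : Tendsto (fun N => ⌊w N⌋₊) atTop atTop := tendsto_nat_floor_atTop.comp hw
  filter_upwards [eventually_abs_avg_sub_formMean_le (ι := Fin m) (t := t) he (by simpa using hm) w C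
    (ε := ε / 2) (by positivity), tendsto_scale.eventually_ge_atTop r₀,
    hfloor.eventually_ge_atTop (max w₀ (max B C)), eventually_gt_atTop (max 1 (max C D)),
    tendsto_scale.eventually_ge_atTop (max B C), hws] with N h1 h2 h3 h4 h5 hwN hNp b
  simp only [max_le_iff, max_lt_iff] at h3 h4 h5
  have hN1 : 1 ≤ N := h4.1.le
  have hsmall : ∀ p ∈ smallPrimes ⌊w N⌋₊ (scale N) ∪ largePrimes (scale N) (level e N),
      p.Prime ∧ ¬ p ∣ primeProd (w N) ∧ B < p ∧ C < p := by
    intro p hp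
    obtain ⟨hp1, hp2⟩ := lt_of_mem_sieving (Nat.floor_le_of_le hwN) hp
    exact ⟨hp1, not_dvd_primeProd hp1 hp2, by omega, by omega⟩
  have hdens : ∀ (Pr : Finset ℕ), (∀ p ∈ Pr, p.Prime ∧ ¬ p ∣ primeProd (w N) ∧ B < p ∧ C < p) →
      ∀ a : Fin m → ℤ, LocalDensities Pr
        (localDensity a (fun i j => (primeProd (w N) : ℤ) * l i j)) (errorTerm ∅) := by
    intro Pr hPr a
    refine localDensities a _ (fun p hp => (hPr p hp).1) ?_ ∅ ?_
    · intro p hp i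
      obtain ⟨hp1, hp2, hp3, hp4⟩ := hPr p hp
      have := Fact.mk hp1
      obtain ⟨j, hj⟩ := hlne i
      refine ⟨j, ?_⟩
      push_cast
      refine mul_ne_zero ?_ (intCast_ne_zero_of_abs_lt hj ((hlC i j).trans_lt hp4))
      rwa [Ne, ZMod.natCast_eq_zero_iff]
    · intro p hp _ i i' hii'
      obtain ⟨hp1, hp2, hp3, hp4⟩ := hPr p hp
      have := Fact.mk hp1
      obtain ⟨j, j', hj⟩ := hminor i i' hii'
      refine (localDensity_pair a _ p ⟨j, j', ?_⟩).le
      have h6 : (primeProd (w N) * l i j * (primeProd (w N) * l i' j') -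
          primeProd (w N) * l i j' * (primeProd (w N) * l i' j) : ℤ) =
          primeProd (w N) ^ 2 * (l i j * l i' j' - l i j' * l i' j) := by ring
      rw [h6, Int.cast_mul]
      refine mul_ne_zero ?_ (intCast_ne_zero_of_abs_lt hj ((hlB i j i' j').trans_lt hp3))
      push_cast
      refine pow_ne_zero 2 ?_
      rwa [Ne, ZMod.natCast_eq_zero_iff]
  have hlN : ∀ i j, (M : ZMod N) * ratMod N (L i j) = (l i j : ZMod N) := fun i j =>
    ratMod_mul ((hLD i j).trans_lt h4.2.2) (hl i j)
  have h6 := h1 M (fun i j => ratMod N (L i j)) b l hlN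
    (fun i hi => by
      obtain ⟨j, hj⟩ := hlne i
      have h7 := hlN i j
      rw [congrFun hi j, Pi.zero_apply, mul_zero] at h7
      exact intCast_ne_zero_of_abs_lt hj ((hlC i j).trans_lt h4.2.1) h7.symm)
    (fun i => by
      rw [hC]
      push_cast
      exact Finset.single_le_sum (f := fun i => ∑ j, |l i j|)
        (fun _ _ => sum_nonneg fun _ _ => abs_nonneg _) (mem_univ i))
  have h7 : |avg (formMean e w (fun i j => ratMod N (L i j)) b l) - 1| ≤ ε / 2 := by
    rw [← avg_const (A := Fin t → ZMod N) 1, ← avg_sub]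
    refine (abs_avg_le _).trans ?_
    rw [← avg_const (A := Fin t → ZMod N) (ε / 2)]
    refine avg_mono fun x => ?_
    refine hmean _ _ _ h3.1 h2 (one_le_level hN1)
      ((level_le hN1 he).trans (lt_two_pow_scale N).le) _ (hdens _ ?_ _) (hdens _ ?_ _)
    · exact fun p hp => hsmall p (mem_union_left _ hp)
    · exact fun p hp => hsmall p (mem_union_right _ hp)
  have h8 := (abs_sub_le _ _ 1).trans (add_le_add h6 h7)
  rw [add_halves] at h8
  exact h8

end PrimeMajorant

namespace PrimeMajorant

/-- The coefficients have bounded height, so there are finitely many systems of homogeneous parts to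
consider, and the linear forms condition follows from its instances for these. -/
theorem linearFormsCondition_majorantFamily {e m₀ : ℕ} (t₀ L₀ : ℕ) (he : e ≠ 0) (hm₀ : 8 * m₀ ≤ e)
    {w : ℕ → ℝ} (hw : Tendsto w atTop atTop) (hws : ∀ᶠ N in atTop, w N ≤ scale N) :
    LinearFormsCondition m₀ t₀ L₀ (majorantFamily e w) := by
  intro ε hε
  have hfin : ∀ m t : ℕ, {L : Fin m → Fin t → ℚ | ∀ i j, |(L i j).num| ≤ (L₀ : ℤ) ∧ (L i j).den ≤ L₀}.Finite :=
    fun m t => (Set.Finite.pi' fun _ => Set.Finite.pi' fun _ => finite_rat_bounded L₀).subset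
      fun L hL i j => hL i j
  have h : ∀ᶠ N in atTop, ∀ m ∈ range (m₀ + 1), ∀ t ∈ range (t₀ + 1),
      ∀ L ∈ {L : Fin m → Fin t → ℚ | ∀ i j, |(L i j).num| ≤ (L₀ : ℤ) ∧ (L i j).den ≤ L₀},
      (∀ i, L i ≠ 0) → (∀ i i' : Fin m, i ≠ i' → ∀ c : ℚ, L i ≠ c • L i') →
      ∀ [Fact N.Prime] (b : Fin m → ZMod N), |avg (fun x : Fin t → ZMod N =>
        ∏ i, majorantFamily e w N (affineForm N (L i) (b i) x)) - 1| ≤ ε := by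
    rw [eventually_all_finset]
    intro m hm
    rw [eventually_all_finset]
    intro t _
    rw [eventually_all_finite (hfin m t)]
    intro L _
    by_cases h1 : (∀ i, L i ≠ 0) ∧ ∀ i i' : Fin m, i ≠ i' → ∀ c : ℚ, L i ≠ c • L i'
    · rw [mem_range] at hm
      filter_upwards [eventually_linear_forms he hw hws (by omega) L h1.1 h1.2 hε] with N hN _ _
      exact hN
    · exact Eventually.of_forall fun N h2 h3 => absurd ⟨h2, h3⟩ h1
  obtain ⟨N₀, hN₀⟩ := eventually_atTop.1 h
  exact ⟨N₀, fun N _ hN m t _ hm _ ht L b hL hL0 hLL =>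
    hN₀ N hN m (by simpa using Nat.lt_succ_of_le hm) t (by simpa using Nat.lt_succ_of_le ht) L hL hL0 hLL b⟩

/-- The mean value of `ν` is the instance of a single form `x` of the linear forms condition. -/
theorem isMeasure_of_linearForms {m₀ t₀ L₀ : ℕ} (hm : 1 ≤ m₀) (ht : 1 ≤ t₀) (hL : 1 ≤ L₀)
    {ν : ∀ N : ℕ, ZMod N → ℝ} (hν : ∀ N x, 0 ≤ ν N x) (h : LinearFormsCondition m₀ t₀ L₀ ν) :
    IsMeasure ν where
  nonneg := hν
  mean ε hε := by
    obtain ⟨N₀, hN₀⟩ := h ε hε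
    refine ⟨N₀, fun N _ hN => ?_⟩
    have h1 := hN₀ N hN 1 1 le_rfl hm le_rfl ht (fun _ _ => 1) (fun _ => 0)
      (fun _ _ => by simpa using hL) (fun _ h => one_ne_zero (congrFun h 0))
      (fun i i' hii' => absurd (Subsingleton.elim i i') hii')
    have h2 : avg (fun x : Fin 1 → ZMod N => ∏ i : Fin 1, ν N (affineForm N (fun _ => 1) 0 x)) =
        avg (ν N) := by
      rw [← avg_equiv (Equiv.funUnique (Fin 1) (ZMod N)) (ν N)]
      refine congrArg avg (funext fun x => ?_)
      simp [affineForm, ratMod]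
    rwa [h2] at h1

/-! ### The weights of the correlation condition -/

/-- The function `∏_{p ∣ v} (1 + c/p)`. -/
noncomputable def divisorProd (c : ℝ) (v : ℕ) : ℝ := ∏ p ∈ v.primeFactors, (1 + c / p)

theorem one_le_divisorProd {c : ℝ} (hc : 0 ≤ c) (v : ℕ) : 1 ≤ divisorProd c v :=
  one_le_prod fun p _ => by
    have : 0 ≤ c / (p : ℝ) := by positivity
    linarith

/-- The weights `τ` of the correlation condition. At `0` they are the trivial bound
`e^{237 r³}` for the majorants (`majorant_le`), to the power `m`. The integers `v` and `N - v`, where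
`v` represents `h`, are the possible differences (up to sign) of the representatives of `x + h` and
`x`. -/
noncomputable def corrWeight (C c : ℝ) (m N : ℕ) (h : ZMod N) : ℝ :=
  if h = 0 then Real.exp (237 * scale N ^ 3) ^ m
  else C * (divisorProd c h.val * divisorProd c (N - h.val)) ^ m ^ 2

theorem corrWeight_nonneg {C c : ℝ} (hC : 0 ≤ C) (hc : 0 ≤ c) (m N : ℕ) (h : ZMod N) :
    0 ≤ corrWeight C c m N h := by
  have h1 := one_le_divisorProd hc h.val
  have h2 := one_le_divisorProd hc (N - h.val)
  unfold corrWeight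
  split_ifs <;> positivity

theorem one_add_mul_pow_le {c x : ℝ} (hc : 0 ≤ c) (hx : 0 ≤ x) (hx1 : x ≤ 1) (D : ℕ) :
    (1 + c * x) ^ D ≤ 1 + ((1 + c) ^ D - 1) * x := by
  induction D with
  | zero => simp
  | succ D ih =>
    have h1 : 1 ≤ (1 + c) ^ D := one_le_pow₀ (by linarith)
    have h2 : 0 ≤ c * x := mul_nonneg hc hx
    rw [pow_succ, pow_succ]
    calc _ ≤ (1 + ((1 + c) ^ D - 1) * x) * (1 + c * x) := by gcongr
      _ ≤ _ := by
        have h3 : 0 ≤ ((1 + c) ^ D - 1) * c * (x * (1 - x)) :=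
          mul_nonneg (mul_nonneg (by linarith) hc) (mul_nonneg hx (by linarith))
        nlinarith

/-- Powers of the function `∏_{p ∣ v} (1 + c/p)` are bounded by the same function with a larger `c`, so
that its moments are bounded as soon as its averages are. -/
theorem divisorProd_pow_le {c : ℝ} (hc : 0 ≤ c) (D v : ℕ) :
    divisorProd c v ^ D ≤ divisorProd ((1 + c) ^ D) v := by
  unfold divisorProd
  rw [← prod_pow]
  refine prod_le_prod (fun _ _ => by positivity) fun p hp => ?_
  have hp1 : (1 : ℝ) ≤ p := by exact_mod_cast (Nat.prime_of_mem_primeFactors hp).one_le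
  have h1 := one_add_mul_pow_le hc (x := 1 / p) (by positivity)
    ((div_le_one (by positivity)).2 hp1) D
  rw [mul_one_div, mul_one_div] at h1
  refine h1.trans ?_
  gcongr
  linarith

theorem mul_pow_le_add_pow {a b : ℝ} (ha : 0 ≤ a) (hb : 0 ≤ b) (n : ℕ) :
    (a * b) ^ n ≤ a ^ (2 * n) + b ^ (2 * n) := by
  rw [mul_pow, mul_comm 2, pow_mul, pow_mul]
  have h1 : 0 ≤ a ^ n := pow_nonneg ha n
  have h2 : 0 ≤ b ^ n := pow_nonneg hb n
  nlinarith [sq_nonneg (a ^ n - b ^ n)]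

/-- The trivial bound `e^{O(r³)}` for the majorants is smaller than `N`; so the value of the weights at
`0`, being attained with probability `1/N`, does not affect the boundedness of their moments. -/
theorem exp_cube_le_mul {B : ℝ} (hB : 0 ≤ B) {N : ℕ} (hN : N ≠ 0) :
    Real.exp (B * scale N ^ 3) ≤ Real.exp (8 * B ^ 4) * N := by
  set r : ℝ := (scale N : ℝ) with hr
  have hr0 : 0 ≤ r := Nat.cast_nonneg _
  have h1 : Real.exp (r ^ 4 / 2) ≤ N := by
    have h2 : ((2 : ℝ) ^ scale N ^ 4) ≤ N := by exact_mod_cast two_pow_scale_le hN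
    refine le_trans ?_ h2
    rw [← Real.exp_log (show (0 : ℝ) < 2 ^ scale N ^ 4 by positivity), Real.log_pow]
    refine Real.exp_le_exp.2 ?_
    have := Real.log_two_gt_d9
    push_cast
    rw [← hr]
    have : 0 ≤ r ^ 4 := by positivity
    nlinarith
  refine le_trans ?_ (mul_le_mul_of_nonneg_left h1 (Real.exp_pos _).le)
  rw [← Real.exp_add]
  refine Real.exp_le_exp.2 ?_
  have h3 : 0 ≤ r ^ 3 := by positivity
  rcases le_total r (2 * B) with h | h
  · have h4 : r ^ 3 ≤ (2 * B) ^ 3 := pow_le_pow_left₀ hr0 h 3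
    have h5 : 0 ≤ r ^ 4 := by positivity
    nlinarith
  · have h4 : 0 ≤ B ^ 4 := by positivity
    nlinarith

/-- The weights have bounded moments. -/
theorem exists_avg_corrWeight_rpow_le {C c : ℝ} (hC : 0 ≤ C) (hc : 0 ≤ c) (m : ℕ) {q : ℝ} (hq : 1 ≤ q) :
    ∃ K : ℝ, ∀ (N : ℕ) [Fact N.Prime], avg (fun x : ZMod N => corrWeight C c m N x ^ q) ≤ K := by
  set D := m ^ 2 * ⌈q⌉₊ with hD
  set c' := (1 + c) ^ (2 * D) with hc'
  have hc'0 : 0 ≤ c' := by positivity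
  refine ⟨Real.exp (8 * (237 * (m * q)) ^ 4) + C ^ q * (Real.exp (c' * 2) + Real.exp (c' * 2)),
    fun N hN => ?_⟩
  have hN0 : (0 : ℝ) < N := by exact_mod_cast hN.out.pos
  have hzero : corrWeight C c m N 0 ^ q ≤ Real.exp (8 * (237 * (m * q)) ^ 4) * N := by
    have h1 : corrWeight C c m N 0 ^ q = Real.exp (237 * (m * q) * scale N ^ 3) := by
      rw [corrWeight, if_pos rfl, ← Real.exp_nat_mul, ← Real.exp_mul]
      ring_nf
    rw [h1]
    exact exp_cube_le_mul (by positivity) hN.out.ne_zero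
  have hne : ∀ x : ZMod N, x ≠ 0 → corrWeight C c m N x ^ q ≤
      C ^ q * (divisorProd c' x.val + divisorProd c' (N - x.val)) := by
    intro x hx
    have h1 := one_le_divisorProd hc x.val
    have h2 := one_le_divisorProd hc (N - x.val)
    have h3 : 1 ≤ divisorProd c x.val * divisorProd c (N - x.val) :=
      one_le_mul_of_one_le_of_one_le h1 h2
    rw [corrWeight, if_neg hx, Real.mul_rpow hC (by positivity)]
    refine mul_le_mul_of_nonneg_left ?_ (Real.rpow_nonneg hC q)
    calc ((divisorProd c x.val * divisorProd c (N - x.val)) ^ m ^ 2) ^ q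
        ≤ ((divisorProd c x.val * divisorProd c (N - x.val)) ^ m ^ 2) ^ (⌈q⌉₊ : ℝ) :=
          Real.rpow_le_rpow_of_exponent_le (one_le_pow₀ h3) (Nat.le_ceil q)
      _ = (divisorProd c x.val * divisorProd c (N - x.val)) ^ D := by
          rw [Real.rpow_natCast, ← pow_mul]
      _ ≤ divisorProd c x.val ^ (2 * D) + divisorProd c (N - x.val) ^ (2 * D) :=
          mul_pow_le_add_pow (by linarith) (by linarith) D
      _ ≤ _ := add_le_add (divisorProd_pow_le hc _ _) (divisorProd_pow_le hc _ _)
  have hmem : ∀ x ∈ univ.erase (0 : ZMod N), 0 < x.val ∧ x.val < N := fun x hx =>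
    ⟨Nat.pos_of_ne_zero fun h => (mem_erase.1 hx).1 ((ZMod.val_eq_zero x).1 h), ZMod.val_lt x⟩
  have hd0 : ∀ v, 0 ≤ divisorProd c' v := fun v => zero_le_one.trans (one_le_divisorProd hc'0 v)
  have hsum1 : ∑ x ∈ univ.erase (0 : ZMod N), divisorProd c' x.val ≤ N * Real.exp (c' * 2) := by
    refine le_trans ?_ (sum_prod_primeFactors_le hc'0 N)
    refine sum_le_sum_of_injOn (g := divisorProd c') ZMod.val (ZMod.val_injective N).injOn
      (fun x hx => ?_) (fun _ _ => le_rfl) fun v _ => hd0 v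
    have := hmem x hx
    exact mem_Icc.2 ⟨this.1, this.2.le⟩
  have hsum2 : ∑ x ∈ univ.erase (0 : ZMod N), divisorProd c' (N - x.val) ≤ N * Real.exp (c' * 2) := by
    refine le_trans ?_ (sum_prod_primeFactors_le hc'0 N)
    refine sum_le_sum_of_injOn (g := divisorProd c') (fun x => N - x.val) ?_
      (fun x hx => ?_) (fun _ _ => le_rfl) fun v _ => hd0 v
    · intro x _ y _ hxy
      have h1 := ZMod.val_lt x
      have h2 := ZMod.val_lt y
      simp only at hxy
      exact ZMod.val_injective N (by omega)
    · have := hmem x hx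
      exact mem_Icc.2 ⟨by omega, by omega⟩
  unfold avg
  rw [ZMod.card, div_le_iff₀ hN0, ← add_sum_erase univ _ (mem_univ (0 : ZMod N))]
  calc _ ≤ Real.exp (8 * (237 * (m * q)) ^ 4) * N + ∑ x ∈ univ.erase (0 : ZMod N),
        C ^ q * (divisorProd c' x.val + divisorProd c' (N - x.val)) :=
        add_le_add hzero (sum_le_sum fun x hx => hne x (mem_erase.1 hx).1)
    _ = Real.exp (8 * (237 * (m * q)) ^ 4) * N + C ^ q * (∑ x ∈ univ.erase (0 : ZMod N),
        divisorProd c' x.val + ∑ x ∈ univ.erase (0 : ZMod N), divisorProd c' (N - x.val)) := by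
        rw [← mul_sum, sum_add_distrib]
    _ ≤ Real.exp (8 * (237 * (m * q)) ^ 4) * N +
        C ^ q * (N * Real.exp (c' * 2) + N * Real.exp (c' * 2)) := by
        have := Real.rpow_nonneg hC q
        gcongr
    _ = _ := by ring

theorem prod_union_le {s t : Finset ℕ} {f : ℕ → ℝ} (hf : ∀ p, 1 ≤ f p) :
    ∏ p ∈ s ∪ t, f p ≤ (∏ p ∈ s, f p) * ∏ p ∈ t, f p := by
  rw [← prod_union_inter]
  exact le_mul_of_one_le_right (prod_nonneg fun p _ => zero_le_one.trans (hf p))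
    (one_le_prod fun p _ => hf p)

theorem prod_le_prod_prod {κ : Type*} {S : Finset ℕ} {T : Finset κ} {u : κ → Finset ℕ} {f : ℕ → ℝ}
    (hf : ∀ p, 1 ≤ f p) (hS : ∀ p ∈ S, ∃ k ∈ T, p ∈ u k) :
    ∏ p ∈ S, f p ≤ ∏ k ∈ T, ∏ p ∈ u k, f p := by
  classical
  have h1 : ∏ p ∈ S, f p ≤ ∏ p ∈ T.biUnion u, f p := by
    refine prod_le_prod_of_subset_of_one_le (fun p hp => mem_biUnion.2 (hS p hp)) ?_ fun p _ _ => hf p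
    exact fun p _ => zero_le_one.trans (hf p)
  refine h1.trans ?_
  clear h1 hS
  induction T using Finset.induction_on with
  | empty => simp
  | insert a s ha ih =>
    rw [biUnion_insert, prod_insert ha]
    refine (prod_union_le hf).trans ?_
    exact mul_le_mul_of_nonneg_left ih (prod_nonneg fun p _ => zero_le_one.trans (hf p))

/-- This bounds products over the pairs of translates by sums of powers, as the correlation condition
asks for a sum of weights. -/
theorem prod_le_sum_pow {κ : Type*} {T : Finset κ} (hT : T.Nonempty) {Y : κ → ℝ}
    (hY : ∀ k, 1 ≤ Y k) {n : ℕ} (hn : #T ≤ n) : ∏ k ∈ T, Y k ≤ ∑ k ∈ T, Y k ^ n := by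
  obtain ⟨k₀, hk₀, hmax⟩ := exists_max_image T Y hT
  calc ∏ k ∈ T, Y k ≤ ∏ _k ∈ T, Y k₀ :=
        prod_le_prod (fun k _ => zero_le_one.trans (hY k)) hmax
    _ = Y k₀ ^ #T := prod_const _
    _ ≤ Y k₀ ^ n := pow_le_pow_right₀ (hY k₀) hn
    _ ≤ _ := single_le_sum (f := fun k => Y k ^ n)
        (fun k _ => pow_nonneg (zero_le_one.trans (hY k)) n) hk₀

theorem val_sub_val_eq {N : ℕ} [NeZero N] (x y : ZMod N) :
    (x.val : ℤ) - y.val = (x - y).val ∨ (x.val : ℤ) - y.val = (x - y).val - N := by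
  have hx := ZMod.val_lt x
  have hy := ZMod.val_lt y
  have h1 : ((x - y).val : ℤ) = ((x.val : ℤ) - y.val) % N := by
    rw [← ZMod.val_intCast]
    push_cast
    rw [ZMod.natCast_zmod_val, ZMod.natCast_zmod_val]
  rcases le_or_gt 0 ((x.val : ℤ) - y.val) with h | h
  · left
    rw [h1, Int.emod_eq_of_lt h (by omega)]
  · right
    rw [h1, ← Int.add_emod_right, Int.emod_eq_of_lt (by omega) (by omega)]
    ring

end PrimeMajorant

/-! ### The correlation condition -/

namespace PrimeMajorant

variable {m : ℕ}

/-- The primes at which two of the translates with representatives `a i` are dependent. -/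
def collisionPrimes (S : Finset ℕ) (a : Fin m → ℤ) : Finset ℕ :=
  S.filter fun p => ∃ i i', i ≠ i' ∧ (p : ℤ) ∣ a i - a i'

/-- At a prime `p` not dividing `W` that divides none of the differences `aᵢ - aᵢ'`, no two of the
translates `W (y + aᵢ) + 1` are divisible by `p` at once. -/
theorem localDensities_translates {W : ℕ} {S S' : Finset ℕ} (hS : S' ⊆ S)
    (hp : ∀ p ∈ S', p.Prime ∧ ¬ p ∣ W) (a : Fin m → ℤ) :
    LocalDensities S' (localDensity (fun i => W * a i + 1) (fun _ (_ : Fin 1) => (W * 1 : ℤ)))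
      (errorTerm (collisionPrimes S a)) := by
  refine localDensities _ _ (fun p h => (hp p h).1) ?_ _ ?_
  · intro p h i
    refine ⟨0, ?_⟩
    push_cast
    rw [mul_one, Ne, ZMod.natCast_eq_zero_iff]
    exact (hp p h).2
  · intro p h hE i i' hii'
    have h0 : IsEmpty {y : Fin 1 → ZMod p // ∀ k ∈ ({i, i'} : Finset (Fin m)),
        ((W * a k + 1 : ℤ) : ZMod p) + ∑ j, ((W * 1 : ℤ) : ZMod p) * y j = 0} := by
      refine ⟨fun y => hE ?_⟩
      have h1 := y.2 i (by simp)
      have h2 := y.2 i' (by simp)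
      have h3 : (((W : ℤ) * (a i - a i') : ℤ) : ZMod p) = 0 := by
        have h4 := sub_eq_zero.2 (h1.trans h2.symm)
        push_cast at h4 ⊢
        rw [← h4]
        ring
      rw [ZMod.intCast_zmod_eq_zero_iff_dvd] at h3
      refine mem_filter.2 ⟨hS h, i, i', hii', ?_⟩
      refine ((Nat.prime_iff_prime_int.1 (hp p h).1).dvd_or_dvd h3).resolve_left fun h5 => ?_
      exact (hp p h).2 (by exact_mod_cast h5)
    rw [localDensity, Nat.card_of_isEmpty]
    simp only [Nat.cast_zero, zero_div]
    positivity

/-- There are few large exceptional primes, since a non-zero integer of absolute value less than `2^{(r+1)⁴}`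
has at most `(r+1)⁴` prime factors. -/
theorem card_largePrimes_collision_le {r R : ℕ} (hr : 1 ≤ r) (S : Finset ℕ) {a : Fin m → ℤ}
    (ha : Function.Injective a) (hlt : ∀ i i', (a i - a i').natAbs < 2 ^ (r + 1) ^ 4) :
    (#((largePrimes r R).filter (· ∈ collisionPrimes S a)) : ℝ) ≤ polyBound (m ^ 2 + 1) r := by
  set T : Finset (Fin m × Fin m) := univ.filter fun q => q.1 ≠ q.2 with hT
  set u : Fin m × Fin m → Finset ℕ := fun q =>
    (largePrimes r R).filter fun p => p ∣ (a q.1 - a q.2).natAbs with hu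
  have hsub : (largePrimes r R).filter (· ∈ collisionPrimes S a) ⊆ T.biUnion u := by
    intro p hp
    rw [mem_filter, collisionPrimes, mem_filter] at hp
    obtain ⟨hp1, -, i, i', hii', hd⟩ := hp
    exact mem_biUnion.2 ⟨(i, i'), mem_filter.2 ⟨mem_univ _, hii'⟩,
      mem_filter.2 ⟨hp1, Int.natCast_dvd.1 hd⟩⟩
  have hcard : ∀ q ∈ T, #(u q) ≤ (r + 1) ^ 4 := by
    intro q hq
    have hne : (a q.1 - a q.2).natAbs ≠ 0 := by
      rw [Int.natAbs_ne_zero, sub_ne_zero]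
      exact ha.ne (mem_filter.1 hq).2
    have h2 : 2 ≤ 2 ^ r ^ 2 := Nat.le_self_pow (by positivity) 2
    have h1 := pow_card_le_of_dvd (P := u q) (z := 2)
      (fun p hp => (mem_largePrimes.1 (mem_filter.1 hp).1).1)
      (fun p hp => h2.trans_lt (mem_largePrimes.1 (mem_filter.1 hp).1).2.1) hne
      (fun p hp => (mem_filter.1 hp).2)
    exact (Nat.pow_lt_pow_iff_right (by norm_num)).1 (h1.trans_lt (hlt _ _)) |>.le
  have h1 : #((largePrimes r R).filter (· ∈ collisionPrimes S a)) ≤ m ^ 2 * (r + 1) ^ 4 := by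
    refine (card_le_card hsub).trans (card_biUnion_le.trans ((sum_le_sum hcard).trans ?_))
    rw [sum_const, smul_eq_mul]
    refine Nat.mul_le_mul_right _ ((card_le_univ _).trans ?_)
    simp [sq]
  calc (#((largePrimes r R).filter (· ∈ collisionPrimes S a)) : ℝ) ≤
        ((m ^ 2 * (r + 1) ^ 4 : ℕ) : ℝ) := by exact_mod_cast h1
    _ = ((m ^ 2 : ℕ) : ℝ) * ((r : ℝ) + 1) ^ 4 := by push_cast; ring
    _ ≤ polyBound (m ^ 2) r * polyBound 1 r := by
        refine mul_le_mul (natCast_le_polyBound _ _) ?_ (by positivity) (polyBound_pos _ _).le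
        unfold polyBound
        have h2 : (1 : ℝ) ≤ Real.exp (5 * (1 : ℕ)) := Real.one_le_exp (by positivity)
        have h3 : ((r : ℝ) + 1) ^ 4 ≤ ((r : ℝ) + 1) ^ (16 * 1) :=
          pow_le_pow_right₀ (by linarith [Nat.cast_nonneg (α := ℝ) r]) (by norm_num)
        exact h3.trans (le_mul_of_one_le_left (by positivity) h2)
    _ = _ := (polyBound_add _ _ _).symm

/-- The contribution of the exceptional primes to a correlation is bounded by the weights `τ`. -/
theorem prod_collisionPrimes_le {N : ℕ} [NeZero N] {c : ℝ} (hc : 0 ≤ c) (S S' : Finset ℕ)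
    (hS : ∀ p ∈ S', p.Prime) (y : Fin m → ZMod N) (hy : Function.Injective y) :
    ∏ p ∈ S'.filter (· ∈ collisionPrimes S (fun i => ((y i).val : ℤ))), (1 + c / (p : ℝ)) ≤
      ∏ q ∈ (univ : Finset (Fin m × Fin m)).filter (fun q => q.1 < q.2),
        divisorProd c (y q.1 - y q.2).val * divisorProd c (N - (y q.1 - y q.2).val) := by
  have hf : ∀ p : ℕ, 1 ≤ 1 + c / (p : ℝ) := fun p => by
    have : 0 ≤ c / (p : ℝ) := by positivity
    linarith
  have key : ∀ p : ℕ, p.Prime → ∀ i i', i ≠ i' → (p : ℤ) ∣ ((y i).val : ℤ) - (y i').val →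
      p ∈ (y i - y i').val.primeFactors ∪ (N - (y i - y i').val).primeFactors := by
    intro p hp i i' hii' hd
    have hlt := ZMod.val_lt (y i - y i')
    have hpos : (y i - y i').val ≠ 0 := by
      rw [Ne, ZMod.val_eq_zero, sub_eq_zero]
      exact hy.ne hii'
    rw [mem_union, Nat.mem_primeFactors, Nat.mem_primeFactors]
    rcases val_sub_val_eq (y i) (y i') with h | h
    · left
      rw [h] at hd
      exact ⟨hp, by exact_mod_cast hd, hpos⟩
    · right
      rw [h, ← dvd_neg, neg_sub, ← Nat.cast_sub hlt.le] at hd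
      exact ⟨hp, by exact_mod_cast hd, by omega⟩
  calc _ ≤ ∏ q ∈ (univ : Finset (Fin m × Fin m)).filter (fun q => q.1 < q.2),
        ∏ p ∈ (y q.1 - y q.2).val.primeFactors ∪ (N - (y q.1 - y q.2).val).primeFactors,
          (1 + c / (p : ℝ)) := by
        refine prod_le_prod_prod hf fun p hp => ?_
        rw [mem_filter, collisionPrimes, mem_filter] at hp
        obtain ⟨hp1, -, i, i', hii', hd⟩ := hp
        rcases lt_or_gt_of_ne hii' with h | h
        · exact ⟨(i, i'), mem_filter.2 ⟨mem_univ _, h⟩, key p (hS p hp1) i i' hii' hd⟩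
        · refine ⟨(i', i), mem_filter.2 ⟨mem_univ _, h⟩, key p (hS p hp1) i' i hii'.symm ?_⟩
          rw [← dvd_neg, neg_sub]
          exact hd
    _ ≤ _ := prod_le_prod (fun _ _ => prod_nonneg fun p _ => zero_le_one.trans (hf p))
        fun q _ => prod_union_le hf

theorem sum_pairs_eq (f : Fin m × Fin m → ℝ) :
    ∑ q ∈ (univ : Finset (Fin m × Fin m)).filter (fun q => q.1 < q.2), f q =
      ∑ i : Fin m, ∑ j ∈ univ.filter (fun j : Fin m => i < j), f (i, j) := by
  rw [sum_filter, Fintype.sum_prod_type]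
  simp only [sum_filter]

/-- For distinct `hᵢ` the local means are bounded by products over the exceptional primes, which depend
on the differences `hᵢ - hⱼ` only; if two of the `hᵢ` agree, the trivial bound is a term of the sum. -/
theorem exists_correlation_bound {e : ℕ} (he : e ≠ 0) (hm1 : 1 < m) (hm : 8 * m ≤ e) {w : ℕ → ℝ}
    (hws : ∀ᶠ N in atTop, w N ≤ scale N)
    (hWN : ∀ᶠ N in atTop, primeProd (w N) * N + 1 ≤ N ^ 2) :
    ∃ C : ℝ, 0 ≤ C ∧ ∀ᶠ N in atTop, ∀ [Fact N.Prime] (h : Fin m → ZMod N),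
      avg (fun x : ZMod N => ∏ i, majorantFamily e w N (x + h i)) ≤
        ∑ i : Fin m, ∑ j ∈ univ.filter (fun j : Fin m => i < j),
          corrWeight C (4 ^ m) m N (h i - h j) := by
  obtain ⟨r₀, hr₀⟩ := exists_abs_localMean_le (ι := Fin m) (m ^ 2 + 1)
  set C' : ℝ := 2 * (1 + Real.exp (4 ^ m)) with hC'
  have hC'0 : 0 ≤ C' := by positivity
  refine ⟨C' + 1, by positivity, ?_⟩
  have hc : (0 : ℝ) ≤ 4 ^ m := by positivity
  filter_upwards [tendsto_scale.eventually_ge_atTop (max 1 r₀), hws, hWN, eventually_ge_atTop 1,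
    eventually_abs_avg_sub_formMean_le (ι := Fin m) (t := 1) he (by simpa using hm) w 1 one_pos]
    with N hr hwN hWN hN1 hmean hNp h
  rw [max_le_iff] at hr
  have hτ : ∀ x : ZMod N, 0 ≤ corrWeight (C' + 1) (4 ^ m) m N x :=
    fun x => corrWeight_nonneg (by positivity) hc m N x
  have hR1 : 1 ≤ level e N := one_le_level hN1
  have hR2 : level e N ≤ 2 ^ (scale N + 1) ^ 4 := (level_le hN1 he).trans (lt_two_pow_scale N).le
  by_cases hinj : Function.Injective h
  · set T := (univ : Finset (Fin m × Fin m)).filter fun q => q.1 < q.2 with hT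
    have hTne : T.Nonempty :=
      ⟨(⟨0, by omega⟩, ⟨1, hm1⟩), mem_filter.2 ⟨mem_univ _, by simp [Fin.lt_def]⟩⟩
    have hTcard : #T ≤ m ^ 2 := (card_le_univ _).trans (by simp [sq])
    set Y : Fin m × Fin m → ℝ := fun q =>
      divisorProd (4 ^ m) (h q.1 - h q.2).val * divisorProd (4 ^ m) (N - (h q.1 - h q.2).val) with hY
    have hY1 : ∀ q, 1 ≤ Y q := fun q =>
      one_le_mul_of_one_le_of_one_le (one_le_divisorProd hc _) (one_le_divisorProd hc _)
    have hform : ∀ x : Fin 1 → ZMod N, |formMean e w (fun (_ : Fin m) (_ : Fin 1) => (1 : ZMod N)) h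
        (fun _ _ => 1) x| ≤ C' * ∏ q ∈ T, Y q := by
      intro x
      set y : Fin m → ZMod N := fun i => ∑ j : Fin 1, 1 * x j + h i with hy
      have hyi : Function.Injective y := fun i i' hii' => hinj (add_left_cancel hii')
      set a : Fin m → ℤ := fun i => ((y i).val : ℤ) with ha
      have hai : Function.Injective a := fun i i' hii' => hyi (ZMod.val_injective N
        (Nat.cast_injective (R := ℤ) hii'))
      set S := smallPrimes ⌊w N⌋₊ (scale N) ∪ largePrimes (scale N) (level e N) with hS
      have hSp : ∀ p ∈ S, p.Prime ∧ ¬ p ∣ primeProd (w N) := fun p hp => by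
        obtain ⟨h1, h2⟩ := lt_of_mem_sieving (Nat.floor_le_of_le hwN) hp
        exact ⟨h1, not_dvd_primeProd h1 h2⟩
      have hlt : ∀ i i', (a i - a i').natAbs < 2 ^ (scale N + 1) ^ 4 := by
        intro i i'
        have h1 := ZMod.val_lt (y i)
        have h2 := ZMod.val_lt (y i')
        have h3 := lt_two_pow_scale N
        simp only [ha]
        omega
      have h1 := hr₀ ⌊w N⌋₊ (scale N) (level e N) hr.2 hR1 hR2 (collisionPrimes S a)
        (localDensity (fun i => primeProd (w N) * a i + 1)
          (fun _ (_ : Fin 1) => (primeProd (w N) * 1 : ℤ)))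
        (localDensities_translates subset_union_left (fun p hp => hSp p (mem_union_left _ hp)) a)
        (localDensities_translates subset_union_right (fun p hp => hSp p (mem_union_right _ hp)) a)
        (card_largePrimes_collision_le hr.1 S hai hlt)
      rw [Fintype.card_fin] at h1
      refine h1.trans (mul_le_mul_of_nonneg_left ?_ hC'0)
      refine (prod_collisionPrimes_le hc S _ (fun p hp => (mem_smallPrimes.1 hp).1) y hyi).trans
        (le_of_eq ?_)
      refine prod_congr rfl fun q _ => ?_
      simp only [hy, hY, add_sub_add_left_eq_sub]
    have h2 := hmean 1 (fun (_ : Fin m) (_ : Fin 1) => (1 : ZMod N)) h (fun _ _ => 1)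
      (fun _ _ => by simp) (fun _ h0 => one_ne_zero (congrFun h0 0)) (fun _ => by simp)
    have h3 : avg (fun x : ZMod N => ∏ i, majorantFamily e w N (x + h i)) =
        avg (fun x : Fin 1 → ZMod N => ∏ i, majorantFamily e w N (∑ j, 1 * x j + h i)) := by
      rw [← avg_equiv (Equiv.funUnique (Fin 1) (ZMod N))]
      refine congrArg avg (funext fun x => ?_)
      simp
    have h4 : avg (formMean e w (fun (_ : Fin m) (_ : Fin 1) => (1 : ZMod N)) h (fun _ _ => 1)) ≤
        C' * ∏ q ∈ T, Y q := by
      refine (avg_mono fun x => (le_abs_self _).trans (hform x)).trans (le_of_eq (avg_const _))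
    have h5 := prod_le_sum_pow hTne hY1 hTcard
    have h6 : 1 ≤ ∏ q ∈ T, Y q := one_le_prod fun q _ => hY1 q
    rw [h3, ← sum_pairs_eq (fun q => corrWeight (C' + 1) (4 ^ m) m N (h q.1 - h q.2))]
    calc _ ≤ C' * ∏ q ∈ T, Y q + 1 := by have := (abs_le.1 h2).2; linarith
      _ ≤ C' * ∏ q ∈ T, Y q + ∏ q ∈ T, Y q := by linarith
      _ = (C' + 1) * ∏ q ∈ T, Y q := by ring
      _ ≤ (C' + 1) * ∑ q ∈ T, Y q ^ m ^ 2 := by gcongr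
      _ = _ := by
          rw [mul_sum]
          refine sum_congr rfl fun q hq => ?_
          have hne : h q.1 - h q.2 ≠ 0 := by
            rw [sub_ne_zero]
            exact hinj.ne (mem_filter.1 hq).2.ne
          rw [corrWeight, if_neg hne]
  · have hpair : ∃ i j : Fin m, i < j ∧ h i = h j := by
      rw [Function.Injective] at hinj
      push Not at hinj
      obtain ⟨i, j, hij, hne⟩ := hinj
      rcases lt_or_gt_of_ne hne with h1 | h1
      · exact ⟨i, j, h1, hij⟩
      · exact ⟨j, i, h1, hij.symm⟩
    obtain ⟨i, j, hij, hhij⟩ := hpair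
    have hsup : ∀ x : ZMod N, majorantFamily e w N x ≤ Real.exp (237 * scale N ^ 3) := by
      intro x
      have hx := ZMod.val_lt x
      have h1 : primeProd (w N) * x.val + 1 ≤ 2 ^ (2 * (scale N + 1) ^ 4) := by
        calc primeProd (w N) * x.val + 1 ≤ primeProd (w N) * N + 1 := by gcongr
          _ ≤ N ^ 2 := hWN
          _ ≤ (2 ^ (scale N + 1) ^ 4) ^ 2 := Nat.pow_le_pow_left (lt_two_pow_scale N).le 2
          _ = _ := by rw [← pow_mul]; congr 1; ring
      have h2 := majorant_le (w := ⌊w N⌋₊) hr.1 hR1 hR2 (Nat.succ_ne_zero _) h1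
      rw [majorantFamily]
      push_cast at h2
      exact h2
    calc _ ≤ avg (fun _ : ZMod N => Real.exp (237 * scale N ^ 3) ^ m) := by
          refine avg_mono fun x => ?_
          calc _ ≤ ∏ _i : Fin m, Real.exp (237 * scale N ^ 3) :=
                prod_le_prod (fun _ _ => majorantFamily_nonneg _ _ _ _) fun _ _ => hsup _
            _ = _ := by simp
      _ = corrWeight (C' + 1) (4 ^ m) m N (h i - h j) := by
          rw [avg_const, hhij, sub_self, corrWeight, if_pos rfl]
      _ ≤ ∑ j ∈ univ.filter (fun j : Fin m => i < j), corrWeight (C' + 1) (4 ^ m) m N (h i - h j) :=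
          single_le_sum (f := fun j => corrWeight (C' + 1) (4 ^ m) m N (h i - h j))
            (fun _ _ => hτ _) (mem_filter.2 ⟨mem_univ _, hij⟩)
      _ ≤ _ := single_le_sum (f := fun i => ∑ j ∈ univ.filter (fun j : Fin m => i < j),
            corrWeight (C' + 1) (4 ^ m) m N (h i - h j))
            (fun _ _ => sum_nonneg fun _ _ => hτ _) (mem_univ i)

theorem correlationCondition_majorantFamily {e m₀ : ℕ} (he : e ≠ 0) (hm₀ : 8 * m₀ ≤ e) {w : ℕ → ℝ}
    (hws : ∀ᶠ N in atTop, w N ≤ scale N)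
    (hWN : ∀ᶠ N in atTop, primeProd (w N) * N + 1 ≤ N ^ 2) :
    CorrelationCondition m₀ (majorantFamily e w) := by
  intro m hm1 hm
  obtain ⟨C, hC, h⟩ := exists_correlation_bound he hm1 (by omega) hws hWN
  have hc : (0 : ℝ) ≤ 4 ^ m := by positivity
  refine ⟨corrWeight C (4 ^ m) m, corrWeight_nonneg hC hc m,
    fun q hq => exists_avg_corrWeight_rpow_le hC hc m hq, ?_⟩
  obtain ⟨N₀, hN₀⟩ := eventually_atTop.1 h
  exact ⟨N₀, fun N _ hN h => hN₀ N hN h⟩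

/-! ### The lower bound at primes -/

/-- For slowly growing `w` the product `W` is smaller than `N`. -/
theorem eventually_primeProd_mul_le {w : ℕ → ℝ} (hws : ∀ᶠ N in atTop, w N ≤ scale N) :
    ∀ᶠ N in atTop, primeProd (w N) * N + 1 ≤ N ^ 2 := by
  filter_upwards [hws, tendsto_scale.eventually_ge_atTop 2, eventually_ge_atTop 2] with N h1 h2 h3
  have h4 : primeProd (w N) ≤ 4 ^ scale N :=
    (primorial_mono (Nat.floor_le_of_le h1)).trans (primorial_le_four_pow _)
  have h5 : 2 * 4 ^ scale N ≤ N := by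
    refine le_trans ?_ (two_pow_scale_le (by omega))
    calc 2 * 4 ^ scale N = 2 ^ (2 * scale N + 1) := by
          rw [show (4 : ℕ) = 2 ^ 2 by norm_num, ← pow_mul, pow_succ, mul_comm]
      _ ≤ _ := by
          refine Nat.pow_le_pow_right (by norm_num) ?_
          have : 2 ^ 3 * scale N ≤ scale N ^ 4 :=
            (Nat.mul_le_mul_right _ (Nat.pow_le_pow_left h2 3)).trans_eq (by ring)
          omega
  nlinarith

/-- The lower bound for the majorants at the primes `Wn + 1`, with `εN ≤ n < N`. There the majorant is
its normalising factor, at least `(φ(W)/W) log R` with `R = N^{1/e}`, while `log (Wn + 1)` is at most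
`2 log N`. -/
theorem eventually_le_majorantFamily {e : ℕ} (he : 2 ≤ e) {w : ℕ → ℝ}
    (hws : ∀ᶠ N in atTop, w N ≤ scale N) {ε : ℝ} (hε : 0 < ε) :
    ∀ᶠ N : ℕ in atTop, ∀ n : ℕ, ε * N ≤ n → n < N →
      (2 * e : ℝ)⁻¹ * modLambda (primeProd (w N)) n ≤ majorantFamily e w N (n : ZMod N) := by
  filter_upwards [hws, eventually_primeProd_mul_le hws, tendsto_scale.eventually_ge_atTop 2,
    eventually_ge_atTop 1, tendsto_natCast_atTop_atTop.eventually_ge_atTop (1 / ε ^ 2)]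
    with N h1 h2 h3 h4 h5 n hn hnN
  unfold modLambda
  split_ifs with hp
  swap
  · rw [mul_zero]
    exact majorantFamily_nonneg _ _ _ _
  set W := primeProd (w N) with hW
  have hWpos : 0 < W := primorial_pos _
  have hN0 : (0 : ℝ) < N := by exact_mod_cast h4
  -- Since `n ≥ εN` is at least `N^{1/2}`, the prime `Wn + 1` exceeds all sieving primes.
  have hsq : (N : ℝ) ≤ n ^ 2 := by
    have h6 : 1 ≤ N * ε ^ 2 := by rwa [div_le_iff₀ (by positivity)] at h5
    calc (N : ℝ) = N * 1 := (mul_one _).symm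
      _ ≤ N * (N * ε ^ 2) := by gcongr
      _ = (ε * N) ^ 2 := by ring
      _ ≤ _ := by gcongr
  have hsq' : N ≤ n ^ 2 := by exact_mod_cast hsq
  have hnW : n < W * n + 1 := Nat.lt_succ_of_le (Nat.le_mul_of_pos_left n hWpos)
  have hle : ∀ a : ℕ, a ^ 2 ≤ N → a < W * n + 1 := fun a ha =>
    ((Nat.pow_le_pow_iff_left two_ne_zero).1 (ha.trans hsq')).trans_lt hnW
  have hz : (2 ^ scale N ^ 2) ^ 2 ≤ N := by
    refine le_trans ?_ (two_pow_scale_le (by omega))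
    rw [← pow_mul]
    refine Nat.pow_le_pow_right (by norm_num) ?_
    have : 2 ^ 2 ≤ scale N ^ 2 := Nat.pow_le_pow_left h3 2
    calc scale N ^ 2 * 2 ≤ scale N ^ 2 * scale N ^ 2 := Nat.mul_le_mul_left _ (by omega)
      _ = _ := by ring
  have hval : ((n : ZMod N)).val = n := ZMod.val_cast_of_lt hnN
  have h7 := majorant_prime (w := ⌊w N⌋₊) (r := scale N) (R := level e N) (one_le_level h4) hp
    (hle _ hz) (hle _ (level_pow_le_of_le h4 he (by omega)))
  have h8 := totient_mul_log_le (w := ⌊w N⌋₊) (r := scale N) (R := level e N)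
    ((Nat.floor_le_of_le h1).trans ((le_sq_nat _).trans Nat.lt_two_pow_self.le))
  rw [majorantFamily, hval]
  push_cast at h7
  rw [← hW, h7]
  refine le_trans ?_ h8
  have h9 : Real.log (W * n + 1) ≤ 2 * Real.log N := by
    rw [← Nat.cast_ofNat (R := ℝ), ← Real.log_pow]
    refine Real.log_le_log (by positivity) ?_
    have h10 : W * n + 1 ≤ N ^ 2 := le_trans (by gcongr) h2
    exact_mod_cast h10
  have he0 : (0 : ℝ) < e := by exact_mod_cast (by omega : 0 < e)
  have hφ : (0 : ℝ) ≤ (Nat.totient W : ℝ) / W := by positivity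
  calc (2 * e : ℝ)⁻¹ * ((Nat.totient W : ℝ) / W * Real.log (W * n + 1))
      ≤ (2 * e : ℝ)⁻¹ * ((Nat.totient W : ℝ) / W * (2 * Real.log N)) := by gcongr
    _ = (Nat.totient W : ℝ) / W * (Real.log N / e) := by field_simp
    _ ≤ (Nat.totient W : ℝ) / W * Real.log (level e N + 1) := by
        gcongr
        exact log_div_le_log_level e h4

end PrimeMajorant

open PrimeMajorant in
theorem proposition9p1 (k : ℕ) (hk : 2 ≤ k) :
    ∃ w₀ : ℕ → ℝ, Tendsto w₀ atTop atTop ∧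
      ∀ w : ℕ → ℝ, Tendsto w atTop atTop → (∀ᶠ N in atTop, w N ≤ w₀ N) →
        ∃ ν : ∀ N : ℕ, ZMod N → ℝ,
          PrimeMajorant.IsPseudorandom k ν ∧
          ∃ N₀ : ℕ, ∀ N : ℕ, N.Prime → N₀ ≤ N →
            ∀ n : ℕ, PrimeMajorant.epsK k * N ≤ n → (n : ℝ) ≤ 2 * PrimeMajorant.epsK k * N →
              (k : ℝ)⁻¹ * ((2 : ℝ) ^ (k + 5))⁻¹ *
                PrimeMajorant.modLambda (PrimeMajorant.primeProd (w N)) n ≤ ν N (n : ZMod N) := by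
  refine ⟨fun N => scale N, tendsto_natCast_atTop_atTop.comp tendsto_scale, fun w hw hws => ?_⟩
  obtain ⟨j, rfl⟩ : ∃ j, k = j + 1 := ⟨k - 1, by omega⟩
  -- This exponent makes `2e` the constant of the lower bound, and it is at least `8` times the number
  -- of forms, so that the moduli of the sieves are small compared to `N`.
  set e := (j + 1) * 2 ^ (j + 1 + 4) with he
  have he0 : e ≠ 0 := by positivity
  have hpow : 2 ^ (j + 1 + 4) = 32 * 2 ^ j := by ring
  have h1 : 8 * ((j + 1) * 2 ^ (j + 1 - 1)) ≤ e := by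
    rw [he, hpow, Nat.add_sub_cancel]
    nlinarith [Nat.zero_le ((j + 1) * 2 ^ j)]
  have h2 : 8 * 2 ^ (j + 1 - 1) ≤ e := by
    refine le_trans ?_ h1
    nlinarith [Nat.zero_le (j * 2 ^ (j + 1 - 1))]
  have hlin := linearFormsCondition_majorantFamily (3 * (j + 1) - 4) (j + 1) he0 h1 hw hws
  refine ⟨majorantFamily e w, ⟨isMeasure_of_linearForms (Nat.mul_pos (by omega) (by positivity))
    (by omega) (by omega) (majorantFamily_nonneg e w) hlin, hlin,
    correlationCondition_majorantFamily he0 h2 hws (eventually_primeProd_mul_le hws)⟩, ?_⟩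
  have hε : 0 < epsK (j + 1) := by unfold epsK; positivity
  have hε2 : 2 * epsK (j + 1) < 1 := by
    unfold epsK
    have h3 : (2 : ℝ) ≤ 2 ^ (j + 1) := le_self_pow₀ (by norm_num) (by omega)
    have h4 : (2 : ℝ) ≤ (Nat.factorial (j + 1 + 4) : ℝ) := by
      exact_mod_cast (Nat.self_le_factorial (j + 1 + 4)).trans' (by omega)
    rw [mul_one_div, div_lt_one (by positivity)]
    nlinarith
  have he2 : 2 ≤ e := by
    have : 1 ≤ 2 ^ (j + 1 - 1) := Nat.one_le_two_pow
    omega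
  obtain ⟨N₀, hN₀⟩ := eventually_atTop.1 (eventually_le_majorantFamily he2 hws hε)
  refine ⟨N₀, fun N hNp hN n hn1 hn2 => ?_⟩
  have hnN : n < N := by
    have hN0 : (0 : ℝ) < N := by exact_mod_cast hNp.pos
    have : (n : ℝ) < N := by nlinarith
    exact_mod_cast this
  have h5 := hN₀ N hN n hn1 hnN
  have h6 : (2 * e : ℝ)⁻¹ = ((j + 1 : ℕ) : ℝ)⁻¹ * ((2 : ℝ) ^ (j + 1 + 5))⁻¹ := by
    rw [← mul_inv, he]
    push_cast
    ring
  rwa [h6] at h5
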